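/- Let $n\in\mathbb Z$. Let $\mathbb S^7\subset\mathbb H^2$ be the unit sphere, $\langle\langle u,v\rangle\rangle=\bar u^{\mathrm t}v$ the standard Hermitian product, and $\rho_n:\mathbb S^7\to\mathbb S^7$ the map $(\cos t+p\sin t,\;w\sin t)\mapsto(\cos nt+p\sin nt,\;w\sin nt)$, where $p\in\operatorname{Im}\mathbb H$, $w\in\mathbb H$, $|p|^2+|w|^2=1$. Let $E_n^{10}=\{(u,v)\in\mathbb S^7\times\mathbb S^7 : \langle\langle\rho_n(u),v\rangle\rangle=0\}$, let $\Sigma^7_n=E_n^{10}/\mathbb S^3$ be the quotient manifold of the free action $q\star(u,v)=(qu\bar q,qv)$ of the unit quaternions, and let $\mathbb Z_2\times\mathbb Z_2\times\mathrm{SO}(3)$ act on $\Sigma^7_n$ by the action induced by $(B,\pm q)\bullet(u,v)=(Bu,Bv\bar q)$, where $\mathbb Z_2\times\mathbb Z_2$ is the group of diagonal matrices in $\mathrm O(2)$ and $\mathrm{SO}(3)=\mathbb S^3/\{\pm1\}$. Let $\Sigma^5_n\subset\Sigma^7_n$ be the set of classes of points $(u,v)$ such that both quaternionic components of $u$ are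 purely imaginary. Then $\Sigma^5_n$ is an embedded $5$-dimensional smooth submanifold of $\Sigma^7_n$ that is invariant under $\mathbb Z_2\times\mathbb Z_2\times\mathrm{SO}(3)$, and the following holds. (i) If $n$ is even, then $\Sigma^5_n$ is $\mathbb Z_2\times\mathbb Z_2\times\mathrm{SO}(3)$-equivariantly diffeomorphic to the unit sphere $\mathbb S^5\subset(\operatorname{Im}\mathbb H)^2$ with the linear action $(B,\pm q)\cdot u=Bqu\bar q$. (ii) If $n$ is odd, then $\Sigma^5_n$ is $\mathbb Z_2\times\mathbb Z_2\times\mathrm{SO}(3)$-equivariantly diffeomorphic to the Brieskorn sphere $W^5_3$, the intersection of the unit sphere of $\mathbb C\oplus\mathbb C^3$ with the hypersurface $z_0^3+z_1^2+z_2^2+z_3^2=0$, with the restriction to $\mathbb Z_2\times\mathbb Z_2\times\mathrm{SO}(3)$ of the action of $\mathrm O(2)\times\mathrm{SO}(3)$ under which the rotation by $\theta$ together with $A\in\mathrm{SO}(3)$ acts by $(z_0,z)\mapsto(e^{2i\theta}z_0,e^{3i\theta}Az)$ and $\operatorname{diag}(1,-1)$ together with $A$ acts by $(z_0,z)\mapsto(\bar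 z_0,A\bar z)$; here $\mathbb S^3/\{\pm1\}$ acts on $\mathbb R^3=\operatorname{Im}\mathbb H$ by $x\mapsto qx\bar q$. (iii) $\Sigma^5_n$ is a minimal submanifold of $\Sigma^7_n$ (its mean curvature vector vanishes identically) for every smooth Riemannian metric on $\Sigma^7_n$ that is invariant under the subgroup $\{\pm\mathrm E\}\times\mathrm{SO}(3)$, where $\mathrm E$ is the $2\times2$ identity matrix. -/

import Mathlib

open Quaternion Manifold ContDiff Topology

noncomputable section

namespace GromollMeyer

/-- The quaternionic plane `ℍ²`. -/
abbrev HH : Type := ℍ[ℝ] × ℍ[ℝ]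

/-- Unit sphere condition in `ℍ²` for the Euclidean norm. -/
def OnS7 (u : HH) : Prop := ‖u.1‖ ^ 2 + ‖u.2‖ ^ 2 = 1

/-- The standard Hermitian product `⟨⟨u, v⟩⟩ = ūᵗ v` on `ℍ²`. -/
def herm (u v : HH) : ℍ[ℝ] := star u.1 * v.1 + star u.2 * v.2

/-- The `n`-th power map of unit octonions, extended polynomially to `ℍ²`: with `x = Re u₁` and the
Chebyshev polynomials `T`, `U` (so that `T n (cos t) = cos (n t)` and
`U (n - 1) (cos t) * sin t = sin (n t)`), it is `u ↦ (T n x + U (n - 1) x • Im u₁, U (n - 1) x • u₂)`.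
The lemma `rho_apply` below is the trigonometric formula on the unit sphere. -/
def rho (n : ℤ) (u : HH) : HH :=
  ((((Polynomial.Chebyshev.T ℝ n).eval u.1.re : ℝ) : ℍ[ℝ])
      + (Polynomial.Chebyshev.U ℝ (n - 1)).eval u.1.re • (u.1 - (u.1.re : ℍ[ℝ])),
    (Polynomial.Chebyshev.U ℝ (n - 1)).eval u.1.re • u.2)

/-- `ρₙ (cos t + p sin t, w sin t) = (cos n t + p sin n t, w sin n t)`; every point of the unit
sphere is of the form `(cos t + p sin t, w sin t)` with `p` imaginary, `‖p‖² + ‖w‖² = 1`. -/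
theorem rho_apply (n : ℤ) (t : ℝ) (p w : ℍ[ℝ]) (hp : p.re = 0) :
    rho n (((Real.cos t : ℝ) : ℍ[ℝ]) + Real.sin t • p, Real.sin t • w) =
      (((Real.cos (n * t) : ℝ) : ℍ[ℝ]) + Real.sin (n * t) • p, Real.sin (n * t) • w) := by
  have hre : (((Real.cos t : ℝ) : ℍ[ℝ]) + Real.sin t • p).re = Real.cos t := by simp [hp]
  have hU := Polynomial.Chebyshev.U_real_cos t (n - 1)
  push_cast at hU
  rw [sub_add_cancel] at hU
  simp only [rho, hre, Polynomial.Chebyshev.T_real_cos, add_sub_cancel_left, smul_smul, hU]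

theorem exists_trig (u : HH) (hu : OnS7 u) : ∃ (t : ℝ) (p w : ℍ[ℝ]), p.re = 0 ∧
    ‖p‖ ^ 2 + ‖w‖ ^ 2 = 1 ∧ u = (((Real.cos t : ℝ) : ℍ[ℝ]) + Real.sin t • p, Real.sin t • w) := by
  have h1 : u.1.re ^ 2 + (‖u.1 - (u.1.re : ℍ[ℝ])‖ ^ 2 + ‖u.2‖ ^ 2) = 1 := by
    have e : ‖u.1‖ ^ 2 = u.1.re ^ 2 + ‖u.1 - (u.1.re : ℍ[ℝ])‖ ^ 2 := by
      simp only [pow_two, ← Quaternion.normSq_eq_norm_mul_self, Quaternion.normSq_def']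
      simp
      ring
    rw [← add_assoc, ← e]; exact hu
  have hx : u.1.re ^ 2 ≤ 1 := by nlinarith [sq_nonneg ‖u.1 - (u.1.re : ℍ[ℝ])‖, sq_nonneg ‖u.2‖]
  have hx' := abs_le.1 ((sq_le_one_iff_abs_le_one _).1 hx)
  have hc : Real.cos (Real.arccos u.1.re) = u.1.re := Real.cos_arccos hx'.1 hx'.2
  set s := Real.sin (Real.arccos u.1.re) with hs
  have hs2 : s ^ 2 = 1 - u.1.re ^ 2 := by rw [hs, Real.sin_sq, hc]
  by_cases h0 : s = 0
  · have hz : ‖u.1 - (u.1.re : ℍ[ℝ])‖ ^ 2 + ‖u.2‖ ^ 2 = 0 := by rw [h0] at hs2; linarith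
    have ha : ‖u.1 - (u.1.re : ℍ[ℝ])‖ = 0 := by
      nlinarith [sq_nonneg ‖u.1 - (u.1.re : ℍ[ℝ])‖, sq_nonneg ‖u.2‖]
    have hb : ‖u.2‖ = 0 := by
      nlinarith [sq_nonneg ‖u.1 - (u.1.re : ℍ[ℝ])‖, sq_nonneg ‖u.2‖]
    refine ⟨Real.arccos u.1.re, ((Complex.I : ℂ) : ℍ[ℝ]), 0, by simp, ?_, ?_⟩
    · rw [pow_two, ← Quaternion.normSq_eq_norm_mul_self, Quaternion.normSq_def']
      simp
    · rw [← hs, h0, hc, zero_smul, smul_zero, add_zero]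
      ext1
      · exact sub_eq_zero.1 (norm_eq_zero.1 ha)
      · exact norm_eq_zero.1 hb
  · refine ⟨Real.arccos u.1.re, s⁻¹ • (u.1 - (u.1.re : ℍ[ℝ])), s⁻¹ • u.2, by simp, ?_, ?_⟩
    · rw [norm_smul, norm_smul, mul_pow, mul_pow, ← mul_add, norm_inv, inv_pow, Real.norm_eq_abs,
        sq_abs, hs2, inv_mul_eq_one₀]
      · linarith
      · rw [← hs2]; exact pow_ne_zero 2 h0
    · rw [← hs, hc, smul_smul, smul_smul, mul_inv_cancel₀ h0]
      ext1 <;> simp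

theorem onS7_trig (t : ℝ) (p w : ℍ[ℝ]) (hp : p.re = 0) (h : ‖p‖ ^ 2 + ‖w‖ ^ 2 = 1) :
    OnS7 (((Real.cos t : ℝ) : ℍ[ℝ]) + Real.sin t • p, Real.sin t • w) := by
  simp only [OnS7, pow_two, ← Quaternion.normSq_eq_norm_mul_self, Quaternion.normSq_def'] at h ⊢
  simp [hp] at h ⊢
  linear_combination Real.sin t ^ 2 * h + Real.sin_sq_add_cos_sq t

theorem onS7_rho (n : ℤ) (u : HH) (hu : OnS7 u) : OnS7 (rho n u) := by
  obtain ⟨t, p, w, hp, h, rfl⟩ := exists_trig u hu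
  rw [rho_apply n t p w hp]
  exact onS7_trig _ p w hp h

/-- The total space `E_n^{10} = {(u, v) ∈ S⁷ × S⁷ | ⟨⟨ρₙ(u), v⟩⟩ = 0}`. -/
def totalSet (n : ℤ) : Set (HH × HH) :=
  {p | OnS7 p.1 ∧ OnS7 p.2 ∧ herm (rho n p.1) p.2 = 0}

/-- The space `E_n^{10}` with the subspace topology of `ℍ² × ℍ²`. -/
abbrev Total (n : ℤ) : Type := totalSet n

/-- Simultaneous conjugation `q u q̄` of the two components. -/
def conjAct (q : unitary ℍ[ℝ]) (u : HH) : HH :=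
  ((q : ℍ[ℝ]) * u.1 * star (q : ℍ[ℝ]), (q : ℍ[ℝ]) * u.2 * star (q : ℍ[ℝ]))

/-- Left multiplication of both components by a unit quaternion. -/
def leftAct (q : unitary ℍ[ℝ]) (v : HH) : HH := ((q : ℍ[ℝ]) * v.1, (q : ℍ[ℝ]) * v.2)

/-- Right multiplication `v q̄` of both components by the inverse of a unit quaternion. -/
def rightAct (q : unitary ℍ[ℝ]) (v : HH) : HH :=
  (v.1 * star (q : ℍ[ℝ]), v.2 * star (q : ℍ[ℝ]))

/-- Multiplication by the diagonal matrix `B = diag(ε, δ) ∈ O(2)`, with `ε, δ ∈ {1, -1}`. -/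
def diagAct (B : ℤˣ × ℤˣ) (u : HH) : HH :=
  (((B.1 : ℤ) : ℍ[ℝ]) * u.1, ((B.2 : ℤ) : ℍ[ℝ]) * u.2)

theorem norm_unit (q : unitary ℍ[ℝ]) : ‖(q : ℍ[ℝ])‖ = 1 := by
  have h := CStarRing.norm_star_mul_self (x := (q : ℍ[ℝ]))
  rw [Unitary.coe_star_mul_self, norm_one] at h
  nlinarith [norm_nonneg (q : ℍ[ℝ])]

theorem norm_sign (e : ℤˣ) : ‖((e : ℤ) : ℍ[ℝ])‖ = 1 := by
  rcases Int.units_eq_one_or e with rfl | rfl <;> simp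

theorem re_conj (q : unitary ℍ[ℝ]) (a : ℍ[ℝ]) :
    ((q : ℍ[ℝ]) * a * star (q : ℍ[ℝ])).re = a.re := by
  have h : (star (q : ℍ[ℝ]) * q).re = 1 := by rw [Unitary.coe_star_mul_self]; rfl
  simp only [Quaternion.re_mul, Quaternion.re_star, Quaternion.imI_star, Quaternion.imJ_star,
    Quaternion.imK_star, Quaternion.imI_mul, Quaternion.imJ_mul, Quaternion.imK_mul] at h ⊢
  linear_combination a.re * h

theorem onS7_conjAct (q : unitary ℍ[ℝ]) {u : HH} (hu : OnS7 u) : OnS7 (conjAct q u) := by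
  simpa [OnS7, conjAct, norm_unit] using hu

theorem onS7_leftAct (q : unitary ℍ[ℝ]) {u : HH} (hu : OnS7 u) : OnS7 (leftAct q u) := by
  simpa [OnS7, leftAct, norm_unit] using hu

theorem onS7_rightAct (q : unitary ℍ[ℝ]) {u : HH} (hu : OnS7 u) : OnS7 (rightAct q u) := by
  simpa [OnS7, rightAct, norm_unit] using hu

theorem onS7_diagAct (B : ℤˣ × ℤˣ) {u : HH} (hu : OnS7 u) : OnS7 (diagAct B u) := by
  simpa [OnS7, diagAct, norm_sign] using hu

theorem rho_conjAct (n : ℤ) (q : unitary ℍ[ℝ]) (u : HH) :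
    rho n (conjAct q u) = conjAct q (rho n u) := by
  have hc : ∀ r : ℝ, (q : ℍ[ℝ]) * (r : ℍ[ℝ]) * star (q : ℍ[ℝ]) = r := fun r => by
    have h := Unitary.coe_mul_star_self q
    rw [← Quaternion.coe_commutes, mul_assoc]
    simp only [Unitary.coe_star] at h
    rw [h, mul_one]
  ext1
  · simp only [rho, conjAct, re_conj, mul_add, add_mul, hc, mul_sub, sub_mul, mul_smul_comm,
      smul_mul_assoc]
  · simp only [rho, conjAct, re_conj, mul_smul_comm, smul_mul_assoc]

theorem herm_conj_left (q : unitary ℍ[ℝ]) (u v : HH) :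
    herm (conjAct q u) (leftAct q v) = (q : ℍ[ℝ]) * herm u v := by
  have h : ∀ a b : ℍ[ℝ], star ((q : ℍ[ℝ]) * a * star (q : ℍ[ℝ])) * ((q : ℍ[ℝ]) * b)
      = q * (star a * b) := fun a b => by
    rw [star_mul, star_mul, star_star, mul_assoc, mul_assoc, ← mul_assoc (star (q : ℍ[ℝ])),
      Unitary.coe_star_mul_self, one_mul]
  simp only [herm, conjAct, leftAct, h, mul_add]

/-- The free action `q ⋆ (u, v) = (q u q̄, q v)` of the unit quaternions on `E_n^{10}`. -/
def starAct (n : ℤ) (q : unitary ℍ[ℝ]) (e : Total n) : Total n :=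
  ⟨(conjAct q e.1.1, leftAct q e.1.2), onS7_conjAct q e.2.1, onS7_leftAct q e.2.2.1, by
    change herm (rho n (conjAct q e.1.1)) (leftAct q e.1.2) = 0
    rw [rho_conjAct, herm_conj_left, e.2.2.2, mul_zero]⟩

theorem herm_rho_diagAct (n : ℤ) (B : ℤˣ × ℤˣ) (u v : HH) (hu : OnS7 u)
    (h : herm (rho n u) v = 0) : herm (rho n (diagAct B u)) (diagAct B v) = 0 := by
  obtain ⟨t, p, w, hp, -, rfl⟩ := exists_trig u hu
  obtain ⟨e, d⟩ := B
  rw [rho_apply n t p w hp] at h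
  have key : ∃ c : ℝ, herm (rho n (diagAct (e, d)
      (((Real.cos t : ℝ) : ℍ[ℝ]) + Real.sin t • p, Real.sin t • w))) (diagAct (e, d) v) =
      c • herm (((Real.cos (n * t) : ℝ) : ℍ[ℝ]) + Real.sin (n * t) • p, Real.sin (n * t) • w) v := by
    have hpos : diagAct (1, d) (((Real.cos t : ℝ) : ℍ[ℝ]) + Real.sin t • p, Real.sin t • w) =
        (((Real.cos t : ℝ) : ℍ[ℝ]) + Real.sin t • p, Real.sin t • (((d : ℤ) : ℍ[ℝ]) * w)) := by
      simp [diagAct]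
    have hneg : diagAct (-1, d) (((Real.cos t : ℝ) : ℍ[ℝ]) + Real.sin t • p, Real.sin t • w) =
        (((Real.cos (Real.pi - t) : ℝ) : ℍ[ℝ]) + Real.sin (Real.pi - t) • (-p),
          Real.sin (Real.pi - t) • (((d : ℤ) : ℍ[ℝ]) * w)) := by
      simp [diagAct, Real.cos_pi_sub, Real.sin_pi_sub, add_comm]
    have hcos : Real.cos (n * (Real.pi - t)) = n.negOnePow * Real.cos (n * t) := by
      rw [mul_sub, Real.cos_sub, Real.cos_int_mul_pi, Real.sin_int_mul_pi]
      rcases Int.even_or_odd n with hn | hn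
      · simp [Int.negOnePow_even n hn, hn.neg_one_zpow]
      · simp [Int.negOnePow_odd n hn, hn.neg_one_zpow]
    have hsin : Real.sin (n * (Real.pi - t)) = -(n.negOnePow * Real.sin (n * t)) := by
      rw [mul_sub, Real.sin_sub, Real.cos_int_mul_pi, Real.sin_int_mul_pi]
      rcases Int.even_or_odd n with hn | hn
      · simp [Int.negOnePow_even n hn, hn.neg_one_zpow]
      · simp [Int.negOnePow_odd n hn, hn.neg_one_zpow]
    rcases Int.units_eq_one_or e with rfl | rfl
    · refine ⟨1, ?_⟩
      rw [hpos, rho_apply n t p _ hp]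
      rcases Int.units_eq_one_or d with rfl | rfl <;> simp [herm, diagAct]
    · refine ⟨-(n.negOnePow : ℝ), ?_⟩
      rw [hneg, rho_apply n _ (-p) _ (by simp [hp]), hcos, hsin]
      rcases Int.even_or_odd n with hn | hn
      · rw [Int.negOnePow_even n hn]
        rcases Int.units_eq_one_or d with rfl | rfl <;> simp [herm, diagAct, add_mul] <;> abel
      · rw [Int.negOnePow_odd n hn]
        rcases Int.units_eq_one_or d with rfl | rfl <;> simp [herm, diagAct, add_mul] <;> abel
  obtain ⟨c, hc⟩ := key
  rw [hc, h, smul_zero]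

/-- The action `(B, q) • (u, v) = (B u, B v q̄)` of `ℤ₂ × ℤ₂ × S³` on `E_n^{10}`. -/
def bulletTotal (n : ℤ) (B : ℤˣ × ℤˣ) (q : unitary ℍ[ℝ]) (e : Total n) : Total n :=
  ⟨(diagAct B e.1.1, rightAct q (diagAct B e.1.2)), onS7_diagAct B e.2.1,
    onS7_rightAct q (onS7_diagAct B e.2.2.1), by
    change herm (rho n (diagAct B e.1.1)) (rightAct q (diagAct B e.1.2)) = 0
    have h := herm_rho_diagAct n B _ _ e.2.1 e.2.2.2
    have h2 : ∀ u v : HH, herm u (rightAct q v) = herm u v * star (q : ℍ[ℝ]) := fun u v => by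
      simp [herm, rightAct, add_mul, mul_assoc]
    rw [h2, h, zero_mul]⟩

/-- The orbit relation of the `⋆`-action. -/
def starSetoid (n : ℤ) : Setoid (Total n) where
  r e e' := ∃ q : unitary ℍ[ℝ], starAct n q e = e'
  iseqv :=
    { refl := fun e => ⟨1, by ext1; simp [starAct, conjAct, leftAct]⟩
      symm := by
        rintro e _ ⟨q, rfl⟩
        refine ⟨star q, ?_⟩
        have hq : star (q : ℍ[ℝ]) * q = 1 := Unitary.coe_star_mul_self q
        have h1 : ∀ a : ℍ[ℝ], star (q : ℍ[ℝ]) * (q * a) = a := fun a => by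
          rw [← mul_assoc, hq, one_mul]
        ext1
        simp only [starAct, conjAct, leftAct, mul_assoc, Unitary.coe_star, star_star, hq, h1,
          mul_one]
      trans := by
        rintro e _ _ ⟨q, rfl⟩ ⟨r, rfl⟩
        exact ⟨r * q, by ext1; simp [starAct, conjAct, leftAct, mul_assoc]⟩ }

/-- The orbit space `Σ⁷_n = E_n^{10} / S³` of the `⋆`-action. -/
def Sigma7 (n : ℤ) : Type := Quotient (starSetoid n)

/-- The quotient topology. -/
instance instTopologicalSpaceSigma7 (n : ℤ) : TopologicalSpace (Sigma7 n) :=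
  inferInstanceAs (TopologicalSpace (Quotient (starSetoid n)))

/-- The projection `E_n^{10} → Σ⁷_n`. -/
def proj (n : ℤ) (e : Total n) : Sigma7 n := Quotient.mk (starSetoid n) e

/-- The induced action of `ℤ₂ × ℤ₂ × S³` on `Σ⁷_n`. The elements `1` and `-1` of `S³` act equally,
so that this is an action of `ℤ₂ × ℤ₂ × SO(3)`, `SO(3) = S³ / {±1}`. -/
def bullet (n : ℤ) (B : ℤˣ × ℤˣ) (q : unitary ℍ[ℝ]) : Sigma7 n → Sigma7 n :=
  Quotient.map' (s₁ := starSetoid n) (s₂ := starSetoid n) (bulletTotal n B q) (by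
    rintro e _ ⟨r, rfl⟩
    refine ⟨r, ?_⟩
    obtain ⟨b, d⟩ := B
    ext1
    rcases Int.units_eq_one_or b with rfl | rfl <;> rcases Int.units_eq_one_or d with rfl | rfl <;>
      simp [starAct, bulletTotal, conjAct, leftAct, rightAct, diagAct, mul_assoc])

/-- The elements `q` and `-q` of `S³` act equally on `Σ⁷_n`. -/
theorem bullet_neg (n : ℤ) (B : ℤˣ × ℤˣ) (q : unitary ℍ[ℝ]) : bullet n B (-q) = bullet n B q := by
  funext x
  obtain ⟨e, rfl⟩ : ∃ e, proj n e = x := Quotient.exists_rep x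
  refine Quotient.sound (s := starSetoid n) ⟨-1, ?_⟩
  have h1 : (((-1 : unitary ℍ[ℝ]) : ℍ[ℝ])) = -1 := rfl
  have h2 : (((-q : unitary ℍ[ℝ]) : ℍ[ℝ])) = -(q : ℍ[ℝ]) := rfl
  ext1
  simp [starAct, bulletTotal, conjAct, leftAct, rightAct, h1, h2]

/-- A chart of the quotient manifold `Σ⁷_n`: a homeomorphism `φ` between open subsets of `Σ⁷_n` and
`ℝ⁷` such that the composition of `φ` with the projection `E_n^{10} → Σ⁷_n` is smooth on the
submanifold `E_n^{10}` of `ℍ² × ℍ²` (locally it extends to a smooth map on the ambient space), and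
such that `φ⁻¹` locally lifts to a smooth map into `E_n^{10}`. -/
def IsQuotientChart (n : ℤ)
    (φ : OpenPartialHomeomorph (Sigma7 n) (EuclideanSpace ℝ (Fin 7))) : Prop :=
  (∀ e : Total n, proj n e ∈ φ.source →
    ∃ (W : Set (HH × HH)) (F : HH × HH → EuclideanSpace ℝ (Fin 7)), IsOpen W ∧ (e : HH × HH) ∈ W ∧
      ContDiffOn ℝ ∞ F W ∧
      ∀ e' : Total n, (e' : HH × HH) ∈ W → proj n e' ∈ φ.source → F e' = φ (proj n e')) ∧
  (∀ y ∈ φ.target,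
    ∃ (W : Set (EuclideanSpace ℝ (Fin 7))) (s : EuclideanSpace ℝ (Fin 7) → HH × HH),
      IsOpen W ∧ y ∈ W ∧ ContDiffOn ℝ ∞ s W ∧
      ∀ y' ∈ W ∩ φ.target, ∃ h : s y' ∈ totalSet n, proj n ⟨s y', h⟩ = φ.symm y')

theorem IsQuotientChart.contDiffOn {n : ℤ}
    {φ ψ : OpenPartialHomeomorph (Sigma7 n) (EuclideanSpace ℝ (Fin 7))}
    (hφ : IsQuotientChart n φ) (hψ : IsQuotientChart n ψ) :
    ContDiffOn ℝ ∞ (φ.symm ≫ₕ ψ) (φ.symm ≫ₕ ψ).source := by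
  intro y hy
  have hy' := hy
  rw [OpenPartialHomeomorph.trans_source] at hy'
  have hyt : y ∈ φ.target := hy'.1
  obtain ⟨W, s, hW, hyW, hs, hsl⟩ := hφ.2 y hyt
  obtain ⟨h0, hp0⟩ := hsl y ⟨hyW, hyt⟩
  have hsrc : proj n ⟨s y, h0⟩ ∈ ψ.source := by rw [hp0]; exact hy'.2
  obtain ⟨W', F, hW', hyW', hF, hFl⟩ := hψ.1 ⟨s y, h0⟩ hsrc
  have hsA : ContDiffAt ℝ ∞ s y := hs.contDiffAt (hW.mem_nhds hyW)
  have hFA : ContDiffAt ℝ ∞ F (s y) := hF.contDiffAt (hW'.mem_nhds hyW')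
  refine ContDiffAt.contDiffWithinAt ((hFA.comp y hsA).congr_of_eventuallyEq ?_)
  filter_upwards [hW.mem_nhds hyW, hsA.continuousAt.preimage_mem_nhds (hW'.mem_nhds hyW'),
    (φ.symm ≫ₕ ψ).open_source.mem_nhds hy] with z hz hz' hz''
  have hzs : z ∈ φ.target ∧ φ.symm z ∈ ψ.source := by
    rw [OpenPartialHomeomorph.trans_source] at hz''
    exact hz''
  obtain ⟨h1, hp1⟩ := hsl z ⟨hz, hzs.1⟩
  have := hFl ⟨s z, h1⟩ hz' (by rw [hp1]; exact hzs.2)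
  simp only [Function.comp_apply, this, hp1]
  rfl

/-- The component of a vector in `ℍ²` selected by a Boolean. -/
def pr (i : Bool) (u : HH) : ℍ[ℝ] := cond i u.1 u.2

/-- The vector in `ℍ²` with component `a` at `i` and `b` at the other place. -/
def mk2 (i : Bool) (a b : ℍ[ℝ]) : HH := cond i (a, b) (b, a)

theorem norm_pr (i : Bool) (u : HH) : OnS7 u ↔ ‖pr i u‖ ^ 2 + ‖pr (!i) u‖ ^ 2 = 1 := by
  cases i <;> simp [pr, OnS7, add_comm]

theorem herm_pr (i : Bool) (u v : HH) :
    herm u v = star (pr i u) * pr i v + star (pr (!i) u) * pr (!i) v := by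
  cases i <;> simp [pr, herm, add_comm]

theorem pr_ext (i : Bool) {u v : HH} (h : pr i u = pr i v) (h' : pr (!i) u = pr (!i) v) :
    u = v := by
  cases i <;> simp_all [pr, Prod.ext_iff]

@[simp] theorem pr_mk2 (i : Bool) (a b : ℍ[ℝ]) : pr i (mk2 i a b) = a := by
  cases i <;> rfl

@[simp] theorem pr_not_mk2 (i : Bool) (a b : ℍ[ℝ]) : pr (!i) (mk2 i a b) = b := by
  cases i <;> rfl

theorem pr_leftAct (i : Bool) (q : unitary ℍ[ℝ]) (u : HH) :
    pr i (leftAct q u) = (q : ℍ[ℝ]) * pr i u := by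
  cases i <;> rfl

/-- The vector `v` orthogonal to `r` whose `i`-th component is real and positive. -/
def slice (i : Bool) (r : HH) : HH :=
  mk2 i ((‖pr (!i) r‖ : ℝ) : ℍ[ℝ]) (-(‖pr (!i) r‖⁻¹ • (pr (!i) r * star (pr i r))))

theorem star_mul_self_norm (a : ℍ[ℝ]) : star a * a = ((‖a‖ ^ 2 : ℝ) : ℍ[ℝ]) := by
  rw [Quaternion.star_mul_self, Quaternion.normSq_eq_norm_mul_self, pow_two]

theorem slice_spec (i : Bool) (r : HH) (hr : OnS7 r) (h : pr (!i) r ≠ 0) :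
    OnS7 (slice i r) ∧ herm r (slice i r) = 0 := by
  have hn : ‖pr (!i) r‖ ≠ 0 := norm_ne_zero_iff.2 h
  constructor
  · rw [norm_pr i] at hr ⊢
    simp only [slice, pr_mk2, pr_not_mk2, norm_neg, norm_smul, norm_mul, norm_star, norm_inv,
      norm_norm, Quaternion.norm_coe]
    rw [inv_mul_cancel_left₀ hn]
    linarith
  · rw [herm_pr i]
    simp only [slice, pr_mk2, pr_not_mk2, mul_neg, mul_smul_comm]
    rw [← mul_assoc, star_mul_self_norm, Quaternion.mul_coe_eq_smul, Quaternion.coe_mul_eq_smul,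
      smul_smul]
    have e : ‖pr (!i) r‖⁻¹ * ‖pr (!i) r‖ ^ 2 = ‖pr (!i) r‖ := by field_simp
    rw [e, add_neg_cancel]

theorem slice_unique (i : Bool) (r v : HH) (hr : OnS7 r) (hv : OnS7 v) (h : herm r v = 0)
    (c : ℝ) (hc : 0 < c) (hvi : pr i v = (c : ℍ[ℝ])) : pr (!i) r ≠ 0 ∧ slice i r = v := by
  rw [norm_pr i] at hr hv
  rw [herm_pr i, hvi, Quaternion.mul_coe_eq_smul] at h
  rw [hvi, Quaternion.norm_coe, Real.norm_eq_abs, sq_abs] at hv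
  have hb : pr (!i) r ≠ 0 := by
    intro hb
    rw [hb, star_zero, zero_mul, add_zero, smul_eq_zero] at h
    have ha : pr i r = 0 := by simpa using h.resolve_left hc.ne'
    rw [ha, hb] at hr
    simp at hr
  have hn : ‖pr (!i) r‖ ≠ 0 := norm_ne_zero_iff.2 hb
  have h1 : c • star (pr i r) = -(star (pr (!i) r) * pr (!i) v) := eq_neg_of_add_eq_zero_left h
  have h2 : c * ‖pr i r‖ = ‖pr (!i) r‖ * ‖pr (!i) v‖ := by
    have := congrArg norm h1
    simpa [norm_smul, abs_of_pos hc] using this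
  have h3 : ‖pr (!i) r‖ ^ 2 = c ^ 2 := by
    have h4 : c ^ 2 * ‖pr i r‖ ^ 2 = ‖pr (!i) r‖ ^ 2 * ‖pr (!i) v‖ ^ 2 := by
      rw [← mul_pow, h2, mul_pow]
    linear_combination (-(‖pr (!i) r‖ ^ 2)) * hv - h4 + c ^ 2 * hr
  have h4 : ‖pr (!i) r‖ = c := (sq_eq_sq₀ (norm_nonneg _) hc.le).1 h3
  refine ⟨hb, pr_ext i ?_ ?_⟩
  · simp only [slice, pr_mk2, h4, hvi]
  · simp only [slice, pr_not_mk2, h4]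
    have h5 : star (pr (!i) r) * (pr (!i) r * star (pr i r)) =
        star (pr (!i) r) * (-(c • pr (!i) v)) := by
      rw [← mul_assoc, star_mul_self_norm, Quaternion.coe_mul_eq_smul, h4, pow_two, mul_smul, h1,
        mul_neg, mul_smul_comm, smul_neg]
    have h6 := mul_left_cancel₀ (star_ne_zero.2 hb) h5
    rw [h6, smul_neg, neg_neg, smul_smul, inv_mul_cancel₀ hc.ne', one_smul]

/-- The unit quaternion that rotates `a ≠ 0` to a positive real number by left multiplication. -/
def nq (a : ℍ[ℝ]) : ℍ[ℝ] := ‖a‖⁻¹ • star a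

theorem nq_mem {a : ℍ[ℝ]} (ha : a ≠ 0) : nq a ∈ unitary ℍ[ℝ] := by
  have hn : ‖a‖ ≠ 0 := norm_ne_zero_iff.2 ha
  have e : ‖a‖⁻¹ * (‖a‖⁻¹ * ‖a‖ ^ 2) = 1 := by field_simp
  have h1 : star a * a = ((‖a‖ ^ 2 : ℝ) : ℍ[ℝ]) := star_mul_self_norm a
  have h2 : a * star a = ((‖a‖ ^ 2 : ℝ) : ℍ[ℝ]) := by
    have := star_mul_self_norm (star a)
    rwa [star_star, norm_star] at this
  rw [Unitary.mem_iff]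
  constructor <;>
  · simp only [nq, Quaternion.star_smul, star_star, smul_mul_assoc, mul_smul_comm, h1, h2]
    rw [Quaternion.smul_coe, Quaternion.smul_coe, e]
    rfl

theorem nq_mul {a : ℍ[ℝ]} (ha : a ≠ 0) : nq a * a = ((‖a‖ : ℝ) : ℍ[ℝ]) := by
  have hn : ‖a‖ ≠ 0 := norm_ne_zero_iff.2 ha
  rw [nq, smul_mul_assoc, star_mul_self_norm, Quaternion.smul_coe]
  congr 1
  field_simp

/-- The vector `u` after rotating `(u, v)` along its orbit so that `vᵢ` becomes positive. -/
def rot (i : Bool) (p : HH × HH) : HH :=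
  (nq (pr i p.2) * p.1.1 * star (nq (pr i p.2)), nq (pr i p.2) * p.1.2 * star (nq (pr i p.2)))

theorem rot_eq (i : Bool) (p : HH × HH) (h : pr i p.2 ≠ 0) :
    rot i p = conjAct ⟨nq (pr i p.2), nq_mem h⟩ p.1 := rfl

theorem rot_starAct {n : ℤ} (i : Bool) (q : unitary ℍ[ℝ]) (e : Total n) :
    rot i (starAct n q e : HH × HH) = rot i e := by
  have hq : star (q : ℍ[ℝ]) * q = 1 := Unitary.coe_star_mul_self q
  have h1 : ∀ a : ℍ[ℝ], star (q : ℍ[ℝ]) * (q * a) = a := fun a => by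
    rw [← mul_assoc, hq, one_mul]
  ext1 <;>
  simp only [rot, starAct, conjAct, pr_leftAct, nq, norm_mul, norm_unit, one_mul, star_mul,
    Quaternion.star_smul, star_star, mul_assoc, smul_mul_assoc, mul_smul_comm, h1]

theorem starAct_nq {n : ℤ} (i : Bool) (e : Total n) (h : pr i (e : HH × HH).2 ≠ 0) :
    pr (!i) (rho n (rot i e)) ≠ 0 ∧
      (starAct n ⟨nq (pr i (e : HH × HH).2), nq_mem h⟩ e : HH × HH) =
        (rot i e, slice i (rho n (rot i e))) := by
  set e' := starAct n ⟨nq (pr i (e : HH × HH).2), nq_mem h⟩ e with he'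
  have h1 : (e' : HH × HH).1 = rot i e := rfl
  have h2 := slice_unique i (rho n (e' : HH × HH).1) (e' : HH × HH).2 (onS7_rho n _ e'.2.1)
    e'.2.2.1 e'.2.2.2 ‖pr i (e : HH × HH).2‖ (norm_pos_iff.2 h) (by
      rw [he']
      exact (pr_leftAct i _ _).trans (nq_mul h))
  rw [h1] at h2
  exact ⟨h2.1, by rw [h2.2]; rfl⟩

theorem slice_mem {n : ℤ} (i : Bool) {u : HH} (hu : OnS7 u) (h : pr (!i) (rho n u) ≠ 0) :
    (u, slice i (rho n u)) ∈ totalSet n :=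
  ⟨hu, slice_spec i _ (onS7_rho n u hu) h⟩

theorem rot_slice {n : ℤ} (i : Bool) {u : HH} (h : pr (!i) (rho n u) ≠ 0) :
    rot i (u, slice i (rho n u)) = u := by
  have hn : ‖pr (!i) (rho n u)‖ ≠ 0 := norm_ne_zero_iff.2 h
  have h1 : nq (pr i (slice i (rho n u))) = 1 := by
    rw [slice, pr_mk2, nq, Quaternion.norm_coe, norm_norm, Quaternion.star_coe,
      Quaternion.smul_coe, inv_mul_cancel₀ hn]
    rfl
  simp [rot, h1]

theorem continuous_proj (n : ℤ) : Continuous (proj n) := continuous_quotient_mk'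

theorem isQuotientMap_proj (n : ℤ) : IsQuotientMap (proj n) := isQuotientMap_quotient_mk'

theorem contDiff_pr (i : Bool) : ContDiff ℝ ∞ (pr i) := by
  cases i
  · exact contDiff_snd
  · exact contDiff_fst

theorem contDiff_re : ContDiff ℝ ∞ (fun a : ℍ[ℝ] => a.re) := by
  have : (fun a : ℍ[ℝ] => a.re) = fun a => inner ℝ a 1 := by
    ext a; simp [Quaternion.inner_def]
  rw [this]
  exact contDiff_id.inner ℝ contDiff_const

theorem contDiff_coe : ContDiff ℝ ∞ (fun a : ℝ => (a : ℍ[ℝ])) := by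
  have : (fun a : ℝ => (a : ℍ[ℝ])) = fun a => a • (1 : ℍ[ℝ]) := by
    ext1 a; rw [← Quaternion.coe_mul_eq_smul, mul_one]
  rw [this]
  exact contDiff_id.smul contDiff_const

theorem contDiff_starH : ContDiff ℝ ∞ (fun a : ℍ[ℝ] => star a) :=
  by
  have : (fun a : ℍ[ℝ] => star a) = fun a => ((2 * a.re : ℝ) : ℍ[ℝ]) - a := by
    ext1 a; exact Quaternion.star_eq_two_re_sub a
  rw [this]
  exact (contDiff_coe.comp (contDiff_const.mul contDiff_re)).sub contDiff_id

theorem polyContDiff (P : Polynomial ℝ) : ContDiff ℝ ∞ (fun x : ℝ => P.eval x) := by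
  induction P using Polynomial.induction_on' with
  | add p q hp hq => simpa only [Polynomial.eval_add] using hp.add hq
  | monomial n a => 
    simp only [Polynomial.eval_monomial]
    fun_prop

theorem contDiff_rho (n : ℤ) : ContDiff ℝ ∞ (rho n) := by
  have hx : ContDiff ℝ ∞ (fun u : HH => u.1.re) := contDiff_re.comp contDiff_fst
  have hp : ∀ P : Polynomial ℝ, ContDiff ℝ ∞ (fun u : HH => P.eval u.1.re) := fun P =>
    (polyContDiff P).comp hx
  exact ((contDiff_coe.comp (hp _)).add ((hp _).smul (contDiff_fst.sub (contDiff_coe.comp hx)))).prodMk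
    ((hp _).smul contDiff_snd)

theorem contDiffAt_slice (i : Bool) (r : HH) (h : pr (!i) r ≠ 0) :
    ContDiffAt ℝ ∞ (slice i) r := by
  have h1 : ContDiffAt ℝ ∞ (fun r => pr (!i) r) r := (contDiff_pr _).contDiffAt
  have h2 : ContDiffAt ℝ ∞ (fun r => ‖pr (!i) r‖) r := h1.norm ℝ h
  have h3 : ContDiffAt ℝ ∞ (fun r => star (pr i r)) r :=
    (contDiff_starH.comp (contDiff_pr i)).contDiffAt
  have h4 : ContDiffAt ℝ ∞ (fun r => ((‖pr (!i) r‖ : ℝ) : ℍ[ℝ])) r :=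
    contDiff_coe.contDiffAt.comp r h2
  have h5 : ContDiffAt ℝ ∞ (fun r => -(‖pr (!i) r‖⁻¹ • (pr (!i) r * star (pr i r)))) r :=
    ((h2.inv (norm_ne_zero_iff.2 h)).smul (h1.mul h3)).neg
  cases i
  · exact h5.prodMk h4
  · exact h4.prodMk h5

theorem contDiffAt_rot (i : Bool) (p : HH × HH) (h : pr i p.2 ≠ 0) :
    ContDiffAt ℝ ∞ (rot i) p := by
  have h1 : ContDiffAt ℝ ∞ (fun p : HH × HH => pr i p.2) p :=
    ((contDiff_pr i).comp contDiff_snd).contDiffAt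
  have h2 : ContDiffAt ℝ ∞ (fun p : HH × HH => nq (pr i p.2)) p :=
    ((h1.norm ℝ h).inv (norm_ne_zero_iff.2 h)).smul (contDiff_starH.contDiffAt.comp p h1)
  have h3 : ContDiffAt ℝ ∞ (fun p : HH × HH => star (nq (pr i p.2))) p :=
    contDiff_starH.contDiffAt.comp p h2
  exact ((h2.mul (contDiff_fst.comp contDiff_fst).contDiffAt).mul h3).prodMk
    ((h2.mul (contDiff_snd.comp contDiff_fst).contDiffAt).mul h3)

/-- The unit sphere of `ℍ²` as a metric sphere in an inner product space. -/
abbrev Sph : Type := Metric.sphere (0 : WithLp 2 HH) 1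

theorem mem_sph (u : HH) : WithLp.toLp 2 u ∈ Metric.sphere (0 : WithLp 2 HH) 1 ↔ OnS7 u := by
  rw [mem_sphere_zero_iff_norm, ← sq_eq_sq₀ (norm_nonneg _) zero_le_one,
    WithLp.prod_norm_sq_eq_of_L2, one_pow]
  rfl

theorem onS7_sph (s : Sph) : OnS7 (WithLp.ofLp (s : WithLp 2 HH)) := (mem_sph _).1 s.2

theorem onS7_rot {n : ℤ} (i : Bool) (e : Total n) (h : pr i (e : HH × HH).2 ≠ 0) :
    OnS7 (rot i (e : HH × HH)) := by
  rw [rot_eq i _ h]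
  exact onS7_conjAct _ e.2.1

/-- The point `(1, 0)`. -/
def base : Sph := ⟨WithLp.toLp 2 (1, 0), (mem_sph _).2 (by simp [OnS7])⟩

theorem base_mem (n : ℤ) : (((1, 0), (0, 1)) : HH × HH) ∈ totalSet n := by
  refine ⟨by simp [OnS7], by simp [OnS7], ?_⟩
  simp [herm, rho]

open Classical in
/-- The map `[(u, v)] ↦ rot i (u, v)` to the sphere. -/
def toSph (n : ℤ) (i : Bool) : Sigma7 n → Sph :=
  Quotient.lift (s := starSetoid n) (fun e : Total n =>
    if h : OnS7 (rot i (e : HH × HH)) then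
      (⟨WithLp.toLp 2 (rot i (e : HH × HH)), (mem_sph _).2 h⟩ : Sph) else base) (by
      rintro e _ ⟨q, rfl⟩
      simp only [rot_starAct])

open Classical in
/-- The map `u ↦ [(u, slice i (rho n u))]`. -/
def ofSph (n : ℤ) (i : Bool) (s : Sph) : Sigma7 n :=
  if h : (WithLp.ofLp (s : WithLp 2 HH), slice i (rho n (WithLp.ofLp (s : WithLp 2 HH)))) ∈ totalSet n
    then proj n ⟨_, h⟩ else proj n ⟨_, base_mem n⟩

theorem toSph_proj {n : ℤ} (i : Bool) (e : Total n) (h : pr i (e : HH × HH).2 ≠ 0) :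
    (toSph n i (proj n e) : WithLp 2 HH) = WithLp.toLp 2 (rot i (e : HH × HH)) :=
  congrArg Subtype.val (dif_pos (onS7_rot i e h))

/-- The open set `vᵢ ≠ 0` of `Σ⁷_n`. -/
def dom (n : ℤ) (i : Bool) : Set (Sigma7 n) :=
  {x | ∃ e : Total n, proj n e = x ∧ pr i (e : HH × HH).2 ≠ 0}

theorem proj_mem_dom {n : ℤ} (i : Bool) (e : Total n) :
    proj n e ∈ dom n i ↔ pr i (e : HH × HH).2 ≠ 0 := by
  refine ⟨?_, fun h => ⟨e, rfl, h⟩⟩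
  rintro ⟨e', h, he'⟩
  obtain ⟨q, rfl⟩ := Quotient.exact h
  change pr i (leftAct q (e' : HH × HH).2) ≠ 0
  rw [pr_leftAct]
  refine mul_ne_zero ?_ he'
  rw [← norm_ne_zero_iff, norm_unit]
  exact one_ne_zero

theorem ofSph_eq {n : ℤ} (i : Bool) (s : Sph)
    (h : pr (!i) (rho n (WithLp.ofLp (s : WithLp 2 HH))) ≠ 0) :
    ofSph n i s = proj n ⟨_, slice_mem i (onS7_sph s) h⟩ := dif_pos _

theorem proj_starAct {n : ℤ} (q : unitary ℍ[ℝ]) (e : Total n) :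
    proj n (starAct n q e) = proj n e :=
  (Quotient.sound (s := starSetoid n) (a := e) (b := starAct n q e) ⟨q, rfl⟩).symm

theorem isOpen_dom (n : ℤ) (i : Bool) : IsOpen (dom n i) := by
  rw [← (isQuotientMap_proj n).isOpen_preimage]
  have : proj n ⁻¹' dom n i = {e : Total n | pr i (e : HH × HH).2 ≠ 0} := by
    ext e; exact proj_mem_dom i e
  rw [this]
  exact isOpen_ne_fun ((contDiff_pr i).continuous.comp
    (continuous_snd.comp continuous_subtype_val)) continuous_const

/-- The open set `vᵢ ≠ 0` of `Σ⁷_n` is homeomorphic to an open subset of the unit sphere. -/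
def sphHomeo (n : ℤ) (i : Bool) : OpenPartialHomeomorph (Sigma7 n) Sph where
  toFun := toSph n i
  invFun := ofSph n i
  source := dom n i
  target := {s | pr (!i) (rho n (WithLp.ofLp (s : WithLp 2 HH))) ≠ 0}
  map_source' := by
    rintro _ ⟨e, rfl, h⟩
    simp only [Set.mem_ofPred_eq, toSph_proj i e h]
    exact (starAct_nq i e h).1
  map_target' := by
    intro s hs
    rw [ofSph_eq i s hs, proj_mem_dom]
    simp only [slice, pr_mk2]
    intro h
    rw [← Quaternion.coe_zero, Quaternion.coe_inj] at h
    exact hs (norm_eq_zero.1 h)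
  left_inv' := by
    rintro _ ⟨e, rfl, h⟩
    have h1 := starAct_nq i e h
    have h2 := toSph_proj i e h
    have h3 : WithLp.ofLp (toSph n i (proj n e) : WithLp 2 HH) = rot i e := by rw [h2]
    rw [ofSph_eq i _ (by rw [h3]; exact h1.1)]
    refine Eq.trans (congrArg (proj n) ?_) (proj_starAct ⟨_, nq_mem h⟩ e)
    ext1
    refine Eq.trans ?_ h1.2.symm
    simp only [h3]
  right_inv' := by
    intro s hs
    rw [ofSph_eq i s hs]
    ext1
    rw [toSph_proj]
    · simp only [rot_slice i hs]
    · simp only [slice, pr_mk2]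
      intro h
      rw [← Quaternion.coe_zero, Quaternion.coe_inj] at h
      exact hs (norm_eq_zero.1 h)
  open_source := isOpen_dom n i
  open_target :=
    isOpen_ne_fun ((contDiff_pr _).continuous.comp ((contDiff_rho n).continuous.comp
      ((WithLp.prod_continuous_ofLp 2 _ _).comp continuous_subtype_val))) continuous_const
  continuousOn_toFun := by
    rw [(isQuotientMap_proj n).continuousOn_isOpen_iff (isOpen_dom n i),
      Topology.IsInducing.subtypeVal.continuousOn_iff]
    have h1 : ContinuousOn (fun e : Total n => WithLp.toLp 2 (rot i (e : HH × HH)))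
        (proj n ⁻¹' dom n i) := by
      intro e he
      exact ((WithLp.prod_continuous_toLp 2 _ _).continuousAt.comp
        ((contDiffAt_rot i _ ((proj_mem_dom i e).1 he)).continuousAt.comp
          continuous_subtype_val.continuousAt)).continuousWithinAt
    exact h1.congr fun e he => toSph_proj i e ((proj_mem_dom i e).1 he)
  continuousOn_invFun := by
    intro s hs
    have ht : IsOpen {s : Sph | pr (!i) (rho n (WithLp.ofLp (s : WithLp 2 HH))) ≠ 0} :=
      isOpen_ne_fun ((contDiff_pr _).continuous.comp ((contDiff_rho n).continuous.comp
        ((WithLp.prod_continuous_ofLp 2 _ _).comp continuous_subtype_val))) continuous_const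
    rw [continuousWithinAt_iff_continuousAt_domRestrict _ hs]
    have h1 : Continuous (fun s : {s : Sph | pr (!i) (rho n (WithLp.ofLp (s : WithLp 2 HH))) ≠ 0} =>
        proj n ⟨_, slice_mem i (onS7_sph s.1) s.2⟩) := by
      refine (continuous_proj n).comp (Continuous.subtype_mk ?_ _)
      have h2 : Continuous (fun s : {s : Sph | pr (!i) (rho n (WithLp.ofLp (s : WithLp 2 HH))) ≠ 0} =>
          WithLp.ofLp ((s : Sph) : WithLp 2 HH)) :=
        (WithLp.prod_continuous_ofLp 2 _ _).comp (continuous_subtype_val.comp continuous_subtype_val)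
      refine h2.prodMk (continuous_iff_continuousAt.2 fun s => ?_)
      exact ContinuousAt.comp (f := fun s : {s : Sph | pr (!i) (rho n (WithLp.ofLp
          (s : WithLp 2 HH))) ≠ 0} => rho n (WithLp.ofLp ((s : Sph) : WithLp 2 HH)))
        (contDiffAt_slice i _ s.2).continuousAt
        ((contDiff_rho n).continuous.comp h2).continuousAt
    refine (h1.congr fun s => ?_).continuousAt
    exact (ofSph_eq i s.1 s.2).symm

instance finrankSph : Fact (Module.finrank ℝ (WithLp 2 HH) = 7 + 1) := ⟨by
  rw [(WithLp.linearEquiv 2 ℝ HH).finrank_eq, Module.finrank_prod, Quaternion.finrank_eq_four]⟩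

theorem contDiff_stereo_symm_aux {F : Type*} [NormedAddCommGroup F] [InnerProductSpace ℝ F] {k : ℕ}
    [Fact (Module.finrank ℝ F = k + 1)] (v : Metric.sphere (0 : F) 1) :
    ContDiff ℝ ∞ (fun y : EuclideanSpace ℝ (Fin k) => ((stereographic' k v).symm y : F)) := by
  simp only [stereographic'_symm_apply]
  have h0 : ContDiff ℝ ∞ (fun y : EuclideanSpace ℝ (Fin k) =>
      ((OrthonormalBasis.fromOrthogonalSpanSingleton (𝕜 := ℝ) k
        (ne_zero_of_mem_unit_sphere v)).repr.symm y : F)) :=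
    (ℝ ∙ (v : F))ᗮ.subtypeL.contDiff.comp
      (OrthonormalBasis.fromOrthogonalSpanSingleton (𝕜 := ℝ) k
        (ne_zero_of_mem_unit_sphere v)).repr.symm.contDiff
  have h1 := h0.norm_sq ℝ
  have h2 := (h1.add (contDiff_const (c := (4 : ℝ)))).inv fun y => by positivity
  exact (h2.smul (contDiff_const.smul h0)).add
    (h2.smul ((h1.sub contDiff_const).smul contDiff_const))

theorem contDiff_stereo_symm (v : Sph) :
    ContDiff ℝ ∞ (fun y : EuclideanSpace ℝ (Fin 7) =>
      WithLp.ofLp (((stereographic' 7 v).symm y : Sph) : WithLp 2 HH)) :=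
  (WithLp.prodContinuousLinearEquiv 2 ℝ ℍ[ℝ] ℍ[ℝ]).contDiff.comp (contDiff_stereo_symm_aux v)

/-- The chart of `Σ⁷_n` on a part of the open set `vᵢ ≠ 0`. -/
def sigmaChart (n : ℤ) (i : Bool) (v : Sph) :
    OpenPartialHomeomorph (Sigma7 n) (EuclideanSpace ℝ (Fin 7)) :=
  sphHomeo n i ≫ₕ stereographic' 7 v

theorem mem_sigmaChart_source (n : ℤ) (i : Bool) (v : Sph) (x : Sigma7 n) :
    x ∈ (sigmaChart n i v).source ↔ x ∈ dom n i ∧ toSph n i x ≠ v := by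
  rw [sigmaChart, OpenPartialHomeomorph.trans_source, stereographic'_source]
  rfl

theorem isQuotientChart_sigmaChart (n : ℤ) (i : Bool) (v : Sph) :
    IsQuotientChart n (sigmaChart n i v) := by
  constructor
  · intro e he
    rw [mem_sigmaChart_source, proj_mem_dom] at he
    let G : HH × HH → WithLp 2 HH := fun p => WithLp.toLp 2 (rot i p)
    have hG : ∀ p : HH × HH, pr i p.2 ≠ 0 → ContDiffAt ℝ ∞ G p := fun p hp =>
      (WithLp.prodContinuousLinearEquiv 2 ℝ ℍ[ℝ] ℍ[ℝ]).symm.contDiff.contDiffAt.comp p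
        (contDiffAt_rot i p hp)
    have hO : IsOpen {p : HH × HH | pr i p.2 ≠ 0} :=
      isOpen_ne_fun ((contDiff_pr i).continuous.comp continuous_snd) continuous_const
    have hO2 : IsOpen {x : WithLp 2 HH | innerSL ℝ (v : WithLp 2 HH) x ≠ (1 : ℝ)} :=
      isOpen_ne_fun (innerSL ℝ (v : WithLp 2 HH)).continuous continuous_const
    have hGc : ContinuousOn G {p : HH × HH | pr i p.2 ≠ 0} := fun p hp =>
      (hG p hp).continuousAt.continuousWithinAt
    have hval : ∀ e' : Total n, pr i (e' : HH × HH).2 ≠ 0 →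
        (toSph n i (proj n e') : WithLp 2 HH) = G e' := fun e' h => toSph_proj i e' h
    refine ⟨{p : HH × HH | pr i p.2 ≠ 0} ∩ G ⁻¹' {x | innerSL ℝ (v : WithLp 2 HH) x ≠ (1 : ℝ)},
      fun p => (OrthonormalBasis.fromOrthogonalSpanSingleton (𝕜 := ℝ) 7
        (ne_zero_of_mem_unit_sphere v)).repr (stereoToFun (v : WithLp 2 HH) (G p)),
      hGc.isOpen_inter_preimage hO hO2, ⟨he.1, ?_⟩, ?_, ?_⟩
    · intro h1
      rw [← hval e he.1] at h1
      refine he.2 ?_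
      rw [sphere_ext_iff, real_inner_comm]
      exact h1
    · refine (LinearIsometryEquiv.contDiff _).comp_contDiffOn ?_
      exact contDiffOn_stereoToFun.comp
        (fun p hp => (hG p hp.1).contDiffWithinAt) (fun p hp => hp.2)
    · intro e' he' _
      simp only [← hval e' he'.1]
      rfl
  · intro y hy
    refine ⟨(sigmaChart n i v).target, fun y =>
      (WithLp.ofLp (((stereographic' 7 v).symm y : Sph) : WithLp 2 HH),
        slice i (rho n (WithLp.ofLp (((stereographic' 7 v).symm y : Sph) : WithLp 2 HH)))),
      (sigmaChart n i v).open_target, hy, ?_, ?_⟩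
    · intro y hy
      rw [sigmaChart, OpenPartialHomeomorph.trans_target] at hy
      have hy2 : pr (!i) (rho n (WithLp.ofLp
        (((stereographic' 7 v).symm y : Sph) : WithLp 2 HH))) ≠ 0 := hy.2
      have h1 := (contDiff_stereo_symm v).contDiffAt (x := y)
      exact (h1.prodMk ((contDiffAt_slice i _ hy2).comp y
        ((contDiff_rho n).contDiffAt.comp y h1))).contDiffWithinAt
    · rintro y ⟨-, hy⟩
      rw [sigmaChart, OpenPartialHomeomorph.trans_target] at hy
      have hy2 : pr (!i) (rho n (WithLp.ofLp
        (((stereographic' 7 v).symm y : Sph) : WithLp 2 HH))) ≠ 0 := hy.2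
      exact ⟨slice_mem i (onS7_sph _) hy2, (ofSph_eq i _ hy2).symm⟩

theorem exists_quotientChart (n : ℤ) (x : Sigma7 n) :
    ∃ φ, IsQuotientChart n φ ∧ x ∈ φ.source := by
  obtain ⟨e, rfl⟩ : ∃ e, proj n e = x := Quotient.exists_rep x
  have h : ∃ i, pr i (e : HH × HH).2 ≠ 0 := by
    by_contra! h
    have := (norm_pr true _).1 e.2.2.1
    rw [h, h] at this
    simp at this
  obtain ⟨i, hi⟩ := h
  refine ⟨sigmaChart n i (-toSph n i (proj n e)), isQuotientChart_sigmaChart _ _ _, ?_⟩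
  rw [mem_sigmaChart_source]
  exact ⟨(proj_mem_dom i e).2 hi, ne_neg_of_mem_unit_sphere ℝ _⟩

/-- The atlas of the quotient manifold `Σ⁷_n`, consisting of all its quotient charts. -/
instance instChartedSpaceSigma7 (n : ℤ) :
    ChartedSpace (EuclideanSpace ℝ (Fin 7)) (Sigma7 n) where
  atlas := {φ | IsQuotientChart n φ}
  chartAt x := (exists_quotientChart n x).choose
  mem_chart_source x := (exists_quotientChart n x).choose_spec.2
  chart_mem_atlas x := (exists_quotientChart n x).choose_spec.1

instance instIsManifoldSigma7 (n : ℤ) : IsManifold (𝓡 7) ∞ (Sigma7 n) :=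
  isManifold_of_contDiffOn (𝓡 7) ∞ (Sigma7 n) fun φ ψ hφ hψ => by
    simpa using! IsQuotientChart.contDiffOn hφ hψ

/-- The subset `Σ⁵_n ⊂ Σ⁷_n` of all classes of points `(u, v)` such that both components of `u` are
purely imaginary. -/
def Sigma5 (n : ℤ) : Set (Sigma7 n) :=
  {x | ∃ e : Total n, proj n e = x ∧ (e : HH × HH).1.1.re = 0 ∧ (e : HH × HH).1.2.re = 0}

/-! ### The model spaces -/

/-- The unit sphere `S⁵` of `(Im ℍ)² ⊂ ℍ²`. -/
def linearS5 : Set HH := {u | OnS7 u ∧ u.1.re = 0 ∧ u.2.re = 0}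

/-- The linear action `(B, ±q) · u = B q u q̄` on `ℍ²`. -/
def linearAct (B : ℤˣ × ℤˣ) (q : unitary ℍ[ℝ]) (u : HH) : HH := diagAct B (conjAct q u)

/-- The space `ℂ⁴ = ℂ ⊕ ℂ³`. -/
abbrev C4 : Type := ℂ × (Fin 3 → ℂ)

/-- The Brieskorn manifold `W⁵_d`: the intersection of the unit sphere of `ℂ ⊕ ℂ³` with the
hypersurface `z₀ᵈ + z₁² + z₂² + z₃² = 0`. -/
def brieskornW (d : ℕ) : Set C4 :=
  {z | z.1 ^ d + ∑ i, z.2 i ^ 2 = 0 ∧ ‖z.1‖ ^ 2 + ∑ i, ‖z.2 i‖ ^ 2 = 1}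

/-- The imaginary quaternion with the given coordinates. -/
def imQuat (x : Fin 3 → ℝ) : ℍ[ℝ] := ⟨0, x 0, x 1, x 2⟩

@[simp] theorem imQuat_re (x : Fin 3 → ℝ) : (imQuat x).re = 0 := rfl

@[simp] theorem imQuat_imI (x : Fin 3 → ℝ) : (imQuat x).imI = x 0 := rfl

@[simp] theorem imQuat_imJ (x : Fin 3 → ℝ) : (imQuat x).imJ = x 1 := rfl

@[simp] theorem imQuat_imK (x : Fin 3 → ℝ) : (imQuat x).imK = x 2 := rfl

/-- The coordinates of the imaginary part of a quaternion. -/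
def imCoord (a : ℍ[ℝ]) : Fin 3 → ℝ := ![a.imI, a.imJ, a.imK]

/-- The matrix in `SO(3)` of the rotation `x ↦ q x q̄` of `Im ℍ = ℝ³`; this is the identification
`S³ / {±1} = SO(3)`. -/
def rotMatrix (q : unitary ℍ[ℝ]) : Matrix (Fin 3) (Fin 3) ℝ :=
  Matrix.of fun i j => imCoord ((q : ℍ[ℝ]) * imQuat (Pi.single j 1) * star (q : ℍ[ℝ])) i

/-- The action of `A = rotMatrix q ∈ SO(3)` on `ℂ ⊕ ℂ³`: `(z₀, z) ↦ (z₀, A z)`. -/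
def brieskornSO3 (q : unitary ℍ[ℝ]) (z : C4) : C4 :=
  (z.1, Matrix.mulVec ((rotMatrix q).map Complex.ofReal) z.2)

/-- The action of the rotation by the angle `θ` in `O(2)`:
`(z₀, z) ↦ (exp (2 i θ) z₀, exp (d i θ) z)`. -/
def brieskornRotation (d : ℕ) (θ : ℝ) (z : C4) : C4 :=
  (Complex.exp (2 * Complex.I * θ) * z.1, Complex.exp (d * Complex.I * θ) • z.2)

/-- The action of the reflection `diag(1, -1) ∈ O(2)`: complex conjugation. -/
def brieskornReflection (z : C4) : C4 := (star z.1, star z.2)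

/-- The restriction to `ℤ₂ × ℤ₂ × SO(3)` of the natural action of `O(2) × SO(3)` on `W⁵_d`. Here
`diag(ε, δ)` is the product of the rotation by `0` or `π` (for `ε = 1` or `ε = -1`) with the identity
or the reflection `diag(1, -1)` (for `ε = δ` or `ε ≠ δ`). -/
def brieskornAct (d : ℕ) (B : ℤˣ × ℤˣ) (q : unitary ℍ[ℝ]) (z : C4) : C4 :=
  brieskornRotation d (if B.1 = 1 then 0 else Real.pi)
    ((if B.1 = B.2 then id else brieskornReflection) (brieskornSO3 q z))

/-! ### Smooth maps between submanifolds -/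

section Submanifolds

variable {E : Type*} [NormedAddCommGroup E] [NormedSpace ℝ E] {H : Type*} [TopologicalSpace H]
  (I : ModelWithCorners ℝ E H) {M : Type*} [TopologicalSpace M] [ChartedSpace H M]
  {E' : Type*} [NormedAddCommGroup E'] [NormedSpace ℝ E'] {H' : Type*} [TopologicalSpace H']
  (I' : ModelWithCorners ℝ E' H') {M' : Type*} [TopologicalSpace M'] [ChartedSpace H' M']

/-- A map between subsets of manifolds is smooth if locally it extends to a smooth map between the
ambient manifolds. For embedded submanifolds this is smoothness in the usual sense. -/
def IsSmoothOnSubset {A : Set M} {B : Set M'} (f : A → B) : Prop :=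
  ∀ a : A, ∃ (W : Set M) (F : M → M'), IsOpen W ∧ (a : M) ∈ W ∧ ContMDiffOn I I' ∞ F W ∧
    ∀ b : A, (b : M) ∈ W → F b = f b

/-- The subsets `A ⊂ M` and `B ⊂ M'` are invariant under the maps `α g` and `β g`, respectively, and
there is a diffeomorphism `A → B` that intertwines these maps, for all `g`. -/
def EquivariantlyDiffeomorphic {G : Type*} (α : G → M → M) (A : Set M) (β : G → M' → M')
    (B : Set M') : Prop :=
  ∃ (hA : ∀ g, Set.MapsTo (α g) A A) (hB : ∀ g, Set.MapsTo (β g) B B) (f : A ≃ B),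
    IsSmoothOnSubset I I' f ∧ IsSmoothOnSubset I' I f.symm ∧
    ∀ g, ∀ a : A, f ⟨α g a, hA g a.2⟩ = ⟨β g (f a), hB g (f a).2⟩

end Submanifolds

/-! ### Minimal submanifolds -/

section Minimal

variable {m : ℕ} {M : Type*} [TopologicalSpace M] [ChartedSpace (EuclideanSpace ℝ (Fin m)) M]

/-- `φ` is a chart of the smooth manifold `M` in which the points of the subset `S` are those whose
coordinates with index at least `k` vanish. -/
def IsSliceChart (k : ℕ) (S : Set M)
    (φ : OpenPartialHomeomorph M (EuclideanSpace ℝ (Fin m))) : Prop :=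
  φ ∈ IsManifold.maximalAtlas (𝓡 m) ∞ M ∧
    ∀ x ∈ φ.source, x ∈ S ↔ ∀ i : Fin m, k ≤ (i : ℕ) → φ x i = 0

/-- Embedded smooth submanifolds of dimension `k ≤ m`. -/
def IsEmbeddedSubmanifold (m k : ℕ) {M : Type*} [TopologicalSpace M]
    [ChartedSpace (EuclideanSpace ℝ (Fin m)) M] (S : Set M) : Prop :=
  k ≤ m ∧ ∀ x ∈ S, ∃ φ : OpenPartialHomeomorph M (EuclideanSpace ℝ (Fin m)),
    IsSliceChart k S φ ∧ x ∈ φ.source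

variable [IsManifold (𝓡 m) ∞ M]

/-- The smooth Riemannian metrics on `M`. -/
abbrev SmoothMetric (m : ℕ) (M : Type*) [TopologicalSpace M]
    [ChartedSpace (EuclideanSpace ℝ (Fin m)) M] [IsManifold (𝓡 m) ∞ M] : Type _ :=
  Bundle.ContMDiffRiemannianMetric (𝓡 m) ∞ (EuclideanSpace ℝ (Fin m))
    (fun x : M => TangentSpace (𝓡 m) x)

/-- The coefficients `g_ij = g(∂_i, ∂_j)` of a Riemannian metric in a chart, at the point with
coordinates `y`. -/
def gramCoeff (g : SmoothMetric m M) (φ : OpenPartialHomeomorph M (EuclideanSpace ℝ (Fin m)))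
    (y : EuclideanSpace ℝ (Fin m)) (i j : Fin m) : ℝ :=
  g.inner (φ.symm y)
    (mfderiv (𝓡 m) (𝓡 m) φ.symm y (EuclideanSpace.single i 1 : EuclideanSpace ℝ (Fin m)))
    (mfderiv (𝓡 m) (𝓡 m) φ.symm y (EuclideanSpace.single j 1 : EuclideanSpace ℝ (Fin m)))

/-- The partial derivative `∂_l g_ij`. -/
def gramDeriv (g : SmoothMetric m M) (φ : OpenPartialHomeomorph M (EuclideanSpace ℝ (Fin m)))
    (y : EuclideanSpace ℝ (Fin m)) (l i j : Fin m) : ℝ :=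
  fderiv ℝ (fun y' => gramCoeff g φ y' i j) y (EuclideanSpace.single l 1)

/-- The Christoffel symbols of the first kind
`Γ_{ij,l} = g(∇_{∂_i} ∂_j, ∂_l) = (∂_i g_jl + ∂_j g_il - ∂_l g_ij) / 2` of the Levi-Civita
connection. -/
def christoffel (g : SmoothMetric m M) (φ : OpenPartialHomeomorph M (EuclideanSpace ℝ (Fin m)))
    (y : EuclideanSpace ℝ (Fin m)) (i j l : Fin m) : ℝ :=
  (gramDeriv g φ y i j l + gramDeriv g φ y j i l - gramDeriv g φ y l i j) / 2

/-- The matrix of the metric induced on the slice spanned by the first `k` coordinates. -/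
def sliceGram (k : ℕ) (g : SmoothMetric m M)
    (φ : OpenPartialHomeomorph M (EuclideanSpace ℝ (Fin m))) (y : EuclideanSpace ℝ (Fin m)) :
    Matrix {i : Fin m // (i : ℕ) < k} {i : Fin m // (i : ℕ) < k} ℝ :=
  Matrix.of fun a b => gramCoeff g φ y a b

/-- For a slice chart `φ` and a normal vector `ν = ∑ ν^l ∂_l`, the product `g(H, ν)` with the mean
curvature vector `H = ∑ h^{ab} (∇_{∂_a} ∂_b)^⊥`, where `a` and `b` run over the first `k` coordinates
and `h` is the induced metric. -/
def meanCurvature (k : ℕ) (g : SmoothMetric m M)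
    (φ : OpenPartialHomeomorph M (EuclideanSpace ℝ (Fin m))) (y : EuclideanSpace ℝ (Fin m))
    (ν : Fin m → ℝ) : ℝ :=
  ∑ a, ∑ b, (sliceGram k g φ y)⁻¹ a b * ∑ l, christoffel g φ y a b l * ν l

/-- `S` is an embedded `k`-dimensional submanifold of `M` whose mean curvature vector with respect to
`g` vanishes at every point: in every slice chart `g(H, ν) = 0` for all vectors `ν` that are
perpendicular to `∂_a` for the first `k` coordinates. -/
def IsMinimalSubmanifold (k : ℕ) (g : SmoothMetric m M) (S : Set M) : Prop :=
  IsEmbeddedSubmanifold m k S ∧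
    ∀ φ : OpenPartialHomeomorph M (EuclideanSpace ℝ (Fin m)), IsSliceChart k S φ →
      ∀ x ∈ φ.source, x ∈ S → ∀ ν : Fin m → ℝ,
        (∀ a : Fin m, (a : ℕ) < k → ∑ l, gramCoeff g φ (φ x) a l * ν l = 0) →
          meanCurvature k g φ (φ x) ν = 0

/-- The metric `g` is invariant under the smooth map `f : M → M`. -/
def IsInvariantUnder (g : SmoothMetric m M) (f : M → M) : Prop :=
  ∀ (x : M) (v w : TangentSpace (𝓡 m) x),
    g.inner (f x) (mfderiv (𝓡 m) (𝓡 m) f x v) (mfderiv (𝓡 m) (𝓡 m) f x w) = g.inner x v w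

end Minimal

end GromollMeyer

end

open GromollMeyer

/-! Minimality. Let `(u, v)` represent a point `p` of `Σ⁵`, normalised by the `⋆`-action so that one
component of `v` is a positive real; orthogonality then determines `v` as `slice i (rho n u)`. Since
`Im ℍ` has dimension 3, some unit imaginary `r` is orthogonal to `u₁` and `u₂`, and conjugation by
`r` negates `u`. On imaginary vectors `rho n (-u) = ± rho n u`, and `slice` ignores signs and
commutes with conjugation, so `r` commutes with `v`. Hence `(-u, -v r̄) = (r u r̄, r v)` lies in the
orbit of `(u, v)`, which says that `(-E, ±r)` fixes `p` (`exists_bullet_fixing`). This isometry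
reverses the sign of `Re u₁` and `Re u₂`, the two functions that cut out `Σ⁵`, so its derivative is
`-1` modulo the tangent space of `Σ⁵`. An isometry preserves the mean curvature vector `H` but sends
the normal vector `H` to `-H`, so `H = 0`. In coordinates this is the transformation law of the
Christoffel symbols (`christoffelForm_isometry`, `sum_inv_mul_christoffelForm_eq_zero`,
`isMinimalSubmanifold_of_reflections`). The real parts also provide the slice charts: in
stereographic projection from `±(i, 0)` they are two linear coordinates times a common positive
factor (`exists_adapted_chart`).

Even `n`. An imaginary `u` is the case `t = π/2` of the trigonometric formula, so `rho n u = (±1,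
0)`. Orthogonality becomes `v₁ = 0`, `|v₂| = 1`, and `[(u, v)] ↦ v̄₂ u v₂` is a diffeomorphism onto
`S⁵` with inverse `u ↦ [(u, (0, 1))]`.

Odd `n`. Now `rho n u = ± u`, so the condition is that `u` and `v` are orthogonal. The invariants `w
= quadInv u` and `X + i Y ∈ ℂ³`, with `(X, Y) = cubicInv (u, v)`, satisfy the equations of `modelX`.
Conversely, with `v = slice i u`, the quaternions `X`, `Y` are combinations of `u₁`, `u₂` whose
coefficients depend only on `w`, and the determinant of this 2 × 2 system is `4 - |w|²`, which is
nonzero. Cramer's rule recovers `u`, hence the class, smoothly from the invariants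
(`solveFst_invPair`, `solveFst_spec`). Finally the weighted dilations `(c² z₀, c³ z)` preserve the
hypersurface, commute with the group action, and carry `modelX` to the Brieskorn sphere: the scale
`c` is the unique positive root of `p c⁶ + q c⁴ = 1` with `p > 0`, which is smooth in `(p, q)`.

In both cases smoothness is tested upstairs: maps out of `Σ⁷` come from smooth functions on `ℍ² ×
ℍ²` constant on orbits, and maps into `Σ⁷` from smooth lifts. -/

noncomputable section

namespace GromollMeyer

/-! ### Fixed points of isometries with a reflecting derivative -/

section Calculus

variable {E : Type*} [NormedAddCommGroup E] [NormedSpace ℝ E]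

/-- The Christoffel form of the first kind of a field of bilinear forms on a vector space. -/
def christoffelForm (G : E → E →L[ℝ] E →L[ℝ] ℝ) (y a b c : E) : ℝ :=
  (fderiv ℝ G y a b c + fderiv ℝ G y b a c - fderiv ℝ G y c a b) / 2

/-- This is the transformation law of the Christoffel symbols at a fixed point: differentiate the
invariance of `G` once. The inhomogeneous term comes from the second derivative of `T`. -/
theorem christoffelForm_isometry {G : E → E →L[ℝ] E →L[ℝ] ℝ} {T : E → E} {y : E}
    (hG : DifferentiableAt ℝ G y) (hsymm : ∀ z a b, G z a b = G z b a)
    (hT : ContDiffAt ℝ 2 T y) (hTy : T y = y)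
    (hinv : ∀ᶠ z in 𝓝 y, ∀ a b, G z a b = G (T z) (fderiv ℝ T z a) (fderiv ℝ T z b))
    (a b c : E) :
    christoffelForm G y a b c =
      christoffelForm G y (fderiv ℝ T y a) (fderiv ℝ T y b) (fderiv ℝ T y c) +
        G y (fderiv ℝ (fderiv ℝ T) y a b) (fderiv ℝ T y c) := by
  have hT1 : DifferentiableAt ℝ T y := hT.differentiableAt (by norm_num)
  have hT2 : DifferentiableAt ℝ (fderiv ℝ T) y :=
    (hT.fderiv_right (m := 1) (by norm_num)).differentiableAt (by norm_num)
  have hsT : ∀ v w, fderiv ℝ (fderiv ℝ T) y v w = fderiv ℝ (fderiv ℝ T) y w v :=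
    fun v w => (hT.isSymmSndFDerivAt (by simp)) v w
  have hderiv : ∀ v a b : E, fderiv ℝ G y v a b =
      fderiv ℝ G y (fderiv ℝ T y v) (fderiv ℝ T y a) (fderiv ℝ T y b) +
      G y (fderiv ℝ (fderiv ℝ T) y v a) (fderiv ℝ T y b) +
      G y (fderiv ℝ T y a) (fderiv ℝ (fderiv ℝ T) y v b) := by
    intro v a b
    have h1 := (hG.hasFDerivAt.clm_apply (hasFDerivAt_const a y)).clm_apply (hasFDerivAt_const b y)
    have hGT : HasFDerivAt (fun z => G (T z)) ((fderiv ℝ G y).comp (fderiv ℝ T y)) y := by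
      have : HasFDerivAt G (fderiv ℝ G y) (T y) := by rw [hTy]; exact hG.hasFDerivAt
      exact HasFDerivAt.comp (g := G) (f := T) y this hT1.hasFDerivAt
    have ha : ∀ a, HasFDerivAt (fun z => fderiv ℝ T z a)
        ((ContinuousLinearMap.apply ℝ E a).comp (fderiv ℝ (fderiv ℝ T) y)) y := fun a =>
      (ContinuousLinearMap.apply ℝ E a).hasFDerivAt.comp y hT2.hasFDerivAt
    have h2 := (hGT.clm_apply (ha a)).clm_apply (ha b)
    have h3 := h2.congr_of_eventuallyEq (f₁ := fun z => G z a b)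
      (hinv.mono fun z hz => hz a b)
    have h4 := congrArg (fun L : E →L[ℝ] ℝ => L v) (h1.unique h3)
    simp only [ContinuousLinearMap.comp_apply, ContinuousLinearMap.apply_apply,
      add_apply, ContinuousLinearMap.flip_apply, hTy, zero_apply, map_zero,
      zero_add] at h4
    rw [h4]
    ring
  -- Of the six terms with a second derivative of `T`, four cancel in pairs by symmetry; the
  -- remaining two agree and absorb the factor 1/2.
  simp only [christoffelForm, hderiv a b c, hderiv b a c, hderiv c a b]
  rw [hsT b a, hsT c a, hsT c b, hsymm y (fderiv ℝ T y b) (fderiv ℝ (fderiv ℝ T) y a c)]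
  ring

/-- Restrict `F` to the line through `y` in the direction `a`, which stays in `V`. -/
theorem fderiv_eq_zero_of_eventually_zero_on {F : E → ℝ} {y : E} {V : Submodule ℝ E}
    (hF : DifferentiableAt ℝ F y) (hy : y ∈ V) (h0 : ∀ᶠ z in 𝓝 y, z ∈ V → F z = 0) {a : E}
    (ha : a ∈ V) : fderiv ℝ F y a = 0 := by
  have hl : HasDerivAt (fun t : ℝ => y + t • a) a 0 := by
    simpa using ((hasDerivAt_id (0 : ℝ)).smul_const a).const_add y
  have h1 : HasDerivAt (fun t : ℝ => F (y + t • a)) (fderiv ℝ F y a) 0 := by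
    refine HasFDerivAt.comp_hasDerivAt (l := F) 0 ?_ hl
    simpa using hF.hasFDerivAt
  have hc : Filter.Tendsto (fun t : ℝ => y + t • a) (𝓝 0) (𝓝 y) := by
    simpa using hl.continuousAt.tendsto
  have h2 : (fun t : ℝ => F (y + t • a)) =ᶠ[𝓝 0] fun _ => 0 :=
    (hc.eventually h0).mono fun t ht => ht (V.add_mem hy (V.smul_mem t ha))
  exact h1.unique ((hasDerivAt_const (0 : ℝ) (0 : ℝ)).congr_of_eventuallyEq h2)

/-- Apply the first-order statement twice, the second time to `z ↦ DF(z) b`, which again vanishes on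
`V` near `y`. -/
theorem fderiv_fderiv_eq_zero_of_eventually_zero_on {F : E → ℝ} {y : E} {V : Submodule ℝ E}
    (hF : ContDiffAt ℝ 2 F y) (hy : y ∈ V) (h0 : ∀ᶠ z in 𝓝 y, z ∈ V → F z = 0) {a b : E}
    (ha : a ∈ V) (hb : b ∈ V) : fderiv ℝ (fderiv ℝ F) y a b = 0 := by
  have hd : DifferentiableAt ℝ (fderiv ℝ F) y :=
    (hF.fderiv_right (m := 1) (by norm_num)).differentiableAt (by norm_num)
  have hev : ∀ᶠ z in 𝓝 y, z ∈ V → fderiv ℝ F z b = 0 := by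
    filter_upwards [h0.eventually_nhds, hF.eventually (by simp)] with z hz hz' hzV
    exact fderiv_eq_zero_of_eventually_zero_on (hz'.differentiableAt (by norm_num)) hzV hz hb
  have h1 := ((ContinuousLinearMap.apply ℝ ℝ b).hasFDerivAt.comp y hd.hasFDerivAt)
  have h2 := fderiv_eq_zero_of_eventually_zero_on h1.differentiableAt hy hev ha
  rw [h1.fderiv] at h2
  simpa using h2

end Calculus

/-- An isometry of a bilinear form also preserves the inverse form on the dual space; this is the
equation `Sᵗ h S = h` inverted. -/
theorem mul_nonsing_inv_mul_transpose {ι : Type*} [Fintype ι] [DecidableEq ι]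
    {h S : Matrix ι ι ℝ} (hdet : IsUnit h.det) (hS : S.transpose * h * S = h) :
    IsUnit S.det ∧ S * h⁻¹ * S.transpose = h⁻¹ := by
  have hSdet : IsUnit S.det := by
    have := congrArg Matrix.det hS
    rw [Matrix.det_mul] at this
    rw [← this] at hdet
    exact isUnit_of_mul_isUnit_right hdet
  have hStdet : IsUnit S.transpose.det := by rwa [Matrix.det_transpose]
  refine ⟨hSdet, ?_⟩
  have : h⁻¹ = S⁻¹ * (h⁻¹ * (S.transpose)⁻¹) := by
    conv_lhs => rw [← hS, Matrix.mul_inv_rev, Matrix.mul_inv_rev]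
  conv_lhs => rw [this]
  rw [Matrix.mul_nonsing_inv_cancel_left _ _ hSdet, Matrix.mul_assoc,
    Matrix.nonsing_inv_mul _ hStdet, Matrix.mul_one]

/-! ### Traces over a coordinate subspace -/

/-- The subspace of `ℝᵐ` spanned by the first `k` coordinates. -/
def sliceSpace (m k : ℕ) : Submodule ℝ (EuclideanSpace ℝ (Fin m)) where
  carrier := {y | ∀ i : Fin m, k ≤ (i : ℕ) → y i = 0}
  add_mem' := by intro a b ha hb i hi; simp [ha i hi, hb i hi]
  zero_mem' := by intro i _; simp
  smul_mem' := by intro c a ha i hi; simp [ha i hi]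

theorem single_mem_sliceSpace {m k : ℕ} {i : Fin m} (hi : (i : ℕ) < k) :
    (EuclideanSpace.single i 1 : EuclideanSpace ℝ (Fin m)) ∈ sliceSpace m k := by
  intro j hj
  have : j ≠ i := by rintro rfl; omega
  simp [this]

theorem eq_sum_single {m : ℕ} (y : EuclideanSpace ℝ (Fin m)) :
    y = ∑ i, y i • (EuclideanSpace.single i 1 : EuclideanSpace ℝ (Fin m)) := by
  ext j
  simp [Pi.single_apply]

theorem eq_sum_single_of_mem_sliceSpace {m k : ℕ} {y : EuclideanSpace ℝ (Fin m)}
    (hy : y ∈ sliceSpace m k) :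
    y = ∑ i : {i : Fin m // (i : ℕ) < k}, y i • EuclideanSpace.single (i : Fin m) (1 : ℝ) := by
  conv_lhs => rw [eq_sum_single y]
  have h1 := Finset.sum_subtype (F := inferInstance) (p := fun i : Fin m => (i : ℕ) < k)
    (Finset.univ.filter fun i : Fin m => (i : ℕ) < k) (by simp)
    (fun i : Fin m => y i • EuclideanSpace.single i (1 : ℝ))
  rw [← h1, Finset.sum_filter]
  refine Finset.sum_congr rfl fun i _ => ?_
  split_ifs with h
  · rfl
  · rw [hy i (by omega), zero_smul]

/-- The trace over a nondegenerate subspace of the Christoffel form vanishes in a normal direction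
if there is a local isometry fixing the point, preserving the subspace and acting as `-1` on the
quotient. -/
theorem sum_inv_mul_christoffelForm_eq_zero {m k : ℕ}
    {G : EuclideanSpace ℝ (Fin m) → EuclideanSpace ℝ (Fin m) →L[ℝ] EuclideanSpace ℝ (Fin m) →L[ℝ] ℝ}
    {T : EuclideanSpace ℝ (Fin m) → EuclideanSpace ℝ (Fin m)} {y : EuclideanSpace ℝ (Fin m)}
    (hG : DifferentiableAt ℝ G y) (hsymm : ∀ z a b, G z a b = G z b a)
    (hT : ContDiffAt ℝ 2 T y) (hTy : T y = y)
    (hinv : ∀ᶠ z in 𝓝 y, ∀ a b, G z a b = G (T z) (fderiv ℝ T z a) (fderiv ℝ T z b))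
    (hy : y ∈ sliceSpace m k) (hslice : ∀ᶠ z in 𝓝 y, z ∈ sliceSpace m k → T z ∈ sliceSpace m k)
    (hneg : ∀ c, fderiv ℝ T y c + c ∈ sliceSpace m k) {ν : EuclideanSpace ℝ (Fin m)}
    (hν : ∀ a ∈ sliceSpace m k, G y a ν = 0)
    (h : Matrix {i : Fin m // (i : ℕ) < k} {i : Fin m // (i : ℕ) < k} ℝ)
    (hh : ∀ a b, h a b = G y (EuclideanSpace.single (a : Fin m) 1) (EuclideanSpace.single (b : Fin m) 1)) :
    ∑ a, ∑ b, h⁻¹ a b * christoffelForm G y (EuclideanSpace.single (a : Fin m) 1)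
      (EuclideanSpace.single (b : Fin m) 1) ν = 0 := by
  -- For a degenerate `h` the matrix `h⁻¹` is zero by convention, so positivity of the form is not
  -- needed.
  by_cases hdet : IsUnit h.det
  swap
  · simp [Matrix.nonsing_inv_apply_not_isUnit _ hdet]
  set V := sliceSpace m k
  set D := fderiv ℝ T y
  let e : {i : Fin m // (i : ℕ) < k} → EuclideanSpace ℝ (Fin m) :=
    fun a => EuclideanSpace.single (a : Fin m) 1
  have he : ∀ a, e a ∈ V := fun a => single_mem_sliceSpace a.2
  have hT1 : DifferentiableAt ℝ T y := hT.differentiableAt (by norm_num)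
  have hT2 : DifferentiableAt ℝ (fderiv ℝ T) y :=
    (hT.fderiv_right (m := 1) (by norm_num)).differentiableAt (by norm_num)
  have hDV : ∀ a ∈ V, D a ∈ V := fun a ha => by
    have := V.sub_mem (hneg a) ha
    simpa using this
  -- The coordinates of `T` of index at least `k` vanish on `V` near `y`, hence so do their second
  -- derivatives along `V`.
  have hDDV : ∀ a ∈ V, ∀ b ∈ V, fderiv ℝ (fderiv ℝ T) y a b ∈ V := by
    intro a ha b hb l hl
    let P : EuclideanSpace ℝ (Fin m) →L[ℝ] ℝ := EuclideanSpace.proj l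
    have h1 : ContDiffAt ℝ 2 (fun z => P (T z)) y := P.contDiff.contDiffAt.comp y hT
    have h2 := fderiv_fderiv_eq_zero_of_eventually_zero_on h1 hy
      (hslice.mono fun z hz hzV => hz hzV l hl) ha hb
    have h3 : fderiv ℝ (fun z => P (T z)) =ᶠ[𝓝 y] fun z => P.comp (fderiv ℝ T z) := by
      filter_upwards [hT.eventually (by simp)] with z hz
      exact (P.hasFDerivAt.comp z (hz.differentiableAt (by norm_num)).hasFDerivAt).fderiv
    have h4 : HasFDerivAt (fun z => P.comp (fderiv ℝ T z))
        ((ContinuousLinearMap.compL ℝ _ _ _ P).comp (fderiv ℝ (fderiv ℝ T) y)) y :=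
      (ContinuousLinearMap.compL ℝ (EuclideanSpace ℝ (Fin m)) _ _ P).hasFDerivAt.comp y
        hT2.hasFDerivAt
    rw [h3.fderiv_eq, h4.fderiv] at h2
    simpa [P] using h2
  have hiso : ∀ a b, G y a b = G y (D a) (D b) := fun a b => by
    have := hinv.self_of_nhds a b
    rwa [hTy] at this
  let S : Matrix {i : Fin m // (i : ℕ) < k} {i : Fin m // (i : ℕ) < k} ℝ :=
    Matrix.of fun c a => D (e a) (c : Fin m)
  have hDe : ∀ a, D (e a) = ∑ c, S c a • e c := fun a =>
    eq_sum_single_of_mem_sliceSpace (hDV _ (he a))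
  have hS : S.transpose * h * S = h := by
    ext a b
    rw [hh, hiso]
    change _ = G y (D (e a)) (D (e b))
    rw [hDe a, hDe b]
    simp only [map_sum, map_smul, sum_apply, smul_apply,
      smul_eq_mul, Matrix.mul_apply, Matrix.transpose_apply, Finset.sum_mul, Finset.mul_sum, hh]
    refine Finset.sum_congr rfl fun c _ => Finset.sum_congr rfl fun d _ => ?_
    simp only [e]
    ring
  obtain ⟨hSdet, hSh⟩ := mul_nonsing_inv_mul_transpose hdet hS
  have hsolve : ∀ w : EuclideanSpace ℝ (Fin m), w ∈ V → (∀ a, G y (e a) w = 0) → w = 0 := by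
    intro w hw h0
    have h1 : h.mulVec (fun a => w a) = 0 := by
      ext a
      have h2 := h0 a
      rw [eq_sum_single_of_mem_sliceSpace hw] at h2
      simp only [map_sum, map_smul, smul_eq_mul] at h2
      simp only [Matrix.mulVec, dotProduct, hh, Pi.zero_apply]
      rw [← h2]
      exact Finset.sum_congr rfl fun b _ => mul_comm _ _
    have h2 : (fun a : {i : Fin m // (i : ℕ) < k} => w a) = 0 :=
      Matrix.eq_zero_of_mulVec_eq_zero hdet.ne_zero h1
    rw [eq_sum_single_of_mem_sliceSpace hw]
    exact Finset.sum_eq_zero fun a _ => by rw [congrFun h2 a]; simp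
  -- `D` restricts to a surjection of `V` because its matrix `S` on `V` is invertible.
  have hsurj : ∀ a, ∃ b ∈ V, D b = e a := by
    intro a
    refine ⟨∑ c, S⁻¹ c a • e c, V.sum_mem fun c _ => V.smul_mem _ (he c), ?_⟩
    have h1 : S * S⁻¹ = 1 := Matrix.mul_nonsing_inv _ hSdet
    simp only [map_sum, map_smul, hDe, Finset.smul_sum, smul_smul]
    rw [Finset.sum_comm]
    simp only [← Finset.sum_smul]
    have h2 : ∀ d, ∑ c, S⁻¹ c a * S d c = (1 : Matrix _ _ ℝ) d a := fun d => by
      rw [← h1, Matrix.mul_apply]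
      exact Finset.sum_congr rfl fun c _ => mul_comm _ _
    simp only [h2, Matrix.one_apply, ite_smul, one_smul, zero_smul, Finset.sum_ite_eq',
      Finset.mem_univ, if_true]
  -- The vector `Dν + ν` lies in `V` and is perpendicular to `D V = V`, on which the form is
  -- nondegenerate.
  have hDν : D ν = -ν := by
    refine eq_neg_of_add_eq_zero_left (hsolve _ (hneg ν) fun a => ?_)
    obtain ⟨b, hb, hba⟩ := hsurj a
    rw [map_add, hν _ (he a), add_zero, ← hba, ← hiso, hν b hb]
  have hlin : ∀ a b c, christoffelForm G y a b (-c) = -christoffelForm G y a b c := fun a b c => by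
    simp only [christoffelForm, map_neg, neg_apply]; ring
  -- The sign comes from `Dν = -ν`; the second-derivative term lies in `V`, so it pairs to zero with
  -- `ν`.
  have htrans : ∀ a b, christoffelForm G y (e a) (e b) ν =
      -christoffelForm G y (D (e a)) (D (e b)) ν := by
    intro a b
    rw [christoffelForm_isometry hG hsymm hT hTy hinv (e a) (e b) ν]
    change christoffelForm G y (D (e a)) (D (e b)) (D ν) + G y _ (D ν) = _
    rw [hDν, hlin, map_neg, hν _ (hDDV _ (he a) _ (he b)), neg_zero, add_zero]
  have hexp : ∀ a b, christoffelForm G y (D (e a)) (D (e b)) ν =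
      ∑ c, ∑ d, S c a * S d b * christoffelForm G y (e c) (e d) ν := by
    intro a b
    have hbil : ∀ B : EuclideanSpace ℝ (Fin m) →L[ℝ] EuclideanSpace ℝ (Fin m) →L[ℝ] ℝ,
        B (D (e a)) (D (e b)) = ∑ c, ∑ d, S c a * S d b * B (e c) (e d) := by
      intro B
      rw [hDe a, hDe b, map_sum B, sum_apply]
      refine Finset.sum_congr rfl fun c _ => ?_
      rw [map_sum]
      refine Finset.sum_congr rfl fun d _ => ?_
      simp only [map_smul, smul_apply, smul_eq_mul]
      ring
    let L : (EuclideanSpace ℝ (Fin m) →L[ℝ] ℝ) →L[ℝ] ℝ := ContinuousLinearMap.apply ℝ ℝ ν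
    have h1 := hbil ((ContinuousLinearMap.compL ℝ _ _ _ L).comp (fderiv ℝ G y))
    have h2 := hbil ((ContinuousLinearMap.compL ℝ _ _ _ L).comp (fderiv ℝ G y)).flip
    have h3 := hbil (fderiv ℝ G y ν)
    simp only [ContinuousLinearMap.comp_apply, ContinuousLinearMap.compL_apply,
      ContinuousLinearMap.flip_apply, ContinuousLinearMap.apply_apply, L] at h1 h2
    simp only [christoffelForm, h1, h2, h3]
    simp only [← Finset.sum_add_distrib, ← Finset.sum_sub_distrib, Finset.sum_div]
    refine Finset.sum_congr rfl fun c _ => Finset.sum_congr rfl fun d _ => ?_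
    ring
  change ∑ a, ∑ b, h⁻¹ a b * christoffelForm G y (e a) (e b) ν = 0
  -- By `S h⁻¹ Sᵗ = h⁻¹` the trace is unchanged by `D` on the basis vectors, so the sign in `htrans`
  -- makes it equal to its own negative.
  have hkey : ∑ a, ∑ b, h⁻¹ a b * christoffelForm G y (e a) (e b) ν =
      -∑ c, ∑ d, h⁻¹ c d * christoffelForm G y (e c) (e d) ν := by
    calc ∑ a, ∑ b, h⁻¹ a b * christoffelForm G y (e a) (e b) ν
        = -∑ a, ∑ b, ∑ c, ∑ d, S c a * h⁻¹ a b * S d b * christoffelForm G y (e c) (e d) ν := by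
          simp only [← Finset.sum_neg_distrib]
          refine Finset.sum_congr rfl fun a _ => Finset.sum_congr rfl fun b _ => ?_
          rw [htrans, hexp, mul_neg, Finset.mul_sum, ← Finset.sum_neg_distrib]
          refine Finset.sum_congr rfl fun c _ => ?_
          rw [Finset.mul_sum, ← Finset.sum_neg_distrib]
          exact Finset.sum_congr rfl fun d _ => by ring
      _ = -∑ c, ∑ d, (S * h⁻¹ * S.transpose) c d * christoffelForm G y (e c) (e d) ν := by
          congr 1
          have h1 : ∀ f : {i : Fin m // (i : ℕ) < k} → {i : Fin m // (i : ℕ) < k} →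
              {i : Fin m // (i : ℕ) < k} → {i : Fin m // (i : ℕ) < k} → ℝ,
              ∑ a, ∑ b, ∑ c, ∑ d, f a b c d = ∑ c, ∑ d, ∑ b, ∑ a, f a b c d := by
            intro f
            calc _ = ∑ a, ∑ c, ∑ b, ∑ d, f a b c d :=
                  Finset.sum_congr rfl fun a _ => Finset.sum_comm
              _ = ∑ c, ∑ a, ∑ b, ∑ d, f a b c d := Finset.sum_comm
              _ = ∑ c, ∑ a, ∑ d, ∑ b, f a b c d :=
                  Finset.sum_congr rfl fun c _ => Finset.sum_congr rfl fun a _ => Finset.sum_comm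
              _ = ∑ c, ∑ d, ∑ a, ∑ b, f a b c d :=
                  Finset.sum_congr rfl fun c _ => Finset.sum_comm
              _ = _ := Finset.sum_congr rfl fun c _ => Finset.sum_congr rfl fun d _ =>
                  Finset.sum_comm
          rw [h1]
          refine Finset.sum_congr rfl fun c _ => Finset.sum_congr rfl fun d _ => ?_
          simp only [Matrix.mul_apply, Matrix.transpose_apply, Finset.sum_mul]
      _ = _ := by rw [hSh]
  linarith

/-! ### Riemannian metrics in charts and the reflection criterion -/

section MinimalCriterion

variable {m : ℕ} {M : Type*} [TopologicalSpace M] [ChartedSpace (EuclideanSpace ℝ (Fin m)) M]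
  [IsManifold (𝓡 m) ∞ M]

/-- The metric in a chart, as a field of bilinear forms on `ℝᵐ`. -/
def chartForm (g : SmoothMetric m M) (φ : OpenPartialHomeomorph M (EuclideanSpace ℝ (Fin m)))
    (y : EuclideanSpace ℝ (Fin m)) :
    EuclideanSpace ℝ (Fin m) →L[ℝ] EuclideanSpace ℝ (Fin m) →L[ℝ] ℝ :=
  ContinuousLinearMap.bilinearComp (E := EuclideanSpace ℝ (Fin m)) (F := EuclideanSpace ℝ (Fin m))
    (g.inner (φ.symm y)) (mfderiv (𝓡 m) (𝓡 m) φ.symm y) (mfderiv (𝓡 m) (𝓡 m) φ.symm y)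

theorem chartForm_apply (g : SmoothMetric m M)
    (φ : OpenPartialHomeomorph M (EuclideanSpace ℝ (Fin m))) (y a b : EuclideanSpace ℝ (Fin m)) :
    chartForm g φ y a b = g.inner (φ.symm y) (mfderiv (𝓡 m) (𝓡 m) φ.symm y a)
      (mfderiv (𝓡 m) (𝓡 m) φ.symm y b) := rfl

/-- Bilinear forms on `ℝᵐ` can be tested on fixed vectors `a`, `b`. Their images under the
derivative of `φ.symm` are smooth fields along `φ.symm`, and pairing them with the smooth section
`g` gives a smooth section of the trivial line bundle. -/
theorem contDiffOn_chartForm (g : SmoothMetric m M)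
    {φ : OpenPartialHomeomorph M (EuclideanSpace ℝ (Fin m))}
    (hφ : φ ∈ IsManifold.maximalAtlas (𝓡 m) ∞ M) : ContDiffOn ℝ ∞ (chartForm g φ) φ.target := by
  rw [contDiffOn_clm_apply]
  intro a
  rw [contDiffOn_clm_apply]
  intro b
  simp only [chartForm_apply]
  intro y hy
  refine ContDiffAt.contDiffWithinAt ?_
  have hs : ContMDiffOn (𝓡 m) (𝓡 m) ∞ φ.symm φ.target := contMDiffOn_symm_of_mem_maximalAtlas hφ
  have hnhds : φ.target ∈ 𝓝 y := φ.open_target.mem_nhds hy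
  have hsec : ∀ a : EuclideanSpace ℝ (Fin m), ContMDiffAt (𝓡 m) (𝓡 m).tangent ∞
      (fun z => Bundle.TotalSpace.mk' (EuclideanSpace ℝ (Fin m)) (E := fun x : M => TangentSpace (𝓡 m) x)
        (φ.symm z) (mfderiv (𝓡 m) (𝓡 m) φ.symm z a)) y := by
    intro a
    have h1 := hs.contMDiffOn_tangentMapWithin (m := ∞) le_rfl φ.open_target.uniqueMDiffOn
    have h2 : ContMDiff (𝓡 m) (𝓡 m).tangent ∞
        (fun z : EuclideanSpace ℝ (Fin m) => (⟨z, a⟩ : TangentBundle (𝓡 m) (EuclideanSpace ℝ (Fin m)))) :=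
      contMDiff_vectorSpace_iff_contDiff.2 contDiff_const
    have h3 : ContMDiffAt (𝓡 m) (𝓡 m).tangent ∞
        ((tangentMapWithin (𝓡 m) (𝓡 m) φ.symm φ.target) ∘ fun z : EuclideanSpace ℝ (Fin m) =>
          (⟨z, a⟩ : TangentBundle (𝓡 m) (EuclideanSpace ℝ (Fin m)))) y := by
      refine ContMDiffWithinAt.contMDiffAt (s := φ.target) ?_ hnhds
      exact (h1 ⟨y, a⟩ hy).comp y h2.contMDiffAt.contMDiffWithinAt (fun z hz => hz)
    refine h3.congr_of_eventuallyEq ?_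
    filter_upwards [hnhds] with z hz
    simp only [Function.comp_apply, tangentMapWithin]
    rw [mfderivWithin_of_isOpen φ.open_target hz]
  have hg : ContMDiffAt (𝓡 m) ((𝓡 m).prod 𝓘(ℝ, EuclideanSpace ℝ (Fin m) →L[ℝ]
      EuclideanSpace ℝ (Fin m) →L[ℝ] ℝ)) ∞
      (fun z => Bundle.TotalSpace.mk' (EuclideanSpace ℝ (Fin m) →L[ℝ]
        EuclideanSpace ℝ (Fin m) →L[ℝ] ℝ) (E := fun x : M => (TangentSpace (𝓡 m) x →L[ℝ]
          TangentSpace (𝓡 m) x →L[ℝ] ℝ)) (φ.symm z) (g.inner (φ.symm z))) y :=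
    g.contMDiff.contMDiffAt.comp y (hs.contMDiffAt hnhds)
  have h4 : ContMDiffAt (𝓡 m) ((𝓡 m).prod 𝓘(ℝ)) ∞
      (fun z => Bundle.TotalSpace.mk' ℝ (E := Bundle.Trivial M ℝ) (φ.symm z)
        (g.inner (φ.symm z) (mfderiv (𝓡 m) (𝓡 m) φ.symm z a)
          (mfderiv (𝓡 m) (𝓡 m) φ.symm z b))) y := by
    apply ContMDiffAt.clm_bundle_apply₂ (F₁ := EuclideanSpace ℝ (Fin m))
      (F₂ := EuclideanSpace ℝ (Fin m))
    · exact hg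
    · exact hsec a
    · exact hsec b
  rw [Bundle.contMDiffAt_totalSpace] at h4
  exact h4.2.contDiffAt

theorem gramCoeff_eq_chartForm (g : SmoothMetric m M)
    (φ : OpenPartialHomeomorph M (EuclideanSpace ℝ (Fin m))) (y : EuclideanSpace ℝ (Fin m))
    (i j : Fin m) : gramCoeff g φ y i j =
      chartForm g φ y (EuclideanSpace.single i 1) (EuclideanSpace.single j 1) := rfl

theorem gramDeriv_eq (g : SmoothMetric m M)
    {φ : OpenPartialHomeomorph M (EuclideanSpace ℝ (Fin m))} {y : EuclideanSpace ℝ (Fin m)}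
    (h : DifferentiableAt ℝ (chartForm g φ) y) (l i j : Fin m) : gramDeriv g φ y l i j =
      fderiv ℝ (chartForm g φ) y (EuclideanSpace.single l 1) (EuclideanSpace.single i 1)
        (EuclideanSpace.single j 1) := by
  simp only [gramDeriv, gramCoeff_eq_chartForm]
  have h1 := (h.hasFDerivAt.clm_apply (hasFDerivAt_const (EuclideanSpace.single i (1 : ℝ)) y)).clm_apply
    (hasFDerivAt_const (EuclideanSpace.single j (1 : ℝ)) y)
  rw [h1.fderiv]
  simp

/-- The Christoffel symbols are the values of `christoffelForm` on basis vectors, and that form is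
linear in its last argument. -/
theorem meanCurvature_eq (k : ℕ) (g : SmoothMetric m M)
    {φ : OpenPartialHomeomorph M (EuclideanSpace ℝ (Fin m))} {y : EuclideanSpace ℝ (Fin m)}
    (h : DifferentiableAt ℝ (chartForm g φ) y) (ν : Fin m → ℝ) : meanCurvature k g φ y ν =
      ∑ a, ∑ b, (sliceGram k g φ y)⁻¹ a b * christoffelForm (chartForm g φ) y
        (EuclideanSpace.single (a : Fin m) 1) (EuclideanSpace.single (b : Fin m) 1)
          (WithLp.toLp 2 ν) := by
  refine Finset.sum_congr rfl fun a _ => Finset.sum_congr rfl fun b _ => ?_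
  congr 1
  conv_rhs => rw [eq_sum_single (WithLp.toLp 2 ν)]
  simp only [christoffel, gramDeriv_eq g h, christoffelForm, map_sum, map_smul, sum_apply,
    smul_apply, smul_eq_mul, ← Finset.sum_add_distrib, ← Finset.sum_sub_distrib, Finset.sum_div]
  exact Finset.sum_congr rfl fun l _ => by ring

/-- An embedded submanifold is minimal if at each of its points there is an isometry that fixes the
point, preserves the submanifold and acts as `-1` on the normal space. -/
theorem isMinimalSubmanifold_of_reflections {k : ℕ} (g : SmoothMetric m M) {S : Set M} (hk : k ≤ m)
    (H : ∀ p ∈ S, ∃ (τ : M → M) (ψ : OpenPartialHomeomorph M (EuclideanSpace ℝ (Fin m))),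
      ContMDiff (𝓡 m) (𝓡 m) ∞ τ ∧ IsInvariantUnder g τ ∧ τ p = p ∧ Set.MapsTo τ S S ∧
      IsSliceChart k S ψ ∧ p ∈ ψ.source ∧
      ∀ c, fderiv ℝ (fun y => ψ (τ (ψ.symm y))) (ψ p) c + c ∈ sliceSpace m k) :
    IsMinimalSubmanifold k g S := by
  refine ⟨⟨hk, fun x hx => ?_⟩, fun φ hφ x hx hxS ν hν => ?_⟩
  · obtain ⟨τ, ψ, -, -, -, -, hψ, hxψ, -⟩ := H x hx
    exact ⟨ψ, hψ, hxψ⟩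
  obtain ⟨τ, ψ, hτ, hτg, hτx, hτS, hψ, hxψ, hneg⟩ := H x hxS
  set y := φ x with hy
  have hxy : φ.symm y = x := φ.left_inv hx
  have hyt : y ∈ φ.target := φ.map_source hx
  have hφs : ContMDiffOn (𝓡 m) (𝓡 m) ∞ φ.symm φ.target :=
    contMDiffOn_symm_of_mem_maximalAtlas hφ.1
  have hφm : ContMDiffOn (𝓡 m) (𝓡 m) ∞ φ φ.source := contMDiffOn_of_mem_maximalAtlas hφ.1
  have hψs : ContMDiffOn (𝓡 m) (𝓡 m) ∞ ψ.symm ψ.target :=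
    contMDiffOn_symm_of_mem_maximalAtlas hψ.1
  have hψm : ContMDiffOn (𝓡 m) (𝓡 m) ∞ ψ ψ.source := contMDiffOn_of_mem_maximalAtlas hψ.1
  have hφsy : ContMDiffAt (𝓡 m) (𝓡 m) ∞ φ.symm y := hφs.contMDiffAt (φ.open_target.mem_nhds hyt)
  have hψsy : ContMDiffAt (𝓡 m) (𝓡 m) ∞ ψ.symm (ψ x) :=
    hψs.contMDiffAt (ψ.open_target.mem_nhds (ψ.map_source hxψ))
  have hφx : ContMDiffAt (𝓡 m) (𝓡 m) ∞ φ x := hφm.contMDiffAt (φ.open_source.mem_nhds hx)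
  have hψx : ContMDiffAt (𝓡 m) (𝓡 m) ∞ ψ x := hψm.contMDiffAt (ψ.open_source.mem_nhds hxψ)
  have hψxy : ψ.symm (ψ x) = x := ψ.left_inv hxψ
  -- the isometry in the coordinates of the given chart
  set T : EuclideanSpace ℝ (Fin m) → EuclideanSpace ℝ (Fin m) := fun z => φ (τ (φ.symm z)) with hTdef
  have hTy : T y = y := by simp only [hTdef, hxy, hτx]; rfl
  have hTd : ContDiffAt ℝ ∞ T y := by
    rw [← contMDiffAt_iff_contDiffAt]
    refine ContMDiffAt.comp (I' := 𝓡 m) y (g := φ) (f := fun z => τ (φ.symm z)) ?_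
      (hτ.contMDiffAt.comp y hφsy)
    rw [hxy, hτx]; exact hφx
  have hcτ : ContinuousAt (fun z => τ (φ.symm z)) y :=
    (hτ.continuous.continuousAt).comp hφsy.continuousAt
  have hsrc : ∀ᶠ z in 𝓝 y, z ∈ φ.target ∧ τ (φ.symm z) ∈ φ.source := by
    refine (Filter.eventually_of_mem (φ.open_target.mem_nhds hyt) fun _ h => h).and ?_
    refine hcτ.eventually (φ.open_source.mem_nhds ?_)
    simp only [hxy, hτx]; exact hx
  have hslice : ∀ᶠ z in 𝓝 y, z ∈ sliceSpace m k → T z ∈ sliceSpace m k := by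
    filter_upwards [hsrc] with z hz hzV
    have h1 : φ.symm z ∈ S := by
      rwa [hφ.2 _ (φ.map_target hz.1), φ.right_inv hz.1]
    exact (hφ.2 _ hz.2).1 (hτS h1)
  have hG : DifferentiableAt ℝ (chartForm g φ) y :=
    ((contDiffOn_chartForm g hφ.1).contDiffAt (φ.open_target.mem_nhds hyt)).differentiableAt (by simp)
  -- Near `y` one has `φ.symm ∘ T = τ ∘ φ.symm`. By the chain rule, invariance of `g` under `τ` is
  -- invariance of its chart form under `T`.
  have hinv : ∀ᶠ z in 𝓝 y, ∀ a b, chartForm g φ z a b =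
      chartForm g φ (T z) (fderiv ℝ T z a) (fderiv ℝ T z b) := by
    filter_upwards [hsrc.eventually_nhds,
      (hTd.of_le (m := 1) (by norm_cast)).eventually (by simp)] with z hz hTz a b
    have hz0 := hz.self_of_nhds
    have hTzt : T z ∈ φ.target := φ.map_source hz0.2
    have hback : φ.symm (T z) = τ (φ.symm z) := φ.left_inv hz0.2
    have hd1 : MDifferentiableAt (𝓡 m) (𝓡 m) φ.symm (T z) :=
      (hφs.contMDiffAt (φ.open_target.mem_nhds hTzt)).mdifferentiableAt (by simp)
    have hd2 : MDifferentiableAt (𝓡 m) (𝓡 m) T z :=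
      (hTz.differentiableAt (by norm_num)).mdifferentiableAt
    have hd3 : MDifferentiableAt (𝓡 m) (𝓡 m) φ.symm z :=
      (hφs.contMDiffAt (φ.open_target.mem_nhds hz0.1)).mdifferentiableAt (by simp)
    have hd4 : MDifferentiableAt (𝓡 m) (𝓡 m) τ (φ.symm z) := hτ.mdifferentiableAt (by simp)
    have h1 := mfderiv_comp z hd1 hd2
    have h2 := mfderiv_comp z hd4 hd3
    have h3 : (φ.symm ∘ T) =ᶠ[𝓝 z] (τ ∘ φ.symm) := hz.mono fun w hw => φ.left_inv hw.2
    rw [← mfderiv_eq_fderiv, chartForm_apply, chartForm_apply]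
    rw [← hτg]
    have h4 : ∀ a : EuclideanSpace ℝ (Fin m),
        mfderiv (𝓡 m) (𝓡 m) φ.symm (T z) (mfderiv (𝓡 m) (𝓡 m) T z a) =
        mfderiv (𝓡 m) (𝓡 m) τ (φ.symm z) (mfderiv (𝓡 m) (𝓡 m) φ.symm z a) := by
      intro a
      have h5 := h3.mfderiv_eq (I := 𝓡 m) (I' := 𝓡 m)
      rw [h1, h2] at h5
      exact congrArg (fun L : EuclideanSpace ℝ (Fin m) →L[ℝ] EuclideanSpace ℝ (Fin m) => L a) h5
    -- The points `φ.symm (T z)` and `τ (φ.symm z)` are equal but not definitionally so; all tangent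
    -- spaces are the same model space, which lets the vectors stay unchanged when the base point is
    -- replaced.
    have h6 : ∀ (p q : M) (_ : p = q) (v w : EuclideanSpace ℝ (Fin m)),
        g.inner p v w = g.inner q v w := by
      rintro p _ rfl v w; rfl
    refine Eq.trans ?_ (h6 _ _ hback.symm _ _)
    exact (congrArg₂ (fun v w : EuclideanSpace ℝ (Fin m) => g.inner (τ (φ.symm z)) v w)
      (h4 a) (h4 b)).symm
  -- change of coordinates
  have hyV : y ∈ sliceSpace m k := (hφ.2 x hx).1 hxS
  have hψV : ψ x ∈ sliceSpace m k := (hψ.2 x hxψ).1 hxS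
  -- Minimality concerns every slice chart `φ`, but the reflection is known only in the slice chart
  -- `ψ`. Both charts send `S` to `sliceSpace m k`, so the derivative of a transition map preserves
  -- that subspace.
  have hchange : ∀ {α β : OpenPartialHomeomorph M (EuclideanSpace ℝ (Fin m))},
      IsSliceChart k S α → IsSliceChart k S β → x ∈ α.source → x ∈ β.source →
      ContDiffAt ℝ ∞ (fun z => β (α.symm z)) (α x) ∧
      ∀ c ∈ sliceSpace m k, fderiv ℝ (fun z => β (α.symm z)) (α x) c ∈ sliceSpace m k := by
    intro α β hα hβ hxα hxβ
    have hαs : ContMDiffAt (𝓡 m) (𝓡 m) ∞ α.symm (α x) :=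
      (contMDiffOn_symm_of_mem_maximalAtlas hα.1).contMDiffAt
        (α.open_target.mem_nhds (α.map_source hxα))
    have hαx : α.symm (α x) = x := α.left_inv hxα
    have hβx : ContMDiffAt (𝓡 m) (𝓡 m) ∞ β x :=
      (contMDiffOn_of_mem_maximalAtlas hβ.1).contMDiffAt (β.open_source.mem_nhds hxβ)
    have h1 : ContDiffAt ℝ ∞ (fun z => β (α.symm z)) (α x) := by
      rw [← contMDiffAt_iff_contDiffAt]
      refine ContMDiffAt.comp (I' := 𝓡 m) (α x) (g := β) (f := α.symm) ?_ hαs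
      rw [hαx]; exact hβx
    refine ⟨h1, fun c hc l hl => ?_⟩
    let P : EuclideanSpace ℝ (Fin m) →L[ℝ] ℝ := EuclideanSpace.proj l
    have h2 : DifferentiableAt ℝ (fun z => β (α.symm z)) (α x) := h1.differentiableAt (by simp)
    have h3 := P.hasFDerivAt.comp (α x) h2.hasFDerivAt
    have h4 := fderiv_eq_zero_of_eventually_zero_on h3.differentiableAt (V := sliceSpace m k)
      ((hα.2 x hxα).1 hxS) ?_ hc
    · rw [h3.fderiv] at h4
      simpa [P] using h4
    · filter_upwards [α.open_target.mem_nhds (α.map_source hxα),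
        hαs.continuousAt.eventually (β.open_source.mem_nhds (by rw [hαx]; exact hxβ))]
        with z hz hz' hzV
      have h5 : α.symm z ∈ S := by
        rw [hα.2 _ (α.map_target hz), α.right_inv hz]; exact hzV
      exact (hβ.2 _ hz').1 h5 l hl
  obtain ⟨hC, -⟩ := hchange hφ hψ hx hxψ
  obtain ⟨hC', hCV⟩ := hchange hψ hφ hxψ hx
  -- `T` is conjugate to `T'` by the transition maps, whose derivatives are inverse to each other:
  -- `DT c + c` is the image under `DC'` of `DT' (DC c) + DC c`.
  have hnegφ : ∀ c, fderiv ℝ T y c + c ∈ sliceSpace m k := by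
    intro c
    set C := fun z => ψ (φ.symm z)
    set C' := fun z => φ (ψ.symm z)
    set T' : EuclideanSpace ℝ (Fin m) → EuclideanSpace ℝ (Fin m) := fun z => ψ (τ (ψ.symm z))
    have hCy : C y = ψ x := by simp only [C, hxy]
    have hT'x : T' (ψ x) = ψ x := by simp only [T', hψxy, hτx]
    have hT'd : DifferentiableAt ℝ T' (ψ x) := by
      have : ContDiffAt ℝ ∞ T' (ψ x) := by
        rw [← contMDiffAt_iff_contDiffAt]
        refine ContMDiffAt.comp (I' := 𝓡 m) (ψ x) (g := ψ) (f := fun z => τ (ψ.symm z)) ?_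
          (hτ.contMDiffAt.comp _ hψsy)
        rw [hψxy, hτx]; exact hψx
      exact this.differentiableAt (by simp)
    have hdC : HasFDerivAt C (fderiv ℝ C y) y := (hC.differentiableAt (by simp)).hasFDerivAt
    have hdC' : HasFDerivAt C' (fderiv ℝ C' (ψ x)) (ψ x) :=
      (hC'.differentiableAt (by simp)).hasFDerivAt
    have hdT' : HasFDerivAt T' (fderiv ℝ T' (ψ x)) (ψ x) := hT'd.hasFDerivAt
    have hnear : ∀ᶠ z in 𝓝 y, z ∈ φ.target ∧ φ.symm z ∈ ψ.source ∧ τ (φ.symm z) ∈ ψ.source := by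
      refine (Filter.eventually_of_mem (φ.open_target.mem_nhds hyt) fun _ h => h).and ?_
      refine (hφsy.continuousAt.eventually (ψ.open_source.mem_nhds ?_)).and
        (hcτ.eventually (ψ.open_source.mem_nhds ?_))
      · rw [hxy]; exact hxψ
      · simp only [hxy, hτx]; exact hxψ
    have hid : HasFDerivAt (fun z => C' (C z)) ((fderiv ℝ C' (ψ x)).comp (fderiv ℝ C y)) y :=
      HasFDerivAt.comp (g := C') (f := C) y (by rw [hCy]; exact hdC') hdC
    have hid' : HasFDerivAt (fun z => C' (C z))
        (ContinuousLinearMap.id ℝ (EuclideanSpace ℝ (Fin m))) y := by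
      refine (hasFDerivAt_id y).congr_of_eventuallyEq ?_
      filter_upwards [hnear] with z hz
      simp only [C, C', id, ψ.left_inv hz.2.1, φ.right_inv hz.1]
    have hTc : HasFDerivAt (fun z => C' (T' (C z)))
        ((fderiv ℝ C' (ψ x)).comp ((fderiv ℝ T' (ψ x)).comp (fderiv ℝ C y))) y := by
      refine HasFDerivAt.comp (g := C') (f := fun z => T' (C z)) y ?_ ?_
      · rw [hCy, hT'x]; exact hdC'
      · exact HasFDerivAt.comp (g := T') (f := C) y (by rw [hCy]; exact hdT') hdC
    have hTc' : T =ᶠ[𝓝 y] fun z => C' (T' (C z)) := by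
      filter_upwards [hnear] with z hz
      simp only [C, C', T', T, ψ.left_inv hz.2.1, ψ.left_inv hz.2.2]
    rw [(hTc.congr_of_eventuallyEq hTc').fderiv]
    have h1 : c = fderiv ℝ C' (ψ x) (fderiv ℝ C y c) := by
      have := congrArg (fun L : EuclideanSpace ℝ (Fin m) →L[ℝ] EuclideanSpace ℝ (Fin m) => L c)
        (hid.unique hid')
      exact this.symm
    have h2 := hCV _ (hneg (fderiv ℝ C y c))
    rw [map_add] at h2
    rwa [← h1] at h2
  rw [meanCurvature_eq k g hG]
  refine sum_inv_mul_christoffelForm_eq_zero hG (fun z a b => ?_)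
    (hTd.of_le (by norm_cast)) hTy hinv hyV hslice hnegφ ?_ _ (fun a b => rfl)
  · rw [chartForm_apply, chartForm_apply, g.symm]
  · intro a ha
    rw [eq_sum_single_of_mem_sliceSpace ha, map_sum, sum_apply]
    refine Finset.sum_eq_zero fun i _ => ?_
    rw [map_smul, smul_apply]
    have h1 := hν i i.2
    have h2 : chartForm g φ y (EuclideanSpace.single (i : Fin m) 1) (WithLp.toLp 2 ν) = 0 := by
      rw [eq_sum_single (WithLp.toLp 2 ν), map_sum, ← h1]
      refine Finset.sum_congr rfl fun l _ => ?_
      rw [map_smul, smul_eq_mul, mul_comm]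
      rfl
    rw [h2, smul_zero]

end MinimalCriterion

/-! ### Smooth maps from and to the quotient manifold -/

/-- A quotient chart composed with the projection extends locally to a smooth map `G` on the ambient
space, so in the chart `F` is `G ∘ s`. -/
theorem contMDiffAt_of_lift {n : ℤ} {N : Type*} [NormedAddCommGroup N] [NormedSpace ℝ N]
    {s : N → HH × HH} {F : N → Sigma7 n} {z : N} (hs : ContDiffAt ℝ ∞ s z)
    (hF : ∀ᶠ w in 𝓝 z, ∃ h : s w ∈ totalSet n, F w = proj n ⟨s w, h⟩) :
    ContMDiffAt 𝓘(ℝ, N) (𝓡 7) ∞ F z := by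
  obtain ⟨hz, hFz⟩ := hF.self_of_nhds
  rw [contMDiffAt_iff_target]
  constructor
  · intro O hO
    change F ⁻¹' O ∈ 𝓝 z
    obtain ⟨O', hO'O, hO', hzO'⟩ := mem_nhds_iff.1 hO
    -- The lift `s` takes values in the ambient space, so the open set of `Total n` has to be
    -- replaced by an ambient open set that induces it.
    obtain ⟨U, hU, hUO⟩ := isOpen_induced_iff.1 (hO'.preimage (continuous_proj n))
    have hmem : ∀ e : Total n, (e : HH × HH) ∈ U ↔ proj n e ∈ O' := fun e => by
      rw [← Set.mem_preimage (f := proj n), ← hUO]; rfl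
    have hzU : s z ∈ U := (hmem ⟨s z, hz⟩).2 (by rw [← hFz]; exact hzO')
    filter_upwards [hF, hs.continuousAt.preimage_mem_nhds (hU.mem_nhds hzU)] with w hw hwU
    obtain ⟨h, hw⟩ := hw
    refine hO'O ?_
    rw [hw]
    exact (hmem ⟨s w, h⟩).1 hwU
  · rw [contMDiffAt_iff_contDiffAt]
    have hc : IsQuotientChart n (chartAt (EuclideanSpace ℝ (Fin 7)) (F z)) :=
      chart_mem_atlas (EuclideanSpace ℝ (Fin 7)) (F z)
    have hsrc := mem_chart_source (EuclideanSpace ℝ (Fin 7)) (F z)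
    obtain ⟨W, G, hW, hzW, hG, hGφ⟩ := hc.1 ⟨s z, hz⟩ (by rw [← hFz]; exact hsrc)
    obtain ⟨U, hU, hUO⟩ := isOpen_induced_iff.1
      ((chartAt (EuclideanSpace ℝ (Fin 7)) (F z)).open_source.preimage (continuous_proj n))
    have hmem : ∀ e : Total n, (e : HH × HH) ∈ U ↔
        proj n e ∈ (chartAt (EuclideanSpace ℝ (Fin 7)) (F z)).source := fun e => by
      rw [← Set.mem_preimage (f := proj n), ← hUO]; rfl
    have hzU : s z ∈ U := (hmem ⟨s z, hz⟩).2 (by rw [← hFz]; exact hsrc)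
    have hGs : ContDiffAt ℝ ∞ (fun w => G (s w)) z :=
      (hG.contDiffAt (hW.mem_nhds hzW)).comp z hs
    refine hGs.congr_of_eventuallyEq ?_
    filter_upwards [hF, hs.continuousAt.preimage_mem_nhds (hU.mem_nhds hzU),
      hs.continuousAt.preimage_mem_nhds (hW.mem_nhds hzW)] with w hw hwU hwW
    obtain ⟨h, hw⟩ := hw
    rw [hGφ ⟨s w, h⟩ hwW ((hmem ⟨s w, h⟩).1 hwU), ← hw]
    simp

/-- The inverse of a quotient chart has smooth local lifts, so smoothness of a map out of `Σ⁷` can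
be tested along lifted maps. -/
theorem contMDiffAt_of_sections {n : ℤ} {E' : Type*} [NormedAddCommGroup E'] [NormedSpace ℝ E']
    {H' : Type*} [TopologicalSpace H'] {I' : ModelWithCorners ℝ E' H'} {M' : Type*}
    [TopologicalSpace M'] [ChartedSpace H' M'] {f : Sigma7 n → M'} {x : Sigma7 n}
    (H : ∀ (s : EuclideanSpace ℝ (Fin 7) → HH × HH) (F : EuclideanSpace ℝ (Fin 7) → Sigma7 n)
      (y : EuclideanSpace ℝ (Fin 7)), F y = x → ContDiffAt ℝ ∞ s y →
      (∀ᶠ w in 𝓝 y, ∃ h : s w ∈ totalSet n, F w = proj n ⟨s w, h⟩) →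
      ContMDiffAt (𝓡 7) I' ∞ (fun w => f (F w)) y) :
    ContMDiffAt (𝓡 7) I' ∞ f x := by
  set φ := chartAt (EuclideanSpace ℝ (Fin 7)) x with hφ
  have hc : IsQuotientChart n φ := chart_mem_atlas (EuclideanSpace ℝ (Fin 7)) x
  have hsrc : x ∈ φ.source := mem_chart_source (EuclideanSpace ℝ (Fin 7)) x
  have hmax : φ ∈ IsManifold.maximalAtlas (𝓡 7) ∞ (Sigma7 n) :=
    IsManifold.chart_mem_maximalAtlas x
  have hyt := φ.map_source hsrc
  obtain ⟨W, s, hW, hyW, hs, hsφ⟩ := hc.2 (φ x) hyt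
  have h1 := H s φ.symm (φ x) (φ.left_inv hsrc) (hs.contDiffAt (hW.mem_nhds hyW)) (by
    filter_upwards [hW.mem_nhds hyW, φ.open_target.mem_nhds hyt] with w hw hwt
    obtain ⟨h, hp⟩ := hsφ w ⟨hw, hwt⟩
    exact ⟨h, hp.symm⟩)
  have h2 : ContMDiffAt (𝓡 7) (𝓡 7) ∞ φ x :=
    (contMDiffOn_of_mem_maximalAtlas hmax).contMDiffAt (φ.open_source.mem_nhds hsrc)
  refine (h1.comp x h2).congr_of_eventuallyEq ?_
  filter_upwards [φ.open_source.mem_nhds hsrc] with w hw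
  simp only [Function.comp_apply, φ.left_inv hw]

/-- A map to a vector space is smooth if its composition with the projection extends to the
ambient space. -/
theorem contMDiffAt_of_comp_proj {n : ℤ} {V : Type*} [NormedAddCommGroup V] [NormedSpace ℝ V]
    {f : Sigma7 n → V} {G : HH × HH → V} (hfG : ∀ e : Total n, f (proj n e) = G e) {x : Sigma7 n}
    (hG : ∀ e : Total n, proj n e = x → ContDiffAt ℝ ∞ G e) :
    ContMDiffAt (𝓡 7) 𝓘(ℝ, V) ∞ f x := by
  refine contMDiffAt_of_sections fun s F y hy hs hF => ?_
  obtain ⟨h, hFy⟩ := hF.self_of_nhds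
  rw [contMDiffAt_iff_contDiffAt]
  have h1 : ContDiffAt ℝ ∞ (fun w => G (s w)) y :=
    ContDiffAt.comp (g := G) y (hG ⟨s y, h⟩ (by rw [← hFy, hy])) hs
  refine h1.congr_of_eventuallyEq ?_
  filter_upwards [hF] with w hw
  obtain ⟨h', hw⟩ := hw
  rw [hw, hfG]

/-- A self-map is smooth if it lifts to a smooth map of the ambient space. -/
theorem contMDiff_of_lift_proj {n : ℤ} {f : Sigma7 n → Sigma7 n} {K : HH × HH → HH × HH}
    (hK : ContDiff ℝ ∞ K)
    (hfK : ∀ e : Total n, ∃ h : K e ∈ totalSet n, f (proj n e) = proj n ⟨K e, h⟩) :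
    ContMDiff (𝓡 7) (𝓡 7) ∞ f := by
  intro x
  refine contMDiffAt_of_sections fun s F y hy hs hF => ?_
  refine contMDiffAt_of_lift (s := fun w => K (s w)) (hK.contDiffAt.comp y hs) ?_
  filter_upwards [hF] with w hw
  obtain ⟨h', hw⟩ := hw
  obtain ⟨h, hf⟩ := hfK ⟨s w, h'⟩
  exact ⟨h, by rw [hw, hf]⟩

theorem contDiff_diagAct (B : ℤˣ × ℤˣ) : ContDiff ℝ ∞ (diagAct B) :=
  (contDiff_const.mul contDiff_fst).prodMk (contDiff_const.mul contDiff_snd)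

theorem contDiff_rightAct (q : unitary ℍ[ℝ]) : ContDiff ℝ ∞ (rightAct q) :=
  (contDiff_fst.mul contDiff_const).prodMk (contDiff_snd.mul contDiff_const)

theorem bullet_proj (n : ℤ) (B : ℤˣ × ℤˣ) (q : unitary ℍ[ℝ]) (e : Total n) :
    bullet n B q (proj n e) = proj n (bulletTotal n B q e) := rfl

theorem contMDiff_bullet (n : ℤ) (B : ℤˣ × ℤˣ) (q : unitary ℍ[ℝ]) :
    ContMDiff (𝓡 7) (𝓡 7) ∞ (bullet n B q) :=
  contMDiff_of_lift_proj
    (K := fun p => (diagAct B p.1, rightAct q (diagAct B p.2)))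
    (((contDiff_diagAct B).comp contDiff_fst).prodMk
      ((contDiff_rightAct q).comp ((contDiff_diagAct B).comp contDiff_snd)))
    fun e => ⟨(bulletTotal n B q e).2, rfl⟩

/-! ### The subset `Σ⁵` -/

/-- Conjugation preserves real parts, so the condition does not depend on the representative. -/
theorem proj_mem_Sigma5 {n : ℤ} (e : Total n) :
    proj n e ∈ Sigma5 n ↔ (e : HH × HH).1.1.re = 0 ∧ (e : HH × HH).1.2.re = 0 := by
  refine ⟨?_, fun h => ⟨e, rfl, h⟩⟩
  rintro ⟨e', h, he'⟩
  obtain ⟨q, rfl⟩ := Quotient.exact h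
  simpa only [starAct, conjAct, re_conj] using he'

theorem re_sign_mul (ε : ℤˣ) (a : ℍ[ℝ]) : (((ε : ℤ) : ℍ[ℝ]) * a).re = (ε : ℤ) * a.re := by
  rcases Int.units_eq_one_or ε with rfl | rfl <;> simp

theorem mapsTo_bullet_Sigma5 (n : ℤ) (B : ℤˣ × ℤˣ) (q : unitary ℍ[ℝ]) :
    Set.MapsTo (bullet n B q) (Sigma5 n) (Sigma5 n) := by
  rintro _ ⟨e, rfl, h1, h2⟩
  rw [bullet_proj, proj_mem_Sigma5]
  simp only [bulletTotal, diagAct, re_sign_mul, h1, h2, mul_zero, and_self]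

theorem exists_pr_ne_zero {n : ℤ} (e : Total n) : ∃ i, pr i (e : HH × HH).2 ≠ 0 := by
  by_contra! h
  have := (norm_pr true _).1 e.2.2.1
  rw [h, h] at this
  simp at this

/-! ### Charts adapted to `Σ⁵` -/

/-- This allows a linear change of coordinates that makes the two real parts the last coordinates.
-/
theorem IsQuotientChart.transHomeomorph {n : ℤ}
    {φ : OpenPartialHomeomorph (Sigma7 n) (EuclideanSpace ℝ (Fin 7))} (hφ : IsQuotientChart n φ)
    (A : EuclideanSpace ℝ (Fin 7) ≃L[ℝ] EuclideanSpace ℝ (Fin 7)) :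
    IsQuotientChart n (φ.transHomeomorph A.toHomeomorph) := by
  constructor
  · intro e he
    obtain ⟨W, F, hW, heW, hF, h⟩ := hφ.1 e he
    exact ⟨W, fun p => A (F p), hW, heW, A.contDiff.comp_contDiffOn hF,
      fun e' he' hs => congrArg A (h e' he' hs)⟩
  · intro y hy
    obtain ⟨W, s, hW, hyW, hs, h⟩ := hφ.2 (A.symm y) hy
    exact ⟨A.symm ⁻¹' W, fun y => s (A.symm y), hW.preimage A.symm.continuous, hyW,
      hs.comp A.symm.contDiff.contDiffOn fun z hz => hz, fun z hz => h _ hz⟩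

/-- All coordinates of a vector in `ℍ²` but one, the two real parts being the last ones. -/
def coordMap : WithLp 2 HH →ₗ[ℝ] EuclideanSpace ℝ (Fin 7) where
  toFun c := !₂[c.fst.imJ, c.fst.imK, c.snd.imI, c.snd.imJ, c.snd.imK, c.fst.re, c.snd.re]
  map_add' a b := by ext i; fin_cases i <;> simp
  map_smul' r a := by ext i; fin_cases i <;> simp

/-- The points `±(i, 0)` of the unit sphere. -/
def pole (ε : ℤˣ) : Sph :=
  ⟨WithLp.toLp 2 (imQuat ![(ε : ℤ), 0, 0], 0), (mem_sph _).2 (by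
    simp only [OnS7, norm_zero, pow_two, ← Quaternion.normSq_eq_norm_mul_self,
      Quaternion.normSq_def']
    rcases Int.units_eq_one_or ε with rfl | rfl <;> simp)⟩

/-- The only coordinate omitted by `coordMap` is the `i`-coordinate of the first component, and
orthogonality to `±(i, 0)` says that it vanishes. -/
theorem eq_zero_of_coordMap_eq_zero {ε : ℤˣ} {c : WithLp 2 HH}
    (hc : c ∈ (ℝ ∙ ((pole ε : Sph) : WithLp 2 HH))ᗮ) (h : coordMap c = 0) : c = 0 := by
  have h0 : ∀ i, coordMap c i = 0 := fun i => by rw [h]; rfl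
  have h1 := h0 0
  have h2 := h0 1
  have h3 := h0 2
  have h4 := h0 3
  have h5 := h0 4
  have h6 := h0 5
  have h7 := h0 6
  rw [Submodule.mem_orthogonal_singleton_iff_inner_right] at hc
  simp [coordMap] at h1 h2 h3 h4 h5 h6 h7
  simp only [pole, WithLp.prod_inner_apply, Quaternion.inner_def] at hc
  have h8 : c.fst.imI = 0 := by
    rcases Int.units_eq_one_or ε with rfl | rfl <;> simpa [Quaternion.inner_def] using hc
  apply WithLp.ofLp_injective
  ext <;> simp [*]

/-- Inverse stereographic projection from `v` is `w ↦ (4 w + (|w|² - 4) v) / (|w|² + 4)`. For `v =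
±(i, 0)`, which has no real parts, the real parts of the image are those of `w` times the positive
factor `h = 4 / (|w|² + 4)`. The rotation `rot` that enters the chart is a conjugation and leaves
real parts alone. -/
theorem exists_adapted_chart {n : ℤ} (x : Sigma7 n) :
    ∃ (ψ : OpenPartialHomeomorph (Sigma7 n) (EuclideanSpace ℝ (Fin 7)))
      (h : EuclideanSpace ℝ (Fin 7) → ℝ), IsQuotientChart n ψ ∧ x ∈ ψ.source ∧ ContDiff ℝ ∞ h ∧
      (∀ y, 0 < h y) ∧ ∀ e : Total n, proj n e ∈ ψ.source →
        (e : HH × HH).1.1.re = h (ψ (proj n e)) * ψ (proj n e) 5 ∧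
        (e : HH × HH).1.2.re = h (ψ (proj n e)) * ψ (proj n e) 6 := by
  obtain ⟨e, rfl⟩ : ∃ e, proj n e = x := Quotient.exists_rep x
  obtain ⟨i, hi⟩ := exists_pr_ne_zero e
  -- The image of the point cannot be both poles, so one of them is available as centre of
  -- projection.
  obtain ⟨ε, hε⟩ : ∃ ε, toSph n i (proj n e) ≠ pole ε := by
    by_contra! h
    have h1 := (h 1).symm.trans (h (-1))
    have h2 := congrArg (fun s : Sph => (s : WithLp 2 HH).fst.imI) h1
    simp [pole] at h2
    norm_num at h2
  set v : Sph := pole ε with hv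
  let R := (OrthonormalBasis.fromOrthogonalSpanSingleton (𝕜 := ℝ) 7
    (ne_zero_of_mem_unit_sphere v)).repr
  let T : EuclideanSpace ℝ (Fin 7) →ₗ[ℝ] EuclideanSpace ℝ (Fin 7) :=
    coordMap ∘ₗ ((ℝ ∙ (v : WithLp 2 HH))ᗮ.subtype ∘ₗ R.symm.toLinearEquiv.toLinearMap)
  have hT : ∀ y, T y = coordMap (R.symm y : WithLp 2 HH) := fun y => rfl
  have hTinj : Function.Injective T := by
    rw [← LinearMap.ker_eq_bot, LinearMap.ker_eq_bot']
    intro y hy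
    have h1 := eq_zero_of_coordMap_eq_zero (R.symm y).2 ((hT y).symm.trans hy)
    have h2 : R.symm y = 0 := Subtype.ext h1
    simpa using h2
  let A := (LinearEquiv.ofInjectiveEndo T hTinj).toContinuousLinearEquiv
  have hA : ∀ y, A y = T y := fun y => rfl
  refine ⟨(sigmaChart n i v).transHomeomorph A.toHomeomorph,
    fun y => (‖A.symm y‖ ^ 2 + 4)⁻¹ * 4, (isQuotientChart_sigmaChart n i v).transHomeomorph A,
    ?_, ?_, fun y => by positivity, ?_⟩
  · change proj n e ∈ (sigmaChart n i v).source
    rw [mem_sigmaChart_source]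
    exact ⟨(proj_mem_dom i e).2 hi, hε⟩
  · exact (((A.symm.contDiff.norm_sq ℝ).add contDiff_const).inv fun y => by positivity).mul
      contDiff_const
  · intro e' he'
    have he2 : proj n e' ∈ dom n i ∧ toSph n i (proj n e') ≠ v :=
      (mem_sigmaChart_source n i v _).1 he'
    have hpr := (proj_mem_dom i e').1 he2.1
    set y := sigmaChart n i v (proj n e') with hy
    have hmem : toSph n i (proj n e') ∈ (stereographic' 7 v).source := by
      rw [stereographic'_source]
      exact he2.2
    have hs : (stereographic' 7 v).symm y = toSph n i (proj n e') :=
      (stereographic' 7 v).left_inv hmem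
    set w : WithLp 2 HH := ((R.symm y : (ℝ ∙ (v : WithLp 2 HH))ᗮ) : WithLp 2 HH) with hw
    have hval : WithLp.toLp 2 (rot i (e' : HH × HH)) = (‖w‖ ^ 2 + 4)⁻¹ • (4 : ℝ) • w +
        (‖w‖ ^ 2 + 4)⁻¹ • (‖w‖ ^ 2 - 4) • (v : WithLp 2 HH) := by
      rw [← toSph_proj i e' hpr, ← hs]
      exact stereographic'_symm_apply v y
    have hψ : (sigmaChart n i v).transHomeomorph A.toHomeomorph (proj n e') = A y := rfl
    rw [hψ]
    have hnorm : ‖w‖ = ‖y‖ := R.symm.norm_map y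
    have hAy : A y = coordMap w := rfl
    beta_reduce
    rw [ContinuousLinearEquiv.symm_apply_apply, hAy, ← hnorm]
    have h1 := congrArg (fun s : WithLp 2 HH => s.fst.re) hval
    have h2 := congrArg (fun s : WithLp 2 HH => s.snd.re) hval
    change (rot i (e' : HH × HH)).1.re = _ at h1
    change (rot i (e' : HH × HH)).2.re = _ at h2
    have h3 : (rot i (e' : HH × HH)).1.re = (e' : HH × HH).1.1.re :=
      re_conj ⟨nq (pr i (e' : HH × HH).2), nq_mem hpr⟩ _
    have h4 : (rot i (e' : HH × HH)).2.re = (e' : HH × HH).1.2.re :=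
      re_conj ⟨nq (pr i (e' : HH × HH).2), nq_mem hpr⟩ _
    rw [← h3, ← h4, h1, h2]
    simp [coordMap, hv, pole]
    constructor <;> ring

/-- As `h` is positive, the real parts vanish exactly where the coordinates 5 and 6 do. The formula
with `h` is kept because the derivative of the reflection is computed from it. -/
theorem exists_slice_chart {n : ℤ} (x : Sigma7 n) :
    ∃ (ψ : OpenPartialHomeomorph (Sigma7 n) (EuclideanSpace ℝ (Fin 7)))
      (h : EuclideanSpace ℝ (Fin 7) → ℝ), IsSliceChart 5 (Sigma5 n) ψ ∧ x ∈ ψ.source ∧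
      ContDiff ℝ ∞ h ∧ (∀ y, 0 < h y) ∧ ∀ e : Total n, proj n e ∈ ψ.source →
        (e : HH × HH).1.1.re = h (ψ (proj n e)) * ψ (proj n e) 5 ∧
        (e : HH × HH).1.2.re = h (ψ (proj n e)) * ψ (proj n e) 6 := by
  obtain ⟨ψ, h, hψ, hx, hh, hpos, hre⟩ := exists_adapted_chart x
  refine ⟨ψ, h, ⟨IsManifold.subset_maximalAtlas hψ, ?_⟩, hx, hh, hpos, hre⟩
  intro w hw
  obtain ⟨e, rfl⟩ : ∃ e, proj n e = w := Quotient.exists_rep w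
  obtain ⟨h1, h2⟩ := hre e hw
  have h0 := (hpos (ψ (proj n e))).ne'
  rw [proj_mem_Sigma5, h1, h2]
  simp only [mul_eq_zero, h0, false_or]
  constructor
  · rintro ⟨h5, h6⟩ i hi
    have : i = 5 ∨ i = 6 := by
      have := i.2
      rcases (by omega : (i : ℕ) = 5 ∨ (i : ℕ) = 6) with h | h
      · exact Or.inl (Fin.ext h)
      · exact Or.inr (Fin.ext h)
    rcases this with rfl | rfl <;> assumption
  · intro H
    exact ⟨H 5 (by decide), H 6 (by decide)⟩

theorem isEmbeddedSubmanifold_Sigma5 (n : ℤ) : IsEmbeddedSubmanifold 7 5 (Sigma5 n) := by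
  refine ⟨by norm_num, fun x _ => ?_⟩
  obtain ⟨ψ, h, hψ, hx, -⟩ := exists_slice_chart x
  exact ⟨ψ, hψ, hx⟩

/-! ### The power map on imaginary vectors -/

/-- An imaginary first component means `t = π/2` in the trigonometric formula. -/
theorem rho_imaginary (n : ℤ) {u : HH} (h1 : u.1.re = 0) :
    rho n u = (((Real.cos (n * (Real.pi / 2)) : ℝ) : ℍ[ℝ]) + Real.sin (n * (Real.pi / 2)) • u.1,
      Real.sin (n * (Real.pi / 2)) • u.2) := by
  have := rho_apply n (Real.pi / 2) u.1 u.2 h1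
  simpa using this

/-- For `n = 2m` the angle `nπ/2 = mπ` has sine 0 and cosine `c = ±1`. -/
theorem rho_imaginary_of_even {n : ℤ} (hn : Even n) : ∃ c : ℝ, c ^ 2 = 1 ∧
    ∀ u : HH, u.1.re = 0 → rho n u = ((c : ℍ[ℝ]), 0) := by
  obtain ⟨m, rfl⟩ := hn
  refine ⟨Real.cos (m * Real.pi), ?_, fun u h1 => ?_⟩
  · rw [Real.cos_sq', Real.sin_int_mul_pi]; norm_num
  · have h : ((m + m : ℤ) : ℝ) * (Real.pi / 2) = m * Real.pi := by push_cast; ring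
    rw [rho_imaginary _ h1, h, Real.sin_int_mul_pi]
    simp

/-- For odd `n` the angle `nπ/2` has cosine 0 and sine `c = ±1`. -/
theorem rho_imaginary_of_odd {n : ℤ} (hn : Odd n) : ∃ c : ℝ, c ^ 2 = 1 ∧
    ∀ u : HH, u.1.re = 0 → rho n u = (c • u.1, c • u.2) := by
  obtain ⟨m, rfl⟩ := hn
  have h : ((2 * m + 1 : ℤ) : ℝ) * (Real.pi / 2) = m * Real.pi + Real.pi / 2 := by push_cast; ring
  have h0 : Real.cos (((2 * m + 1 : ℤ) : ℝ) * (Real.pi / 2)) = 0 := by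
    rw [h, Real.cos_add_pi_div_two, Real.sin_int_mul_pi, neg_zero]
  refine ⟨Real.sin (((2 * m + 1 : ℤ) : ℝ) * (Real.pi / 2)), ?_, fun u h1 => ?_⟩
  · rw [Real.sin_sq, h0]; norm_num
  · rw [rho_imaginary _ h1, h0]
    simp

/-! ### Reflections at points of `Σ⁵` -/

/-- Orthogonal imaginary quaternions anticommute, so a unit imaginary `r` orthogonal to `a` and `b`
negates both by conjugation. -/
theorem exists_anticommuting {a b : ℍ[ℝ]} (ha : a.re = 0) (hb : b.re = 0) :
    ∃ r : unitary ℍ[ℝ], star (r : ℍ[ℝ]) = -r ∧ (r : ℍ[ℝ]) * a * star (r : ℍ[ℝ]) = -a ∧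
      (r : ℍ[ℝ]) * b * star (r : ℍ[ℝ]) = -b := by
  let L : ℍ[ℝ] →ₗ[ℝ] (Fin 3 → ℝ) :=
    { toFun := fun x => ![x.re, x.imI * a.imI + x.imJ * a.imJ + x.imK * a.imK,
        x.imI * b.imI + x.imJ * b.imJ + x.imK * b.imK]
      map_add' := fun x y => by ext i; fin_cases i <;> simp <;> ring
      map_smul' := fun r x => by ext i; fin_cases i <;> simp <;> ring }
  -- Being imaginary and orthogonal to `a` and `b` are three linear conditions on the
  -- four-dimensional space `ℍ`.
  have hker : LinearMap.ker L ≠ ⊥ := LinearMap.ker_ne_bot_of_finrank_lt (by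
    rw [Quaternion.finrank_eq_four]; simp)
  obtain ⟨x, hx, hx0⟩ := Submodule.exists_mem_ne_zero_of_ne_bot hker
  rw [LinearMap.mem_ker] at hx
  have e0 : x.re = 0 := congrFun hx 0
  have e1 : x.imI * a.imI + x.imJ * a.imJ + x.imK * a.imK = 0 := congrFun hx 1
  have e2 : x.imI * b.imI + x.imJ * b.imJ + x.imK * b.imK = 0 := congrFun hx 2
  have hn : ‖x‖ ≠ 0 := norm_ne_zero_iff.2 hx0
  have hs : star x = -x := by ext <;> simp [e0]
  have hxx : x * x = -((‖x‖ ^ 2 : ℝ) : ℍ[ℝ]) := by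
    rw [← star_mul_self_norm, hs, neg_mul, neg_neg]
  have hanti : ∀ c : ℍ[ℝ], c.re = 0 → x.imI * c.imI + x.imJ * c.imJ + x.imK * c.imK = 0 →
      x * c = -(c * x) := by
    intro c hc h
    ext <;> simp [e0, hc] <;> linarith
  let y : ℍ[ℝ] := nq x
  have hy : y = -(‖x‖⁻¹ • x) := by simp only [y, nq, hs, smul_neg]
  refine ⟨⟨y, nq_mem hx0⟩, ?_⟩
  have hconj : ∀ c : ℍ[ℝ], c.re = 0 → x.imI * c.imI + x.imJ * c.imJ + x.imK * c.imK = 0 →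
      y * c * star y = -c := by
    intro c hc h
    rw [hy, star_neg, Quaternion.star_smul, hs, smul_neg, neg_neg, neg_mul, neg_mul,
      smul_mul_assoc, smul_mul_assoc, mul_smul_comm, smul_smul, hanti c hc h, neg_mul, mul_assoc,
      hxx, mul_neg, neg_neg, Quaternion.mul_coe_eq_smul, smul_smul]
    rw [show ‖x‖⁻¹ * ‖x‖⁻¹ * ‖x‖ ^ 2 = 1 by field_simp, one_smul]
  refine ⟨?_, hconj a ha e1, hconj b hb e2⟩
  change star y = -y
  rw [hy, star_neg, Quaternion.star_smul, hs, smul_neg]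

theorem slice_conjAct (i : Bool) (q : unitary ℍ[ℝ]) (w : HH) :
    slice i (conjAct q w) = conjAct q (slice i w) := by
  have hq : star (q : ℍ[ℝ]) * q = 1 := Unitary.coe_star_mul_self q
  have hq' : (q : ℍ[ℝ]) * star (q : ℍ[ℝ]) = 1 := Unitary.coe_mul_star_self q
  have h1 : ∀ a : ℍ[ℝ], star (q : ℍ[ℝ]) * (q * a) = a := fun a => by
    rw [← mul_assoc, hq, one_mul]
  have hc : ∀ r : ℝ, (q : ℍ[ℝ]) * ((r : ℍ[ℝ]) * star (q : ℍ[ℝ])) = r := fun r => by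
    rw [Quaternion.coe_mul_eq_smul, mul_smul_comm, hq', ← Quaternion.coe_mul_eq_smul, mul_one]
  cases i <;>
  · ext1 <;>
    simp only [slice, mk2, pr, conjAct, Bool.not_false, Bool.not_true, cond_true, cond_false,
      norm_mul, norm_unit, norm_star, one_mul, mul_one, star_mul, star_star, mul_assoc, h1, hc,
      mul_neg, neg_mul, smul_mul_assoc, mul_smul_comm]

theorem slice_neg (i : Bool) (w : HH) : slice i (-w) = slice i w := by
  cases i <;> simp [slice, mk2, pr]

/-- On imaginary vectors `rho n` is constant for even `n` and `± id` for odd `n`. -/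
theorem rho_neg_imaginary (n : ℤ) {u : HH} (h1 : u.1.re = 0) :
    rho n (-u) = rho n u ∨ rho n (-u) = -rho n u := by
  have h1' : (-u).1.re = 0 := by simp [h1]
  rcases Int.even_or_odd n with hn | hn
  · obtain ⟨c, -, hc⟩ := rho_imaginary_of_even hn
    exact Or.inl (by rw [hc _ h1, hc _ h1'])
  · obtain ⟨c, -, hc⟩ := rho_imaginary_of_odd hn
    exact Or.inr (by rw [hc _ h1, hc _ h1']; simp)

/-- Every class of `Σ⁷` with `vᵢ ≠ 0` has a representative with `vᵢ > 0`. -/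
theorem exists_normal_form {n : ℤ} {i : Bool} (e : Total n) (h : pr i (e : HH × HH).2 ≠ 0) :
    ∃ e' : Total n, proj n e' = proj n e ∧ pr (!i) (rho n (e' : HH × HH).1) ≠ 0 ∧
      (e' : HH × HH).2 = slice i (rho n (e' : HH × HH).1) := by
  obtain ⟨h1, h2⟩ := starAct_nq i e h
  refine ⟨starAct n ⟨_, nq_mem h⟩ e, proj_starAct _ e, ?_, ?_⟩
  · rw [h2]; exact h1
  · rw [h2]

/-- Conjugation by `r` negates `u` and fixes `v`, so `r` commutes with the components of `v`. With
`r̄ = -r` this gives `-v r̄ = v r = r v`, and therefore `(-u, -v r̄) = (r u r̄, r v)` lies in the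
orbit of `(u, v)`. -/
theorem exists_bullet_fixing {n : ℤ} {p : Sigma7 n} (hp : p ∈ Sigma5 n) :
    ∃ q : unitary ℍ[ℝ], bullet n (-1, -1) q p = p := by
  obtain ⟨e0, rfl⟩ : ∃ e, proj n e = p := Quotient.exists_rep p
  obtain ⟨i, hi⟩ := exists_pr_ne_zero e0
  obtain ⟨e, he, -, hv⟩ := exists_normal_form e0 hi
  rw [← he] at hp ⊢
  obtain ⟨h1, h2⟩ := (proj_mem_Sigma5 e).1 hp
  obtain ⟨r, hr, hr1, hr2⟩ := exists_anticommuting h1 h2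
  refine ⟨r, ?_⟩
  have hconj : conjAct r (e : HH × HH).1 = -(e : HH × HH).1 := Prod.ext hr1 hr2
  -- In normal form `v` is a conjugation-equivariant function of `u` that takes the same value at
  -- `-u`.
  have hcv : conjAct r (e : HH × HH).2 = (e : HH × HH).2 := by
    rw [hv, ← slice_conjAct, ← rho_conjAct, hconj]
    rcases rho_neg_imaginary n h1 with h | h
    · rw [h]
    · rw [h, slice_neg]
  have hq : star (r : ℍ[ℝ]) * r = 1 := Unitary.coe_star_mul_self r
  have hcomm : ∀ a : ℍ[ℝ], (r : ℍ[ℝ]) * a * star (r : ℍ[ℝ]) = a → (r : ℍ[ℝ]) * a = a * r := by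
    intro a ha
    conv_rhs => rw [← ha, mul_assoc, hq, mul_one]
  have hc1 := hcomm _ (congrArg Prod.fst hcv)
  have hc2 := hcomm _ (congrArg Prod.snd hcv)
  rw [bullet_proj]
  refine Eq.trans (congrArg (proj n) ?_) (proj_starAct r e)
  ext1
  refine Prod.ext ?_ ?_
  · change diagAct (-1, -1) (e : HH × HH).1 = conjAct r (e : HH × HH).1
    rw [hconj]
    ext1 <;> simp [diagAct]
  · change rightAct r (diagAct (-1, -1) (e : HH × HH).2) = leftAct r (e : HH × HH).2
    ext1
    · simp only [rightAct, diagAct, leftAct, hr, hc1]; simp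
    · simp only [rightAct, diagAct, leftAct, hr, hc2]; simp

/-- The reflection at a point is the element `(-E, ±q)` that fixes it; it negates both real parts,
hence acts as `-1` on the normal space. -/
theorem isMinimalSubmanifold_Sigma5 (n : ℤ) (g : SmoothMetric 7 (Sigma7 n))
    (hg : ∀ (ε : ℤˣ) (q : unitary ℍ[ℝ]), IsInvariantUnder g (bullet n (ε, ε) q)) :
    IsMinimalSubmanifold 5 g (Sigma5 n) := by
  refine isMinimalSubmanifold_of_reflections g (by norm_num) fun p hp => ?_
  obtain ⟨q, hq⟩ := exists_bullet_fixing hp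
  obtain ⟨ψ, h, hψ, hpψ, hh, hpos, hre⟩ := exists_slice_chart p
  refine ⟨bullet n (-1, -1) q, ψ, contMDiff_bullet n _ q, hg (-1) q, hq,
    mapsTo_bullet_Sigma5 n _ q, hψ, hpψ, fun c => ?_⟩
  set τ := bullet n (-1, -1) q
  set T : EuclideanSpace ℝ (Fin 7) → EuclideanSpace ℝ (Fin 7) := fun y => ψ (τ (ψ.symm y))
  set y := ψ p with hy
  have hyp : ψ.symm y = p := ψ.left_inv hpψ
  have hyt : y ∈ ψ.target := ψ.map_source hpψ
  have hTy : T y = y := by simp only [T, hyp, hq]; rfl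
  have hs : ContMDiffAt (𝓡 7) (𝓡 7) ∞ ψ.symm y :=
    (contMDiffOn_symm_of_mem_maximalAtlas hψ.1).contMDiffAt (ψ.open_target.mem_nhds hyt)
  have hτs : ContMDiffAt (𝓡 7) (𝓡 7) ∞ (fun z => τ (ψ.symm z)) y :=
    (contMDiff_bullet n _ q).contMDiffAt.comp y hs
  have hT : DifferentiableAt ℝ T y := by
    have : ContDiffAt ℝ ∞ T y := by
      rw [← contMDiffAt_iff_contDiffAt]
      refine ContMDiffAt.comp (I' := 𝓡 7) y (g := ψ) (f := fun z => τ (ψ.symm z)) ?_ hτs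
      simp only [hyp, hq]
      exact (contMDiffOn_of_mem_maximalAtlas hψ.1).contMDiffAt (ψ.open_source.mem_nhds hpψ)
    exact this.differentiableAt (by simp)
  have hyV := (hψ.2 p hpψ).1 hp
  have hnear : ∀ᶠ z in 𝓝 y, z ∈ ψ.target ∧ τ (ψ.symm z) ∈ ψ.source := by
    refine (Filter.eventually_of_mem (ψ.open_target.mem_nhds hyt) fun _ h => h).and ?_
    refine hτs.continuousAt.eventually (ψ.open_source.mem_nhds ?_)
    simp only [hyp, hq]; exact hpψ
  -- This is the sign change of `Re u₁` and `Re u₂` under `τ`, written in the chart.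
  have hrel : ∀ l : Fin 7, 5 ≤ (l : ℕ) → (fun z => h (T z) * T z l) =ᶠ[𝓝 y] fun z => -(h z * z l) := by
    intro l hl
    filter_upwards [hnear] with z hz
    obtain ⟨e, he⟩ : ∃ e, proj n e = ψ.symm z := Quotient.exists_rep _
    have h1 := hre e (by rw [he]; exact ψ.map_target hz.1)
    have h2 := hre (bulletTotal n (-1, -1) q e) (by rw [← bullet_proj, he]; exact hz.2)
    rw [← bullet_proj, he] at h2
    rw [he, ψ.right_inv hz.1] at h1
    have h3 : ((bulletTotal n (-1, -1) q e : Total n) : HH × HH).1.1.re = -(e : HH × HH).1.1.re := by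
      simp [bulletTotal, diagAct]
    have h4 : ((bulletTotal n (-1, -1) q e : Total n) : HH × HH).1.2.re = -(e : HH × HH).1.2.re := by
      simp [bulletTotal, diagAct]
    rw [h3, h4, h1.1, h1.2] at h2
    have : l = 5 ∨ l = 6 := by
      have := l.2
      rcases (by omega : (l : ℕ) = 5 ∨ (l : ℕ) = 6) with h | h
      · exact Or.inl (Fin.ext h)
      · exact Or.inr (Fin.ext h)
    rcases this with rfl | rfl
    · exact h2.1.symm
    · exact h2.2.symm
  intro l hl
  have hyl : y l = 0 := hyV l hl
  let P : EuclideanSpace ℝ (Fin 7) →L[ℝ] ℝ := EuclideanSpace.proj l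
  have hd : HasFDerivAt h (fderiv ℝ h y) y := (hh.differentiable (by simp) y).hasFDerivAt
  have hdT : HasFDerivAt (fun z => h (T z)) ((fderiv ℝ h y).comp (fderiv ℝ T y)) y :=
    HasFDerivAt.comp (g := h) (f := T) y (by rw [hTy]; exact hd) hT.hasFDerivAt
  have hPT : HasFDerivAt (fun z => T z l) (P.comp (fderiv ℝ T y)) y :=
    P.hasFDerivAt.comp y hT.hasFDerivAt
  have hP : HasFDerivAt (fun z : EuclideanSpace ℝ (Fin 7) => z l) P y := P.hasFDerivAt
  have h1 := hdT.mul hPT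
  have h2 := (hd.mul hP).neg.congr_of_eventuallyEq (hrel l hl)
  have h3 := congrArg (fun L : EuclideanSpace ℝ (Fin 7) →L[ℝ] ℝ => L c) (h1.unique h2)
  have hPv : ∀ v, P v = v l := fun v => rfl
  -- Because `y l = 0`, the product rule leaves no derivative of `h`, and the positive factor `h y`
  -- can be cancelled.
  simp [hTy, hyl] at h3
  have h4 : h y * ((fderiv ℝ T y c) l + c l) = 0 := by
    rw [hPv, hPv] at h3
    linarith
  exact (mul_eq_zero.1 h4).resolve_left (hpos y).ne'

/-! ### Diffeomorphisms from local sections -/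

section LocalSections

variable {E : Type*} [NormedAddCommGroup E] [NormedSpace ℝ E] {H : Type*} [TopologicalSpace H]
  {I : ModelWithCorners ℝ E H} {M : Type*} [TopologicalSpace M] [ChartedSpace H M]
  {E' : Type*} [NormedAddCommGroup E'] [NormedSpace ℝ E'] {H' : Type*} [TopologicalSpace H']
  {I' : ModelWithCorners ℝ E' H'} {M' : Type*} [TopologicalSpace M'] [ChartedSpace H' M']

/-- Local sections give surjectivity and, since `P` is injective on `A`, they coincide on `B` with
the inverse, which is thus smooth. Invariance of `B` is inherited from `A` through equivariance. -/
theorem equivariantlyDiffeomorphic_of_local_sections {G : Type*} {α : G → M → M} {A : Set M}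
    {β : G → M' → M'} {B : Set M'} (P : M → M') (hA : ∀ g, Set.MapsTo (α g) A A)
    (hPAB : Set.MapsTo P A B) (hinj : Set.InjOn P A)
    (hP : ∀ a ∈ A, ∀ᶠ x in 𝓝 a, ContMDiffAt I I' ∞ P x)
    (hsec : ∀ b ∈ B, ∃ F : M' → M, (∀ᶠ y in 𝓝 b, ContMDiffAt I' I ∞ F y) ∧
      ∀ᶠ y in 𝓝 b, y ∈ B → F y ∈ A ∧ P (F y) = y)
    (hequiv : ∀ g, ∀ a ∈ A, P (α g a) = β g (P a)) :
    EquivariantlyDiffeomorphic I I' α A β B := by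
  have hsurj : ∀ b ∈ B, ∃ a ∈ A, P a = b := fun b hb => by
    obtain ⟨F, -, hF⟩ := hsec b hb
    exact ⟨F b, hF.self_of_nhds hb⟩
  have hB : ∀ g, Set.MapsTo (β g) B B := by
    intro g b hb
    obtain ⟨a, ha, rfl⟩ := hsurj b hb
    rw [← hequiv g a ha]
    exact hPAB (hA g ha)
  let f0 : A → B := fun a => ⟨P a, hPAB a.2⟩
  have hf0 : Function.Bijective f0 := by
    constructor
    · intro a b hab
      exact Subtype.ext (hinj a.2 b.2 (congrArg Subtype.val hab))
    · rintro ⟨b, hb⟩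
      obtain ⟨a, ha, rfl⟩ := hsurj b hb
      exact ⟨⟨a, ha⟩, rfl⟩
  refine ⟨hA, hB, Equiv.ofBijective f0 hf0, ?_, ?_, ?_⟩
  · intro a
    obtain ⟨W, hW, hWo, haW⟩ := eventually_nhds_iff.1 (hP a a.2)
    exact ⟨W, P, hWo, haW, fun x hx => (hW x hx).contMDiffWithinAt, fun b _ => rfl⟩
  · intro b
    obtain ⟨F, hF, hFB⟩ := hsec b b.2
    obtain ⟨W, hW, hWo, hbW⟩ := eventually_nhds_iff.1 (hF.and hFB)
    refine ⟨W, F, hWo, hbW, fun x hx => (hW x hx).1.contMDiffWithinAt, fun c hc => ?_⟩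
    obtain ⟨h1, h2⟩ := (hW c hc).2 c.2
    have h3 : (Equiv.ofBijective f0 hf0).symm c = ⟨F c, h1⟩ := by
      rw [Equiv.symm_apply_eq]
      exact Subtype.ext h2.symm
    rw [h3]
  · intro g a
    exact Subtype.ext (hequiv g a a.2)

end LocalSections

/-! ### Smooth sections of the projection -/

/-- The radial projection to the unit sphere. -/
def normalize (u : HH) : HH := (Real.sqrt (‖u.1‖ ^ 2 + ‖u.2‖ ^ 2))⁻¹ • u

theorem normalize_of_onS7 {u : HH} (hu : OnS7 u) : normalize u = u := by
  rw [normalize, hu, Real.sqrt_one, inv_one, one_smul]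

theorem norm_sq_add_norm_sq_pos {u : HH} (hu : u ≠ 0) : 0 < ‖u.1‖ ^ 2 + ‖u.2‖ ^ 2 := by
  by_contra h
  have h1 : ‖u.1‖ = 0 := by nlinarith [sq_nonneg ‖u.1‖, sq_nonneg ‖u.2‖]
  have h2 : ‖u.2‖ = 0 := by nlinarith [sq_nonneg ‖u.1‖, sq_nonneg ‖u.2‖]
  exact hu (Prod.ext (norm_eq_zero.1 h1) (norm_eq_zero.1 h2))

theorem onS7_normalize {u : HH} (hu : u ≠ 0) : OnS7 (normalize u) := by
  have h := norm_sq_add_norm_sq_pos hu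
  simp only [OnS7, normalize, Prod.smul_fst, Prod.smul_snd, norm_smul, mul_pow, ← mul_add,
    norm_inv, Real.norm_eq_abs, inv_pow, sq_abs, Real.sq_sqrt h.le]
  exact inv_mul_cancel₀ h.ne'

theorem contDiffAt_normalize {u : HH} (hu : u ≠ 0) : ContDiffAt ℝ ∞ normalize u := by
  have h := norm_sq_add_norm_sq_pos hu
  have h1 : ContDiffAt ℝ ∞ (fun u : HH => ‖u.1‖ ^ 2 + ‖u.2‖ ^ 2) u :=
    ((contDiff_fst.norm_sq ℝ).add (contDiff_snd.norm_sq ℝ)).contDiffAt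
  exact ((h1.sqrt h.ne').inv (Real.sqrt_pos.2 h).ne').smul contDiffAt_id

open Classical in
/-- The class of `(u, v)` with `vᵢ > 0`, for the point `u` of the sphere on a given ray. -/
def sect (n : ℤ) (i : Bool) (u : HH) : Sigma7 n :=
  if h : (normalize u, slice i (rho n (normalize u))) ∈ totalSet n then proj n ⟨_, h⟩
  else proj n ⟨_, base_mem n⟩

theorem sect_eq {n : ℤ} {i : Bool} {u : HH} (hu : OnS7 u) (h : pr (!i) (rho n u) ≠ 0) :
    sect n i u = proj n ⟨(u, slice i (rho n u)), slice_mem i hu h⟩ := by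
  have h1 : (normalize u, slice i (rho n (normalize u))) ∈ totalSet n := by
    rw [normalize_of_onS7 hu]; exact slice_mem i hu h
  rw [sect, dif_pos h1]
  congr 1
  ext1
  simp only [normalize_of_onS7 hu]

/-- Smoothness on subsets requires an extension to an open set of `ℍ²`; the radial projection built
into `sect` provides it. -/
theorem eventually_contMDiffAt_sect {n : ℤ} {i : Bool} {u : HH} (hu : OnS7 u)
    (h : pr (!i) (rho n u) ≠ 0) : ∀ᶠ w in 𝓝 u, ContMDiffAt 𝓘(ℝ, HH) (𝓡 7) ∞ (sect n i) w := by
  have hu0 : u ≠ 0 := by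
    rintro rfl
    simp [OnS7] at hu
  have hc : ContinuousAt (fun w => pr (!i) (rho n (normalize w))) u :=
    ((contDiff_pr _).continuous.comp (contDiff_rho n).continuous).continuousAt.comp
      (contDiffAt_normalize hu0).continuousAt
  have hne : ∀ᶠ w in 𝓝 u, w ≠ 0 ∧ pr (!i) (rho n (normalize w)) ≠ 0 :=
    (isOpen_ne.mem_nhds hu0 |> fun h => Filter.eventually_of_mem h fun _ h => h).and
      (hc.eventually_ne (by rwa [normalize_of_onS7 hu]))
  filter_upwards [hne.eventually_nhds] with w hw
  have hw0 := hw.self_of_nhds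
  have hs : ContDiffAt ℝ ∞ (fun w => (normalize w, slice i (rho n (normalize w)))) w :=
    (contDiffAt_normalize hw0.1).prodMk (ContDiffAt.comp (g := slice i)
      (f := fun w => rho n (normalize w)) w (contDiffAt_slice i _ hw0.2)
      ((contDiff_rho n).contDiffAt.comp w (contDiffAt_normalize hw0.1)))
  refine contMDiffAt_of_lift hs ?_
  filter_upwards [hw] with z hz
  exact ⟨slice_mem i (onS7_normalize hz.1) hz.2, dif_pos _⟩

/-! ### The case of even `n` -/

/-- The map `(u, v) ↦ v̄₂ u v₂`. -/
def conjBySnd (p : HH × HH) : HH :=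
  (star p.2.2 * p.1.1 * p.2.2, star p.2.2 * p.1.2 * p.2.2)

theorem contDiff_conjBySnd : ContDiff ℝ ∞ conjBySnd := by
  have h1 : ContDiff ℝ ∞ (fun p : HH × HH => p.2.2) := contDiff_snd.comp contDiff_snd
  have h2 : ContDiff ℝ ∞ (fun p : HH × HH => star p.2.2) := contDiff_starH.comp h1
  exact ((h2.mul (contDiff_fst.comp contDiff_fst)).mul h1).prodMk
    ((h2.mul (contDiff_snd.comp contDiff_fst)).mul h1)

/-- This makes the expressions `v̄ᵢ u v_k` invariant under the `⋆`-action, hence functions on `Σ⁷`.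
-/
theorem star_leftAct_cancel (q : unitary ℍ[ℝ]) (a b c : ℍ[ℝ]) :
    star ((q : ℍ[ℝ]) * a) * ((q : ℍ[ℝ]) * b * star (q : ℍ[ℝ])) * ((q : ℍ[ℝ]) * c) =
      star a * b * c := by
  have hq : star (q : ℍ[ℝ]) * q = 1 := Unitary.coe_star_mul_self q
  have h1 : ∀ a : ℍ[ℝ], star (q : ℍ[ℝ]) * (q * a) = a := fun a => by
    rw [← mul_assoc, hq, one_mul]
  simp only [star_mul, mul_assoc, h1]

/-- The map `[(u, v)] ↦ v̄₂ u v₂`. -/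
def evenMap (n : ℤ) : Sigma7 n → HH :=
  Quotient.lift (s := starSetoid n) (fun e : Total n => conjBySnd e) (by
    rintro e _ ⟨q, rfl⟩
    ext1 <;> simp only [conjBySnd, starAct, conjAct, leftAct, star_leftAct_cancel])

theorem evenMap_proj {n : ℤ} (e : Total n) : evenMap n (proj n e) = conjBySnd e := rfl

/-- Since `rho n u = (±1, 0)`, orthogonality forces `v₁ = 0` and `|v₂| = 1`. Acting by `q = v̄₂`
then moves `(u, v)` to `(v̄₂ u v₂, (0, 1))`, so the value of `evenMap` determines the class. -/
theorem exists_evenMap_normal_form {n : ℤ} (hn : Even n) {x : Sigma7 n} (hx : x ∈ Sigma5 n) :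
    evenMap n x ∈ linearS5 ∧ ∃ h : (evenMap n x, ((0, 1) : HH)) ∈ totalSet n,
      x = proj n ⟨_, h⟩ := by
  obtain ⟨c, hc, hrho⟩ := rho_imaginary_of_even hn
  obtain ⟨e, rfl⟩ : ∃ e, proj n e = x := Quotient.exists_rep x
  obtain ⟨h1, h2⟩ := (proj_mem_Sigma5 e).1 hx
  have hc0 : c ≠ 0 := by rintro rfl; norm_num at hc
  have hherm := e.2.2.2
  rw [hrho _ h1] at hherm
  have hv1 : (e : HH × HH).2.1 = 0 := by
    simp only [herm, star_zero, zero_mul, add_zero, Quaternion.star_coe,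
      Quaternion.coe_mul_eq_smul, smul_eq_zero, hc0, false_or] at hherm
    exact hherm
  have hv2 : ‖(e : HH × HH).2.2‖ = 1 := by
    have h := e.2.2.1
    rw [OnS7, hv1, norm_zero] at h
    nlinarith [norm_nonneg (e : HH × HH).2.2]
  have hv20 : (e : HH × HH).2.2 ≠ 0 := by rw [← norm_ne_zero_iff, hv2]; exact one_ne_zero
  have hnq : nq (e : HH × HH).2.2 = star (e : HH × HH).2.2 := by
    rw [nq, hv2, inv_one, one_smul]
  let q : unitary ℍ[ℝ] := ⟨star (e : HH × HH).2.2, hnq ▸ nq_mem hv20⟩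
  have hq : (q : ℍ[ℝ]) = star (e : HH × HH).2.2 := rfl
  have hval : (starAct n q e : HH × HH) = (evenMap n (proj n e), ((0, 1) : HH)) := by
    refine Prod.ext ?_ ?_
    · rw [evenMap_proj]
      simp only [starAct, conjAct, conjBySnd, hq, star_star]
    · refine Prod.ext ?_ ?_
      · simp only [starAct, leftAct, hv1, mul_zero]
      · simp only [starAct, leftAct, hq]
        rw [star_mul_self_norm, hv2]
        norm_num
  have hmem := (starAct n q e).2
  have hp : proj n e = proj n (starAct n q e) := (proj_starAct q e).symm
  have hp5 : proj n (starAct n q e) ∈ Sigma5 n := hp ▸ hx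
  rw [proj_mem_Sigma5] at hp5
  refine ⟨⟨?_, ?_, ?_⟩, hval ▸ hmem, ?_⟩
  · have := hmem.1
    rwa [hval] at this
  · have := hp5.1
    rwa [hval] at this
  · have := hp5.2
    rwa [hval] at this
  · exact hp.trans (congrArg (proj n) (Subtype.ext hval))

theorem slice_false_coe {c : ℝ} (hc : c ^ 2 = 1) : slice false ((c : ℍ[ℝ]), 0) = (0, 1) := by
  have h1 : |c| = 1 := by rw [← sq_eq_sq₀ (abs_nonneg _) zero_le_one, sq_abs, hc, one_pow]
  simp [slice, mk2, pr, h1]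

theorem equivariantlyDiffeomorphic_of_even {n : ℤ} (hn : Even n) :
    EquivariantlyDiffeomorphic (𝓡 7) 𝓘(ℝ, HH)
      (fun g : (ℤˣ × ℤˣ) × unitary ℍ[ℝ] => bullet n g.1 g.2) (Sigma5 n)
      (fun g => linearAct g.1 g.2) linearS5 := by
  obtain ⟨c, hc, hrho⟩ := rho_imaginary_of_even hn
  have hc0 : c ≠ 0 := by rintro rfl; norm_num at hc
  refine equivariantlyDiffeomorphic_of_local_sections (evenMap n)
    (fun g => mapsTo_bullet_Sigma5 n g.1 g.2) (fun x hx => (exists_evenMap_normal_form hn hx).1)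
    ?_ ?_ ?_ ?_
  · intro x hx y hy hxy
    obtain ⟨-, h1, h1'⟩ := exists_evenMap_normal_form hn hx
    obtain ⟨-, h2, h2'⟩ := exists_evenMap_normal_form hn hy
    rw [h1', h2']
    congr 2
    rw [hxy]
  · exact fun a _ => Filter.Eventually.of_forall fun x =>
      contMDiffAt_of_comp_proj (G := conjBySnd) evenMap_proj
        fun e _ => contDiff_conjBySnd.contDiffAt
  · rintro u ⟨hu, h1, h2⟩
    have hpr : ∀ w : HH, w.1.re = 0 → pr (!false) (rho n w) ≠ 0 := by
      intro w hw
      rw [hrho w hw]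
      exact fun h => hc0 (Quaternion.coe_injective (h.trans Quaternion.coe_zero.symm))
    -- On imaginary unit vectors this section is `u ↦ [(u, (0, 1))]`, because the slice of `(±1, 0)`
    -- is `(0, 1)`.
    refine ⟨sect n false, eventually_contMDiffAt_sect hu (hpr u h1),
      Filter.Eventually.of_forall ?_⟩
    rintro w ⟨hw, hw1, hw2⟩
    rw [sect_eq hw (hpr w hw1), proj_mem_Sigma5, evenMap_proj]
    refine ⟨⟨hw1, hw2⟩, ?_⟩
    simp only [hrho w hw1, slice_false_coe hc, conjBySnd]
    simp
  · rintro ⟨⟨ε, δ⟩, q⟩ x -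
    obtain ⟨e, rfl⟩ : ∃ e, proj n e = x := Quotient.exists_rep x
    change evenMap n (bullet n (ε, δ) q (proj n e)) = linearAct (ε, δ) q (evenMap n (proj n e))
    rw [bullet_proj, evenMap_proj, evenMap_proj]
    rcases Int.units_eq_one_or ε with rfl | rfl <;> rcases Int.units_eq_one_or δ with rfl | rfl <;>
    simp [conjBySnd, bulletTotal, linearAct, diagAct, conjAct, rightAct, mul_assoc]

/-! ### A weighted radial projection -/

/-- The sign of `q` is arbitrary, so `c ↦ p c⁶ + q c⁴` need not be increasing everywhere. Where it
equals 1 the factor `p c² + q` is positive, and from there on both `c⁴` and `p c² + q` increase. -/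
theorem weight_strictMono {p q a b : ℝ} (hp : 0 < p) (ha : 0 < a) (hab : a < b)
    (h : p * a ^ 6 + q * a ^ 4 = 1) : 1 < p * b ^ 6 + q * b ^ 4 := by
  have h1 : 0 < p * a ^ 2 + q := by
    by_contra hneg
    nlinarith [pow_pos ha 4]
  have h2 : a ^ 2 < b ^ 2 := by nlinarith
  have h3 : a ^ 4 < b ^ 4 := by nlinarith [pow_pos ha 2]
  have h4 : p * a ^ 2 + q < p * b ^ 2 + q := by nlinarith
  calc (1 : ℝ) = a ^ 4 * (p * a ^ 2 + q) := by linarith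
    _ < b ^ 4 * (p * b ^ 2 + q) := mul_lt_mul h3 h4.le h1 (by positivity)
    _ = _ := by ring

theorem weight_unique {p q a b : ℝ} (hp : 0 < p) (ha : 0 < a) (hb : 0 < b)
    (h : p * a ^ 6 + q * a ^ 4 = 1) (h' : p * b ^ 6 + q * b ^ 4 = 1) : a = b := by
  rcases lt_trichotomy a b with hab | hab | hab
  · exact absurd h' (weight_strictMono hp ha hab h).ne'
  · exact hab
  · exact absurd h (weight_strictMono hp hb hab h').ne'

theorem exists_weight {p : ℝ} (hp : 0 < p) (q : ℝ) : ∃ c, 0 < c ∧ p * c ^ 6 + q * c ^ 4 = 1 := by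
  -- `K` is chosen so that `p K² + q ≥ p K + q ≥ 1` and `K ≥ 1`; the intermediate value theorem on
  -- `[0, K]` gives the root.
  let K := 1 + (1 + |q|) / p
  have hK1 : 1 ≤ K := by
    have : 0 ≤ (1 + |q|) / p := by positivity
    linarith
  have hpK : p * K = p + (1 + |q|) := by simp only [K]; field_simp
  have hK : 1 ≤ p * K ^ 6 + q * K ^ 4 := by
    have h1 : 1 ≤ p * K ^ 2 + q := by
      have : p * K ≤ p * K ^ 2 :=
        mul_le_mul_of_nonneg_left (le_self_pow₀ hK1 two_ne_zero) hp.le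
      linarith [neg_abs_le q]
    have h2 : 1 ≤ K ^ 4 := one_le_pow₀ hK1
    nlinarith
  have hcont : ContinuousOn (fun c : ℝ => p * c ^ 6 + q * c ^ 4) (Set.Icc 0 K) := by fun_prop
  obtain ⟨c, hc, hc1⟩ := intermediate_value_Icc (by linarith) hcont
    (show (1 : ℝ) ∈ Set.Icc _ _ from ⟨by norm_num, hK⟩)
  refine ⟨c, lt_of_le_of_ne hc.1 ?_, hc1⟩
  rintro rfl
  norm_num at hc1

open Classical in
/-- The positive solution `c` of `p c⁶ + q c⁴ = 1`, for `p > 0`. -/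
def weight (p q : ℝ) : ℝ := if hp : 0 < p then (exists_weight hp q).choose else 1

theorem weight_pos {p : ℝ} (hp : 0 < p) (q : ℝ) : 0 < weight p q := by
  rw [weight, dif_pos hp]; exact (exists_weight hp q).choose_spec.1

theorem weight_spec {p : ℝ} (hp : 0 < p) (q : ℝ) :
    p * weight p q ^ 6 + q * weight p q ^ 4 = 1 := by
  rw [weight, dif_pos hp]; exact (exists_weight hp q).choose_spec.2

theorem weight_eq {p q c : ℝ} (hp : 0 < p) (hc : 0 < c) (h : p * c ^ 6 + q * c ^ 4 = 1) :
    weight p q = c :=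
  weight_unique hp (weight_pos hp q) hc (weight_spec hp q) h

/-- The implicit function theorem gives a smooth root near `c`; it stays positive, so by uniqueness
it is `weight`. -/
theorem contDiffAt_weight {p : ℝ} (hp : 0 < p) (q : ℝ) :
    ContDiffAt ℝ ∞ (fun x : ℝ × ℝ => weight x.1 x.2) (p, q) := by
  set c := weight p q with hc
  have hc0 : 0 < c := weight_pos hp q
  have hcs := weight_spec hp q
  rw [← hc] at hcs
  let f : (ℝ × ℝ) × ℝ → ℝ := fun x => x.1.1 * x.2 ^ 6 + x.1.2 * x.2 ^ 4
  have hf : ContDiff ℝ ∞ f := by fun_prop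
  have hfa : ContDiffAt ℝ ∞ f ((p, q), c) := hf.contDiffAt
  have hder : fderiv ℝ f ((p, q), c) ((0, 0), 1) = 6 * p * c ^ 5 + 4 * q * c ^ 3 := by
    have h1 : HasDerivAt (fun t : ℝ => p * t ^ 6 + q * t ^ 4) (6 * p * c ^ 5 + 4 * q * c ^ 3) c := by
      have := ((hasDerivAt_pow 6 c).const_mul p).add ((hasDerivAt_pow 4 c).const_mul q)
      refine this.congr_deriv ?_
      norm_num
      ring
    have h2 : HasDerivAt (fun t : ℝ => ((p, q), t)) (((0, 0), 1) : (ℝ × ℝ) × ℝ) c :=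
      (hasDerivAt_const c (p, q)).prodMk (hasDerivAt_id c)
    have h3 : HasFDerivAt f (fderiv ℝ f ((p, q), c)) ((p, q), c) :=
      (hf.differentiable (by simp) _).hasFDerivAt
    exact (h3.comp_hasDerivAt c h2).unique h1
  -- At a root, `c` times the derivative is `6 p c⁶ + 4 q c⁴ = 4 + 2 p c⁶`.
  have hpos : 0 < 6 * p * c ^ 5 + 4 * q * c ^ 3 := by
    have : c * (6 * p * c ^ 5 + 4 * q * c ^ 3) = 4 + 2 * p * c ^ 6 := by linear_combination 4 * hcs
    have h2 : 0 < c * (6 * p * c ^ 5 + 4 * q * c ^ 3) := by rw [this]; positivity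
    exact (pos_iff_pos_of_mul_pos h2).1 hc0
  have hinv : (fderiv ℝ f ((p, q), c) ∘L .inr ℝ (ℝ × ℝ) ℝ).IsInvertible := by
    refine ⟨ContinuousLinearEquiv.unitsEquivAut ℝ (Units.mk0 _ hpos.ne'), ?_⟩
    ext
    simp only [ContinuousLinearEquiv.coe_coe, ContinuousLinearEquiv.unitsEquivAut_apply,
      Units.val_mk0, one_mul, ContinuousLinearMap.comp_apply, ContinuousLinearMap.inr_apply]
    exact hder.symm
  have hsm := hfa.contDiffAt_implicitFunction (by simp) hinv
  refine hsm.congr_of_eventuallyEq ?_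
  have h1 := hfa.eventually_apply_implicitFunction (by simp) hinv
  have h2 := hsm.continuousAt.eventually (isOpen_Ioi.mem_nhds
    (show hfa.implicitFunction (by simp) hinv (p, q) ∈ Set.Ioi 0 by
      rw [hfa.implicitFunction_apply_self (by simp) hinv]; exact hc0))
  have h3 : ∀ᶠ x : ℝ × ℝ in 𝓝 (p, q), 0 < x.1 :=
    continuous_fst.continuousAt.eventually (isOpen_Ioi.mem_nhds hp)
  filter_upwards [h1, h2, h3] with x hx1 hx2 hx3
  refine weight_eq hx3 hx2 ?_
  have : f ((p, q), c) = 1 := hcs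
  rw [this] at hx1
  exact hx1

/-! ### Weighted dilations between the two sections of the hypersurface -/

/-- The weighted dilation `(z₀, z) ↦ (c² z₀, c³ z)`. -/
def dilate (c : ℝ) (z : C4) : C4 := (c ^ 2 • z.1, c ^ 3 • z.2)

theorem dilate_dilate (c d : ℝ) (z : C4) : dilate c (dilate d z) = dilate (c * d) z := by
  simp only [dilate, smul_smul, mul_pow]

theorem dilate_one (z : C4) : dilate 1 z = z := by simp [dilate]

/-- The section `z₀³ + z₁² + z₂² + z₃² = 0`, `3 |z₀|² + |z₁|² + |z₂|² + |z₃|² = 4` of the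
hypersurface. -/
def modelX : Set C4 :=
  {z | z.1 ^ 3 + ∑ i, z.2 i ^ 2 = 0 ∧ 3 * ‖z.1‖ ^ 2 + ∑ i, ‖z.2 i‖ ^ 2 = 4}

theorem eq_zero_of_sum_norm_sq {w : Fin 3 → ℂ} (h : ∑ i, ‖w i‖ ^ 2 = 0) : ∀ i, w i = 0 := by
  intro i
  have := (Finset.sum_eq_zero_iff_of_nonneg fun i _ => sq_nonneg ‖w i‖).1 h i (Finset.mem_univ i)
  simpa using this

/-- The quantity equals `|z|²`. If that vanished, the cubic equation would give `z₀ = 0`, against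
the norm condition. -/
theorem norm_fst_sq_lt_of_mem_modelX {z : C4} (hz : z ∈ modelX) : 0 < 4 - 3 * ‖z.1‖ ^ 2 := by
  have h0 : 0 ≤ ∑ i, ‖z.2 i‖ ^ 2 := Finset.sum_nonneg fun i _ => sq_nonneg _
  rcases h0.lt_or_eq with h | h
  · linarith [hz.2]
  · have h1 := eq_zero_of_sum_norm_sq h.symm
    have h2 := hz.1
    simp [h1] at h2
    have h3 := hz.2
    simp [h1, h2] at h3

theorem norm_fst_sq_lt_of_mem_brieskornW {z : C4} (hz : z ∈ brieskornW 3) :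
    0 < (1 - ‖z.1‖ ^ 2) / 4 := by
  have h0 : 0 ≤ ∑ i, ‖z.2 i‖ ^ 2 := Finset.sum_nonneg fun i _ => sq_nonneg _
  rcases h0.lt_or_eq with h | h
  · linarith [hz.2]
  · have h1 := eq_zero_of_sum_norm_sq h.symm
    have h2 := hz.1
    simp [h1] at h2
    have h3 := hz.2
    simp [h1, h2] at h3

/-- The weighted projection from `modelX` to the Brieskorn manifold. -/
def toSphere (z : C4) : C4 := dilate (weight (4 - 3 * ‖z.1‖ ^ 2) (‖z.1‖ ^ 2)) z

/-- The weighted projection from the Brieskorn manifold to `modelX`. -/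
def ofSphere (z : C4) : C4 := dilate (weight ((1 - ‖z.1‖ ^ 2) / 4) (3 * ‖z.1‖ ^ 2 / 4)) z

theorem norm_dilate_fst_sq (c : ℝ) (z : C4) : ‖(dilate c z).1‖ ^ 2 = c ^ 4 * ‖z.1‖ ^ 2 := by
  simp only [dilate, norm_smul, mul_pow, Real.norm_eq_abs, sq_abs, abs_pow]; ring

theorem sum_norm_dilate_snd_sq (c : ℝ) (z : C4) :
    ∑ i, ‖(dilate c z).2 i‖ ^ 2 = c ^ 6 * ∑ i, ‖z.2 i‖ ^ 2 := by
  rw [Finset.mul_sum]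
  refine Finset.sum_congr rfl fun i _ => ?_
  simp only [dilate, Pi.smul_apply, norm_smul, mul_pow, norm_pow, Real.norm_eq_abs]
  rw [← pow_mul, show (3 * 2 : ℕ) = 2 * 3 by norm_num, pow_mul, sq_abs]
  ring

/-- With the weights 2 and 3 the polynomial is homogeneous of degree 6. -/
theorem hypersurface_dilate (c : ℝ) (z : C4) :
    (dilate c z).1 ^ 3 + ∑ i, (dilate c z).2 i ^ 2 = c ^ 6 • (z.1 ^ 3 + ∑ i, z.2 i ^ 2) := by
  rw [smul_add, Finset.smul_sum]
  simp only [dilate, smul_pow, Pi.smul_apply]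
  congr 1
  · congr 1; ring
  · refine Finset.sum_congr rfl fun i _ => ?_
    congr 1; ring

/-- On `modelX` one has `|z|² = 4 - 3 |z₀|²`, so a dilation by `c` has norm one exactly when `(4 - 3
|z₀|²) c⁶ + |z₀|² c⁴ = 1`, the equation defining the weight. -/
theorem toSphere_mem {z : C4} (hz : z ∈ modelX) : toSphere z ∈ brieskornW 3 := by
  have hp := norm_fst_sq_lt_of_mem_modelX hz
  have hc := weight_spec hp (‖z.1‖ ^ 2)
  refine ⟨?_, ?_⟩
  · rw [toSphere, hypersurface_dilate, hz.1, smul_zero]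
  · rw [toSphere, norm_dilate_fst_sq, sum_norm_dilate_snd_sq]
    have : ∑ i, ‖z.2 i‖ ^ 2 = 4 - 3 * ‖z.1‖ ^ 2 := by linarith [hz.2]
    rw [this]
    linarith

/-- On the sphere `|z|² = 1 - |z₀|²`; the norm condition of `modelX`, divided by 4, is the equation
of the weight. -/
theorem ofSphere_mem {z : C4} (hz : z ∈ brieskornW 3) : ofSphere z ∈ modelX := by
  have hp := norm_fst_sq_lt_of_mem_brieskornW hz
  have hc := weight_spec hp (3 * ‖z.1‖ ^ 2 / 4)
  refine ⟨?_, ?_⟩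
  · rw [ofSphere, hypersurface_dilate, hz.1, smul_zero]
  · rw [ofSphere, norm_dilate_fst_sq, sum_norm_dilate_snd_sq]
    have : ∑ i, ‖z.2 i‖ ^ 2 = 1 - ‖z.1‖ ^ 2 := by linarith [hz.2]
    rw [this]
    linarith

/-- The inverse of the first scale solves the equation for the second, so it is the second scale by
uniqueness. -/
theorem ofSphere_toSphere {z : C4} (hz : z ∈ modelX) : ofSphere (toSphere z) = z := by
  have hp := norm_fst_sq_lt_of_mem_modelX hz
  have hW := norm_fst_sq_lt_of_mem_brieskornW (toSphere_mem hz)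
  have hc := weight_spec hp (‖z.1‖ ^ 2)
  have hc0 := weight_pos hp (‖z.1‖ ^ 2)
  rw [ofSphere, weight_eq (c := (weight (4 - 3 * ‖z.1‖ ^ 2) (‖z.1‖ ^ 2))⁻¹) hW (inv_pos.2 hc0)]
  · rw [toSphere, dilate_dilate, inv_mul_cancel₀ hc0.ne', dilate_one]
  · rw [toSphere, norm_dilate_fst_sq]
    set c := weight (4 - 3 * ‖z.1‖ ^ 2) (‖z.1‖ ^ 2)
    field_simp
    linear_combination -hc

theorem toSphere_ofSphere {z : C4} (hz : z ∈ brieskornW 3) : toSphere (ofSphere z) = z := by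
  have hp := norm_fst_sq_lt_of_mem_brieskornW hz
  have hX := norm_fst_sq_lt_of_mem_modelX (ofSphere_mem hz)
  have hc := weight_spec hp (3 * ‖z.1‖ ^ 2 / 4)
  have hc0 := weight_pos hp (3 * ‖z.1‖ ^ 2 / 4)
  rw [toSphere, weight_eq (c := (weight ((1 - ‖z.1‖ ^ 2) / 4) (3 * ‖z.1‖ ^ 2 / 4))⁻¹) hX
    (inv_pos.2 hc0)]
  · rw [ofSphere, dilate_dilate, inv_mul_cancel₀ hc0.ne', dilate_one]
  · rw [ofSphere, norm_dilate_fst_sq]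
    set c := weight ((1 - ‖z.1‖ ^ 2) / 4) (3 * ‖z.1‖ ^ 2 / 4)
    field_simp
    linear_combination -4 * hc

theorem contDiffAt_dilate {N : Type*} [NormedAddCommGroup N] [NormedSpace ℝ N] {c : N → ℝ}
    {f : N → C4} {x : N} (hc : ContDiffAt ℝ ∞ c x) (hf : ContDiffAt ℝ ∞ f x) :
    ContDiffAt ℝ ∞ (fun x => dilate (c x) (f x)) x :=
  ((hc.pow 2).smul hf.fst).prodMk ((hc.pow 3).smul hf.snd)

theorem contDiff_norm_fst_sq : ContDiff ℝ ∞ (fun z : C4 => ‖z.1‖ ^ 2) := contDiff_fst.norm_sq ℝ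

theorem contDiffAt_toSphere {z : C4} (hz : 0 < 4 - 3 * ‖z.1‖ ^ 2) : ContDiffAt ℝ ∞ toSphere z := by
  refine contDiffAt_dilate (f := fun z => z) ?_ contDiffAt_id
  have h1 : ContDiffAt ℝ ∞ (fun z : C4 => (4 - 3 * ‖z.1‖ ^ 2, ‖z.1‖ ^ 2)) z :=
    ((contDiff_const.sub (contDiff_const.mul contDiff_norm_fst_sq)).prodMk
      contDiff_norm_fst_sq).contDiffAt
  exact ContDiffAt.comp (g := fun x : ℝ × ℝ => weight x.1 x.2) z (contDiffAt_weight hz _) h1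

theorem contDiffAt_ofSphere {z : C4} (hz : 0 < (1 - ‖z.1‖ ^ 2) / 4) :
    ContDiffAt ℝ ∞ ofSphere z := by
  refine contDiffAt_dilate (f := fun z => z) ?_ contDiffAt_id
  have h1 : ContDiffAt ℝ ∞ (fun z : C4 => ((1 - ‖z.1‖ ^ 2) / 4, 3 * ‖z.1‖ ^ 2 / 4)) z :=
    (((contDiff_const.sub contDiff_norm_fst_sq).div_const _).prodMk
      ((contDiff_const.mul contDiff_norm_fst_sq).div_const _)).contDiffAt
  exact ContDiffAt.comp (g := fun x : ℝ × ℝ => weight x.1 x.2) z (contDiffAt_weight hz _) h1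

/-- The weighted projection commutes with maps of the form `(z₀, z) ↦ (ψ z₀, φ z)` that are real
homogeneous and preserve `|z₀|`. -/
theorem toSphere_comm {f : C4 → C4} (hf : ∀ (c : ℝ) z, f (dilate c z) = dilate c (f z))
    (hn : ∀ z, ‖(f z).1‖ = ‖z.1‖) (z : C4) : toSphere (f z) = f (toSphere z) := by
  rw [toSphere, toSphere, hf, hn]

/-! ### Invariants of pairs of vectors -/

/-- The complex number `-(|u₁|² - |u₂|² + 2 i ⟨u₁, u₂⟩)`. -/
def quadInv (u : HH) : ℂ :=
  ⟨inner ℝ u.2 u.2 - inner ℝ u.1 u.1, -2 * inner ℝ u.1 u.2⟩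

/-- The pair of quaternions `(3 v̄₁u₁v₁ - v̄₂u₁v₂, v̄₁u₂v₁ - 3 v̄₂u₂v₂)`. -/
def cubicInv (p : HH × HH) : HH :=
  ((3 : ℝ) • (star p.2.1 * p.1.1 * p.2.1) - star p.2.2 * p.1.1 * p.2.2,
    star p.2.1 * p.1.2 * p.2.1 - (3 : ℝ) • (star p.2.2 * p.1.2 * p.2.2))

/-- The pair of invariants `quadInv` and `cubicInv`. -/
def invPair (p : HH × HH) : ℂ × HH := (quadInv p.1, cubicInv p)

/-- The conditions of `modelX` in terms of two imaginary quaternions, the real and the imaginary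
part of a vector in `ℂ³`. -/
structure IsModelPoint (d : ℂ × HH) : Prop where
  re_fst : d.2.1.re = 0
  re_snd : d.2.2.re = 0
  re_eq : d.1.re ^ 3 - 3 * d.1.re * d.1.im ^ 2 + inner ℝ d.2.1 d.2.1 - inner ℝ d.2.2 d.2.2 = 0
  im_eq : 3 * d.1.re ^ 2 * d.1.im - d.1.im ^ 3 + 2 * inner ℝ d.2.1 d.2.2 = 0
  norm_eq : 3 * (d.1.re ^ 2 + d.1.im ^ 2) + inner ℝ d.2.1 d.2.1 + inner ℝ d.2.2 d.2.2 = 4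

theorem inner_eq (a b : ℍ[ℝ]) : inner ℝ a b =
    a.re * b.re + a.imI * b.imI + a.imJ * b.imJ + a.imK * b.imK := by
  rw [Quaternion.inner_def]; simp

theorem imaginary_mul_self {a : ℍ[ℝ]} (ha : a.re = 0) (x : ℍ[ℝ]) :
    a * (a * x) = -((inner ℝ a a : ℝ) • x) := by
  rw [inner_eq]
  ext <;> simp [ha] <;> ring

/-- This is `ab + ba = -2⟨a, b⟩` together with `b² = -|b|²`. -/
theorem imaginary_sandwich {a b : ℍ[ℝ]} (ha : a.re = 0) (hb : b.re = 0) :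
    b * (a * b) = (inner ℝ b b : ℝ) • a - (2 * inner ℝ a b : ℝ) • b := by
  rw [inner_eq, inner_eq]
  ext <;> simp [ha, hb] <;> ring

theorem onS7_iff_inner (u : HH) : OnS7 u ↔ (inner ℝ u.1 u.1 : ℝ) + inner ℝ u.2 u.2 = 1 := by
  rw [OnS7, real_inner_self_eq_norm_sq, real_inner_self_eq_norm_sq]

theorem star_imaginary {a : ℍ[ℝ]} (ha : a.re = 0) : star a = -a := by
  ext <;> simp [ha]

/-- With `u = (a, b)` imaginary, `v = (ab/|a|, |a|)`, so `v̄₁ x v₁ = b a x a b / |a|²` and `v̄₂ x v₂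
= |a|² x`. For `x = a, b` repeated sandwiching reduces these words to combinations of `a` and `b`.
-/
theorem cubicInv_slice_false {u : HH} (h1 : u.1.re = 0) (h2 : u.2.re = 0) (hu : u.1 ≠ 0) :
    cubicInv (u, slice false u) =
      (-(3 * inner ℝ u.2 u.2 + inner ℝ u.1 u.1 : ℝ) • u.1 + (6 * inner ℝ u.1 u.2 : ℝ) • u.2,
        (-2 * inner ℝ u.1 u.2 * inner ℝ u.2 u.2 / inner ℝ u.1 u.1 : ℝ) • u.1 +
          (4 * inner ℝ u.1 u.2 ^ 2 / inner ℝ u.1 u.1 - inner ℝ u.2 u.2 -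
            3 * inner ℝ u.1 u.1 : ℝ) • u.2) := by
  obtain ⟨a, b⟩ := u
  simp only at h1 h2 hu ⊢
  have hn : ‖a‖ ≠ 0 := norm_ne_zero_iff.2 hu
  have hs : slice false (a, b) = (‖a‖⁻¹ • (a * b), ((‖a‖ : ℝ) : ℍ[ℝ])) := by
    simp [slice, mk2, pr, star_imaginary h2]
  have hst : star (‖a‖⁻¹ • (a * b)) = ‖a‖⁻¹ • (b * a) := by
    rw [Quaternion.star_smul, star_mul, star_imaginary h1, star_imaginary h2, neg_mul_neg]
  have hg : (inner ℝ b a : ℝ) = inner ℝ a b := real_inner_comm _ _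
  have hbb : b * b = -((inner ℝ b b : ℝ) : ℍ[ℝ]) := by
    have := imaginary_mul_self h2 1
    rwa [mul_one, ← Quaternion.coe_mul_eq_smul, mul_one] at this
  have e1 : b * (a * (a * (a * b))) = -(inner ℝ a a : ℝ) • ((inner ℝ b b : ℝ) • a -
      (2 * inner ℝ a b : ℝ) • b) := by
    rw [imaginary_mul_self h1, ← imaginary_sandwich h1 h2, mul_neg, mul_smul_comm, neg_smul]
  have e2 : b * (a * (b * (a * b))) = (inner ℝ a a : ℝ) • (-(inner ℝ b b : ℝ) • b) -
      (2 * inner ℝ a b : ℝ) • ((inner ℝ b b : ℝ) • a - (2 * inner ℝ a b : ℝ) • b) := by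
    have h : a * (b * (a * b)) = (inner ℝ a a : ℝ) • (b * b) - (2 * inner ℝ a b : ℝ) • (a * b) := by
      have h := congrArg (· * b) (imaginary_sandwich h2 h1)
      simp only [mul_assoc, sub_mul, smul_mul_assoc, hg] at h
      exact h
    rw [h, mul_sub, mul_smul_comm, mul_smul_comm, imaginary_mul_self h2, imaginary_sandwich h1 h2,
      neg_smul]
  have hn2 : (inner ℝ a a : ℝ) = ‖a‖ ^ 2 := real_inner_self_eq_norm_sq a
  have hα : (inner ℝ a a : ℝ) ≠ 0 := by rw [hn2]; exact pow_ne_zero 2 hn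
  rw [cubicInv]
  simp only [hs, hst, Quaternion.star_coe, smul_mul_assoc, mul_smul_comm, mul_assoc, e1, e2,
    Quaternion.coe_mul_eq_smul, Quaternion.mul_coe_eq_smul, smul_smul, hn2]
  ext1
  · simp only
    match_scalars <;> field_simp <;> ring
  · simp only
    match_scalars <;> field_simp <;> ring

/-! ### Recovering a vector from its invariants -/

/-- The coefficients of `cubicInv (u, v)` with respect to `u` in terms of `quadInv u`. -/
def coefD (w : ℂ) : ℝ := 2 * w.im ^ 2 / (1 - w.re) - 2 + w.re

/-- The solution `u` of `invPair (u, v) = d`, where `v₂ > 0`. -/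
def solveFst (d : ℂ × HH) : HH :=
  ((4 - d.1.re ^ 2 - d.1.im ^ 2)⁻¹ • (coefD d.1 • d.2.1 + (3 * d.1.im) • d.2.2),
    -(4 - d.1.re ^ 2 - d.1.im ^ 2)⁻¹ •
      ((2 + d.1.re) • d.2.2 + (d.1.im * (1 + d.1.re) / (1 - d.1.re)) • d.2.1))

/-- On the unit sphere the Gram matrix of `u₁`, `u₂` is determined by `w = r + i s`: `|u₁|² = (1 -
r)/2`, `|u₂|² = (1 + r)/2`, `⟨u₁, u₂⟩ = -s/2`. Hence all coefficients are functions of `w`. -/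
theorem invPair_slice_false {u : HH} (h1 : u.1.re = 0) (h2 : u.2.re = 0) (hu : OnS7 u)
    (hu0 : u.1 ≠ 0) : invPair (u, slice false u) = (quadInv u,
      (-(2 + (quadInv u).re) • u.1 + (-3 * (quadInv u).im) • u.2,
        ((quadInv u).im * (1 + (quadInv u).re) / (1 - (quadInv u).re)) • u.1 +
          coefD (quadInv u) • u.2)) := by
  rw [invPair, cubicInv_slice_false h1 h2 hu0]
  have hα : (inner ℝ u.1 u.1 : ℝ) ≠ 0 := by rwa [Ne, inner_self_eq_zero]
  have hβ : (inner ℝ u.2 u.2 : ℝ) = 1 - inner ℝ u.1 u.1 := by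
    rw [onS7_iff_inner] at hu; linarith
  have hre : 1 - (quadInv u).re = 2 * inner ℝ u.1 u.1 := by simp only [quadInv, hβ]; ring
  simp only [coefD, hre]
  simp only [quadInv, hβ]
  congr 3
  · congr 1; ring
  · congr 1; ring
  · congr 1; field_simp; ring
  · congr 1; field_simp; ring

/-- `1 - Re w = 2 |u₁|²`, and `|w| ≤ 1` by the Cauchy–Schwarz inequality. -/
theorem quadInv_bounds {u : HH} (hu : OnS7 u) (hu0 : u.1 ≠ 0) :
    1 - (quadInv u).re ≠ 0 ∧ 4 - (quadInv u).re ^ 2 - (quadInv u).im ^ 2 ≠ 0 := by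
  have hα : 0 < (inner ℝ u.1 u.1 : ℝ) := by
    rw [real_inner_self_eq_norm_sq]; exact pow_pos (norm_pos_iff.2 hu0) 2
  have hβ : (inner ℝ u.2 u.2 : ℝ) = 1 - inner ℝ u.1 u.1 := by
    rw [onS7_iff_inner] at hu; linarith
  have hcs := real_inner_mul_inner_self_le u.1 u.2
  simp only [quadInv, hβ] at hcs ⊢
  constructor
  · have : 1 - (1 - inner ℝ u.1 u.1 - inner ℝ u.1 u.1) = 2 * (inner ℝ u.1 u.1 : ℝ) := by ring
    rw [this]; positivity
  · nlinarith

/-- `solveFst` is Cramer's rule for the coefficient matrix of `invPair_slice_false`, whose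
determinant simplifies to `4 - |w|²`. -/
theorem solveFst_invPair {u : HH} (h1 : u.1.re = 0) (h2 : u.2.re = 0) (hu : OnS7 u)
    (hu0 : u.1 ≠ 0) : solveFst (invPair (u, slice false u)) = u := by
  obtain ⟨hr, hΔ⟩ := quadInv_bounds hu hu0
  rw [invPair_slice_false h1 h2 hu hu0]
  simp only [solveFst, coefD]
  generalize (quadInv u).re = r at *
  generalize (quadInv u).im = s at *
  ext1
  · simp only
    match_scalars <;> field_simp <;> ring
  · simp only
    match_scalars <;> field_simp <;> ring

/-- Since the Gram matrix of `u₁`, `u₂` is affine in `w`, the model equations become rational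
identities in the real and imaginary parts of `w`. -/
theorem isModelPoint_invPair_slice_false {u : HH} (h1 : u.1.re = 0) (h2 : u.2.re = 0)
    (hu : OnS7 u) (hu0 : u.1 ≠ 0) : IsModelPoint (invPair (u, slice false u)) := by
  obtain ⟨hr, hΔ⟩ := quadInv_bounds hu hu0
  rw [invPair_slice_false h1 h2 hu hu0]
  have hα : (inner ℝ u.1 u.1 : ℝ) = (1 - (quadInv u).re) / 2 := by
    rw [onS7_iff_inner] at hu; simp only [quadInv]; linarith
  have hβ : (inner ℝ u.2 u.2 : ℝ) = (1 + (quadInv u).re) / 2 := by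
    rw [onS7_iff_inner] at hu; simp only [quadInv]; linarith
  have hg : (inner ℝ u.1 u.2 : ℝ) = -(quadInv u).im / 2 := by
    simp only [quadInv]; ring
  have hg' : (inner ℝ u.2 u.1 : ℝ) = -(quadInv u).im / 2 := by rw [real_inner_comm, hg]
  constructor
  · simp [h1, h2]
  · simp [h1, h2]
  all_goals
    simp only [inner_add_left, inner_add_right, real_inner_smul_left, real_inner_smul_right,
      hα, hβ, hg, hg', coefD]
    generalize (quadInv u).re = r at *
    generalize (quadInv u).im = s at *
    field_simp
    ring

theorem IsModelPoint.norm_bound {d : ℂ × HH} (hd : IsModelPoint d) :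
    0 < 4 - d.1.re ^ 2 - d.1.im ^ 2 := by
  have h1 : 0 ≤ (inner ℝ d.2.1 d.2.1 : ℝ) := real_inner_self_nonneg
  have h2 : 0 ≤ (inner ℝ d.2.2 d.2.2 : ℝ) := real_inner_self_nonneg
  linarith [hd.norm_eq]

/-- The model equations determine the Gram matrix of `(X, Y)` from `w`. Inserted in Cramer's
formulas, this Gram matrix shows that the solution `u` is a unit vector with `quadInv u = w`; then
the linear system is the right one and returns `X` and `Y`. -/
theorem solveFst_spec {d : ℂ × HH} (hd : IsModelPoint d) (hr : 1 - d.1.re ≠ 0) :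
    (solveFst d).1.re = 0 ∧ (solveFst d).2.re = 0 ∧ OnS7 (solveFst d) ∧ (solveFst d).1 ≠ 0 ∧
      invPair (solveFst d, slice false (solveFst d)) = d := by
  have hΔ := hd.norm_bound.ne'
  -- The real cubic equation gives `|X|² - |Y|²` and the norm equation `|X|² + |Y|²`.
  have hX : (inner ℝ d.2.1 d.2.1 : ℝ) = (4 - 3 * (d.1.re ^ 2 + d.1.im ^ 2) -
      (d.1.re ^ 3 - 3 * d.1.re * d.1.im ^ 2)) / 2 := by linarith [hd.re_eq, hd.norm_eq]
  have hY : (inner ℝ d.2.2 d.2.2 : ℝ) = (4 - 3 * (d.1.re ^ 2 + d.1.im ^ 2) +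
      (d.1.re ^ 3 - 3 * d.1.re * d.1.im ^ 2)) / 2 := by linarith [hd.re_eq, hd.norm_eq]
  have hZ : (inner ℝ d.2.1 d.2.2 : ℝ) = -(3 * d.1.re ^ 2 * d.1.im - d.1.im ^ 3) / 2 := by
    linarith [hd.im_eq]
  have hZ' : (inner ℝ d.2.2 d.2.1 : ℝ) = -(3 * d.1.re ^ 2 * d.1.im - d.1.im ^ 3) / 2 := by
    rw [real_inner_comm, hZ]
  have h1 : (solveFst d).1.re = 0 := by simp [solveFst, hd.re_fst, hd.re_snd]
  have h2 : (solveFst d).2.re = 0 := by simp [solveFst, hd.re_fst, hd.re_snd]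
  have hα : (inner ℝ (solveFst d).1 (solveFst d).1 : ℝ) = (1 - d.1.re) / 2 := by
    simp only [solveFst, inner_add_left, inner_add_right, real_inner_smul_left,
      real_inner_smul_right, hX, hY, hZ, hZ', coefD]
    generalize d.1.re = r at *
    generalize d.1.im = s at *
    field_simp
    ring
  have hβ : (inner ℝ (solveFst d).2 (solveFst d).2 : ℝ) = (1 + d.1.re) / 2 := by
    simp only [solveFst, inner_add_left, inner_add_right, real_inner_smul_left,
      real_inner_smul_right, hX, hY, hZ, hZ', coefD]
    generalize d.1.re = r at *
    generalize d.1.im = s at *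
    field_simp
    ring
  have hg : (inner ℝ (solveFst d).1 (solveFst d).2 : ℝ) = -d.1.im / 2 := by
    simp only [solveFst, inner_add_left, inner_add_right, real_inner_smul_left,
      real_inner_smul_right, hX, hY, hZ, hZ', coefD]
    generalize d.1.re = r at *
    generalize d.1.im = s at *
    field_simp
    ring
  have hS : OnS7 (solveFst d) := by rw [onS7_iff_inner, hα, hβ]; ring
  have h0 : (solveFst d).1 ≠ 0 := by
    intro h
    rw [h, inner_zero_left] at hα
    exact hr (by linarith)
  have hq : quadInv (solveFst d) = d.1 := by
    apply Complex.ext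
    · simp only [quadInv, hα, hβ]; ring
    · simp only [quadInv, hg]; ring
  refine ⟨h1, h2, hS, h0, ?_⟩
  rw [invPair_slice_false h1 h2 hS h0, hq]
  refine Prod.ext rfl ?_
  simp only [solveFst, coefD]
  generalize d.1.re = r at *
  generalize d.1.im = s at *
  ext1
  · simp only
    match_scalars <;> field_simp <;> ring
  · simp only
    match_scalars <;> field_simp <;> ring

/-! ### The symmetry between the two components -/

/-- The effect on invariants of the exchange of the two components. -/
def swapInv (d : ℂ × HH) : ℂ × HH := (⟨-d.1.re, d.1.im⟩, (-d.2.2, -d.2.1))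

theorem swapInv_swapInv (d : ℂ × HH) : swapInv (swapInv d) = d := by
  simp [swapInv]

/-- The coefficients 3 and 1 in `cubicInv` are placed so that exchanging components only permutes
the invariants up to sign. The formulas for `v₂ > 0` thereby give those for `v₁ > 0`. -/
theorem invPair_swap (u v : HH) : invPair (u.swap, v.swap) = swapInv (invPair (u, v)) := by
  refine Prod.ext (Complex.ext ?_ ?_) (Prod.ext ?_ ?_)
  · simp [invPair, swapInv, quadInv]
  · simp [invPair, swapInv, quadInv, real_inner_comm]
  · simp [invPair, swapInv, cubicInv]
  · simp [invPair, swapInv, cubicInv]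

theorem slice_true (u : HH) : slice true u = (slice false u.swap).swap := rfl

theorem onS7_swap (u : HH) : OnS7 u.swap ↔ OnS7 u := by
  simp [OnS7, add_comm]

theorem IsModelPoint.swap {d : ℂ × HH} (hd : IsModelPoint d) : IsModelPoint (swapInv d) := by
  obtain ⟨h1, h2, h3, h4, h5⟩ := hd
  constructor <;> simp only [swapInv, inner_neg_neg]
  · simp [h2]
  · simp [h1]
  · linear_combination -h3
  · rw [real_inner_comm]; linear_combination h4
  · linear_combination h5

/-- The solution `u` of `invPair (u, v) = d`, where `vᵢ > 0`. -/
def solve : Bool → ℂ × HH → HH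
  | false, d => solveFst d
  | true, d => (solveFst (swapInv d)).swap

/-- The number `2 |u₁|²` or `2 |u₂|²`, respectively. -/
def denom : Bool → ℂ → ℝ
  | false, w => 1 - w.re
  | true, w => 1 + w.re

theorem solve_invPair {i : Bool} {u : HH} (h1 : u.1.re = 0) (h2 : u.2.re = 0) (hu : OnS7 u)
    (hu0 : pr (!i) u ≠ 0) : solve i (invPair (u, slice i u)) = u := by
  cases i
  · exact solveFst_invPair h1 h2 hu hu0
  · rw [slice_true, solve]
    conv_lhs => rw [← Prod.swap_swap u, invPair_swap, swapInv_swapInv]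
    simp only [Prod.swap_swap]
    rw [solveFst_invPair h2 h1 ((onS7_swap u).2 hu) hu0, Prod.swap_swap]

theorem isModelPoint_invPair {i : Bool} {u : HH} (h1 : u.1.re = 0) (h2 : u.2.re = 0)
    (hu : OnS7 u) (hu0 : pr (!i) u ≠ 0) : IsModelPoint (invPair (u, slice i u)) := by
  cases i
  · exact isModelPoint_invPair_slice_false h1 h2 hu hu0
  · rw [slice_true]
    have h := invPair_swap u.swap (slice false u.swap)
    rw [Prod.swap_swap] at h
    rw [h]
    exact (isModelPoint_invPair_slice_false h2 h1 ((onS7_swap u).2 hu) hu0).swap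

theorem solve_spec {i : Bool} {d : ℂ × HH} (hd : IsModelPoint d) (hr : denom i d.1 ≠ 0) :
    (solve i d).1.re = 0 ∧ (solve i d).2.re = 0 ∧ OnS7 (solve i d) ∧ pr (!i) (solve i d) ≠ 0 ∧
      invPair (solve i d, slice i (solve i d)) = d := by
  cases i
  · exact solveFst_spec hd hr
  · obtain ⟨h1, h2, h3, h4, h5⟩ := solveFst_spec hd.swap
      (by simpa [denom, swapInv] using hr)
    refine ⟨h2, h1, (onS7_swap _).2 h3, h4, ?_⟩
    rw [solve, slice_true, Prod.swap_swap, invPair_swap, h5, swapInv_swapInv]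

/-- The two denominators add up to 2, so the solutions for `v₁ > 0` and `v₂ > 0` together cover
everything. -/
theorem exists_denom_ne_zero (w : ℂ) : ∃ i, denom i w ≠ 0 := by
  by_cases h : 1 - w.re = 0
  · exact ⟨true, by simp only [denom]; linarith⟩
  · exact ⟨false, h⟩

theorem denom_quadInv {u : HH} (hu : OnS7 u) (i : Bool) :
    denom i (quadInv u) = 2 * ‖pr (!i) u‖ ^ 2 := by
  have h := hu
  rw [OnS7] at h
  cases i <;> simp [denom, quadInv, pr] <;> linarith

theorem slice_smul {i : Bool} {c : ℝ} (hc : c ^ 2 = 1) (u : HH) :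
    slice i (c • u.1, c • u.2) = slice i u := by
  have h1 : (c - 1) * (c + 1) = 0 := by linear_combination hc
  rcases mul_eq_zero.1 h1 with h | h
  · obtain rfl : c = 1 := by linarith
    simp
  · obtain rfl : c = -1 := by linarith
    have h2 : ((-1 : ℝ) • u.1, (-1 : ℝ) • u.2) = -u := by ext1 <;> simp
    rw [h2, slice_neg]

/-! ### Smoothness of the invariants -/

/-- The formulas are rational with just these denominators, so `solve i` is smooth in ambient
directions too, not only along the model. -/
theorem contDiffAt_solve {i : Bool} {d : ℂ × HH} (hr : denom i d.1 ≠ 0)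
    (hΔ : 4 - d.1.re ^ 2 - d.1.im ^ 2 ≠ 0) : ContDiffAt ℝ ∞ (solve i) d := by
  have hre : ContDiff ℝ ∞ (fun d : ℂ × HH => d.1.re) := Complex.reCLM.contDiff.comp contDiff_fst
  have him : ContDiff ℝ ∞ (fun d : ℂ × HH => d.1.im) := Complex.imCLM.contDiff.comp contDiff_fst
  have hx : ContDiff ℝ ∞ (fun d : ℂ × HH => d.2.1) := contDiff_fst.comp contDiff_snd
  have hy : ContDiff ℝ ∞ (fun d : ℂ × HH => d.2.2) := contDiff_snd.comp contDiff_snd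
  have hF : ∀ d : ℂ × HH, 1 - d.1.re ≠ 0 → 4 - d.1.re ^ 2 - d.1.im ^ 2 ≠ 0 →
      ContDiffAt ℝ ∞ solveFst d := by
    intro d hr hΔ
    have h1 : ContDiffAt ℝ ∞ (fun d : ℂ × HH => (4 - d.1.re ^ 2 - d.1.im ^ 2)⁻¹) d :=
      (((contDiff_const.sub (hre.pow 2)).sub (him.pow 2)).contDiffAt).inv hΔ
    have h2 : ContDiffAt ℝ ∞ (fun d : ℂ × HH => coefD d.1) d :=
      (((contDiff_const.mul (him.pow 2)).contDiffAt.div (contDiff_const.sub hre).contDiffAt hr).sub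
        contDiffAt_const).add hre.contDiffAt
    have h3 : ContDiffAt ℝ ∞ (fun d : ℂ × HH => d.1.im * (1 + d.1.re) / (1 - d.1.re)) d :=
      (him.mul (contDiff_const.add hre)).contDiffAt.div (contDiff_const.sub hre).contDiffAt hr
    exact (h1.smul ((h2.smul hx.contDiffAt).add
      ((contDiff_const.mul him).smul hy).contDiffAt)).prodMk
      (h1.neg.smul (((contDiff_const.add hre).smul hy).contDiffAt.add (h3.smul hx.contDiffAt)))
  cases i
  · exact hF d hr hΔ
  · have hswap : ContDiff ℝ ∞ swapInv := by
      have h1 : ContDiff ℝ ∞ (fun d : ℂ × HH => (⟨-d.1.re, d.1.im⟩ : ℂ)) :=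
        (Complex.equivRealProdCLM.symm.contDiff).comp (hre.neg.prodMk him)
      exact h1.prodMk (hy.neg.prodMk hx.neg)
    have h1 := (hF (swapInv d) (by simpa [denom, swapInv] using hr)
      (by simpa [swapInv] using hΔ)).comp d hswap.contDiffAt
    exact h1.snd.prodMk h1.fst

theorem contDiff_invPair : ContDiff ℝ ∞ invPair := by
  have hu1 : ContDiff ℝ ∞ (fun p : HH × HH => p.1.1) := contDiff_fst.comp contDiff_fst
  have hu2 : ContDiff ℝ ∞ (fun p : HH × HH => p.1.2) := contDiff_snd.comp contDiff_fst
  have hv1 : ContDiff ℝ ∞ (fun p : HH × HH => p.2.1) := contDiff_fst.comp contDiff_snd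
  have hv2 : ContDiff ℝ ∞ (fun p : HH × HH => p.2.2) := contDiff_snd.comp contDiff_snd
  have hs1 : ContDiff ℝ ∞ (fun p : HH × HH => star p.2.1) := contDiff_starH.comp hv1
  have hs2 : ContDiff ℝ ∞ (fun p : HH × HH => star p.2.2) := contDiff_starH.comp hv2
  have h1 : ContDiff ℝ ∞ (fun p : HH × HH => quadInv p.1) :=
    (Complex.equivRealProdCLM.symm.contDiff).comp
      (((hu2.inner ℝ hu2).sub (hu1.inner ℝ hu1)).prodMk (contDiff_const.mul (hu1.inner ℝ hu2)))
  exact h1.prodMk (((((hs1.mul hu1).mul hv1).const_smul (3 : ℝ)).sub ((hs2.mul hu1).mul hv2)).prodMk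
    (((hs1.mul hu2).mul hv1).sub (((hs2.mul hu2).mul hv2).const_smul (3 : ℝ))))

/-! ### Complex coordinates -/

/-- The identification of a pair of imaginary quaternions with a vector in `ℂ³`. -/
def toC4 (d : ℂ × HH) : C4 := (d.1, fun j => ⟨imCoord d.2.1 j, imCoord d.2.2 j⟩)

/-- The inverse of `toC4`. -/
def ofC4 (z : C4) : ℂ × HH := (z.1, (imQuat fun j => (z.2 j).re, imQuat fun j => (z.2 j).im))

theorem imCoord_imQuat (x : Fin 3 → ℝ) : imCoord (imQuat x) = x := by
  funext j; fin_cases j <;> rfl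

theorem imQuat_imCoord {a : ℍ[ℝ]} (ha : a.re = 0) : imQuat (imCoord a) = a := by
  ext <;> simp [ha, imCoord]

theorem toC4_ofC4 (z : C4) : toC4 (ofC4 z) = z := by
  refine Prod.ext rfl (funext fun j => ?_)
  simp only [toC4, ofC4, imCoord_imQuat]

theorem ofC4_toC4 {d : ℂ × HH} (hd : IsModelPoint d) : ofC4 (toC4 d) = d :=
  Prod.ext rfl (Prod.ext (imQuat_imCoord hd.re_fst) (imQuat_imCoord hd.re_snd))

theorem isModelPoint_ofC4 {z : C4} (hz : z ∈ modelX) : IsModelPoint (ofC4 z) := by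
  obtain ⟨h1, h2⟩ := hz
  have h3 := congrArg Complex.re h1
  have h4 := congrArg Complex.im h1
  simp only [Fin.sum_univ_three, pow_succ, pow_zero, one_mul, Complex.add_re, Complex.add_im,
    Complex.mul_re, Complex.mul_im, Complex.zero_re, Complex.zero_im] at h3 h4
  simp only [Fin.sum_univ_three, ← Complex.normSq_eq_norm_sq, Complex.normSq_apply] at h2
  constructor
  · rfl
  · rfl
  all_goals simp only [ofC4, inner_eq, imQuat_re, imQuat_imI, imQuat_imJ, imQuat_imK]
  · linear_combination h3
  · linear_combination h4
  · linear_combination h2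

theorem toC4_mem_modelX {d : ℂ × HH} (hd : IsModelPoint d) : toC4 d ∈ modelX := by
  obtain ⟨h1, h2, h3, h4, h5⟩ := hd
  rw [inner_eq, inner_eq, h1, h2] at h3 h5
  rw [inner_eq, h1, h2] at h4
  constructor
  · apply Complex.ext
    · simp [toC4, imCoord, Fin.sum_univ_three, pow_succ]
      linear_combination h3
    · simp [toC4, imCoord, Fin.sum_univ_three, pow_succ]
      linear_combination h4
  · simp only [toC4, imCoord, Fin.sum_univ_three, ← Complex.normSq_eq_norm_sq, Complex.normSq_apply]
    simp
    linear_combination h5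

theorem contDiff_toC4 : ContDiff ℝ ∞ toC4 := by
  let L : (ℂ × HH) →ₗ[ℝ] C4 :=
    { toFun := toC4
      map_add' := fun a b => by
        refine Prod.ext rfl (funext fun j => Complex.ext ?_ ?_) <;>
        fin_cases j <;> simp [toC4, imCoord]
      map_smul' := fun r a => by
        refine Prod.ext rfl (funext fun j => Complex.ext ?_ ?_) <;>
        fin_cases j <;> simp [toC4, imCoord] }
  exact (LinearMap.toContinuousLinearMap L).contDiff

theorem contDiff_ofC4 : ContDiff ℝ ∞ ofC4 := by
  let L : C4 →ₗ[ℝ] (ℂ × HH) :=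
    { toFun := ofC4
      map_add' := fun a b => by
        refine Prod.ext rfl (Prod.ext ?_ ?_) <;> ext <;> simp [ofC4]
      map_smul' := fun r a => by
        refine Prod.ext rfl (Prod.ext ?_ ?_) <;> ext <;> simp [ofC4] }
  exact (LinearMap.toContinuousLinearMap L).contDiff

/-! ### The case of odd `n` -/

theorem inner_conj (q : unitary ℍ[ℝ]) (a b : ℍ[ℝ]) :
    (inner ℝ ((q : ℍ[ℝ]) * a * star (q : ℍ[ℝ])) ((q : ℍ[ℝ]) * b * star (q : ℍ[ℝ])) : ℝ) =
      inner ℝ a b := by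
  have hq : star (q : ℍ[ℝ]) * q = 1 := Unitary.coe_star_mul_self q
  have h1 : ∀ a : ℍ[ℝ], star (q : ℍ[ℝ]) * (q * a) = a := fun a => by
    rw [← mul_assoc, hq, one_mul]
  rw [Quaternion.inner_def, Quaternion.inner_def, ← re_conj q (a * star b)]
  simp only [star_mul, star_star, mul_assoc, h1]

/-- The map induced by `invPair` on `Σ⁷`. -/
def oddMap (n : ℤ) : Sigma7 n → ℂ × HH :=
  Quotient.lift (s := starSetoid n) (fun e : Total n => invPair e) (by
    rintro e _ ⟨q, rfl⟩
    refine Prod.ext ?_ ?_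
    · simp only [invPair, quadInv, starAct, conjAct, inner_conj]
    · simp only [invPair, cubicInv, starAct, conjAct, leftAct, star_leftAct_cancel])

theorem oddMap_proj {n : ℤ} (e : Total n) : oddMap n (proj n e) = invPair e := rfl

theorem pr_smul (i : Bool) (c : ℝ) (u : HH) : pr i (c • u.1, c • u.2) = c • pr i u := by
  cases i <;> rfl

/-- A class in `Σ⁵` has a representative `(u, slice i u)`, because `rho n u = ± u` and slices ignore
the sign. Its `u` is recovered from the invariants by `solve`, so the invariants determine the
class. -/
theorem exists_odd_normal_form {n : ℤ} (hn : Odd n) {x : Sigma7 n} (hx : x ∈ Sigma5 n) {i : Bool}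
    (hi : denom i (oddMap n x).1 ≠ 0) : IsModelPoint (oddMap n x) ∧
      ∃ h : (solve i (oddMap n x), slice i (solve i (oddMap n x))) ∈ totalSet n,
        x = proj n ⟨_, h⟩ := by
  obtain ⟨c, hc, hrho⟩ := rho_imaginary_of_odd hn
  have hc0 : c ≠ 0 := by rintro rfl; norm_num at hc
  obtain ⟨e, rfl⟩ : ∃ e, proj n e = x := Quotient.exists_rep x
  obtain ⟨h1, -⟩ := (proj_mem_Sigma5 e).1 hx
  have hu : pr (!i) (e : HH × HH).1 ≠ 0 := by
    intro h
    rw [oddMap_proj, invPair, denom_quadInv e.2.1, h] at hi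
    simp at hi
  -- If `vᵢ` vanished, orthogonality to `u` with nonzero other component would force `v = 0`.
  have hv : pr i (e : HH × HH).2 ≠ 0 := by
    intro h
    have hherm := e.2.2.2
    rw [herm_pr i, hrho _ h1, pr_smul, pr_smul, h, mul_zero, zero_add] at hherm
    have h2 : pr (!i) (e : HH × HH).2 = 0 :=
      (mul_eq_zero.1 hherm).resolve_left (star_ne_zero.2 (smul_ne_zero hc0 hu))
    have h3 := (norm_pr i _).1 e.2.2.1
    rw [h, h2] at h3
    simp at h3
  obtain ⟨e', he, hne, hv'⟩ := exists_normal_form e hv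
  rw [← he] at hx ⊢
  obtain ⟨h1, h2⟩ := (proj_mem_Sigma5 e').1 hx
  rw [hrho _ h1, pr_smul] at hne
  rw [hrho _ h1, slice_smul hc] at hv'
  have hu' : pr (!i) (e' : HH × HH).1 ≠ 0 := fun h => hne (by rw [h, smul_zero])
  have hval : (e' : HH × HH) = ((e' : HH × HH).1, slice i (e' : HH × HH).1) := Prod.ext rfl hv'
  have hodd : oddMap n (proj n e') = invPair ((e' : HH × HH).1, slice i (e' : HH × HH).1) := by
    rw [oddMap_proj]
    exact congrArg invPair hval
  have hsol : solve i (oddMap n (proj n e')) = (e' : HH × HH).1 := by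
    rw [hodd, solve_invPair h1 h2 e'.2.1 hu']
  refine ⟨?_, ?_⟩
  · rw [hodd]
    exact isModelPoint_invPair h1 h2 e'.2.1 hu'
  · have hmem : (solve i (oddMap n (proj n e')), slice i (solve i (oddMap n (proj n e')))) =
        (e' : HH × HH) := by rw [hsol]; exact hval.symm
    exact ⟨hmem ▸ e'.2, congrArg (proj n) (Subtype.ext hmem.symm)⟩

theorem isModelPoint_oddMap {n : ℤ} (hn : Odd n) {x : Sigma7 n} (hx : x ∈ Sigma5 n) :
    IsModelPoint (oddMap n x) := by
  obtain ⟨i, hi⟩ := exists_denom_ne_zero (oddMap n x).1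
  exact (exists_odd_normal_form hn hx hi).1

/-- The choice of `i` depends only on the common value of the invariants, so both points have the
same normal form. -/
theorem injOn_oddMap {n : ℤ} (hn : Odd n) : Set.InjOn (oddMap n) (Sigma5 n) := by
  intro x hx y hy hxy
  obtain ⟨i, hi⟩ := exists_denom_ne_zero (oddMap n x).1
  obtain ⟨-, h1, h1'⟩ := exists_odd_normal_form hn hx hi
  obtain ⟨-, h2, h2'⟩ := exists_odd_normal_form hn hy (hxy ▸ hi)
  rw [h1', h2']
  congr 2
  rw [hxy]

theorem contMDiff_oddMap (n : ℤ) : ContMDiff (𝓡 7) 𝓘(ℝ, ℂ × HH) ∞ (oddMap n) := fun _ =>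
  contMDiffAt_of_comp_proj oddMap_proj fun _ _ => contDiff_invPair.contDiffAt

/-- The map from `Σ⁷` to `ℂ⁴` that restricts to a diffeomorphism from `Σ⁵` to the Brieskorn
manifold. -/
def brieskornMap (n : ℤ) (x : Sigma7 n) : C4 := toSphere (toC4 (oddMap n x))

theorem eventually_contMDiffAt_brieskornMap {n : ℤ} (hn : Odd n) {x : Sigma7 n}
    (hx : x ∈ Sigma5 n) : ∀ᶠ y in 𝓝 x, ContMDiffAt (𝓡 7) 𝓘(ℝ, C4) ∞ (brieskornMap n) y := by
  have hm : ContMDiff (𝓡 7) 𝓘(ℝ, C4) ∞ (fun y => toC4 (oddMap n y)) :=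
    contDiff_toC4.contMDiff.comp (contMDiff_oddMap n)
  have hc : Continuous fun y => 4 - 3 * ‖(toC4 (oddMap n y)).1‖ ^ 2 :=
    (continuous_const.sub (continuous_const.mul contDiff_norm_fst_sq.continuous)).comp hm.continuous
  have hpos := norm_fst_sq_lt_of_mem_modelX (toC4_mem_modelX (isModelPoint_oddMap hn hx))
  filter_upwards [hc.continuousAt.eventually (isOpen_Ioi.mem_nhds hpos)] with y hy
  exact (contDiffAt_toSphere hy).contMDiffAt.comp y (hm y)

/-- A local section of `brieskornMap`. -/
def brieskornSect (n : ℤ) (i : Bool) (z : C4) : Sigma7 n := sect n i (solve i (ofC4 (ofSphere z)))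

/-- Undo the construction: return to `modelX`, solve for `u`, and take the class of `(u, slice i
u)`. Where the denominators are nonzero each stage is smooth in the ambient space. -/
theorem exists_brieskornSect {n : ℤ} (hn : Odd n) {z : C4} (hz : z ∈ brieskornW 3) :
    ∃ F : C4 → Sigma7 n, (∀ᶠ y in 𝓝 z, ContMDiffAt 𝓘(ℝ, C4) (𝓡 7) ∞ F y) ∧
      ∀ᶠ y in 𝓝 z, y ∈ brieskornW 3 → F y ∈ Sigma5 n ∧ brieskornMap n (F y) = y := by
  obtain ⟨c, hc, hrho⟩ := rho_imaginary_of_odd hn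
  have hc0 : c ≠ 0 := by rintro rfl; norm_num at hc
  have hmodel : ∀ y ∈ brieskornW 3, IsModelPoint (ofC4 (ofSphere y)) := fun y hy =>
    isModelPoint_ofC4 (ofSphere_mem hy)
  obtain ⟨i, hi⟩ := exists_denom_ne_zero (ofC4 (ofSphere z)).1
  have hpr : ∀ u : HH, u.1.re = 0 → pr (!i) u ≠ 0 → pr (!i) (rho n u) ≠ 0 := by
    intro u hu hu0
    rw [hrho u hu, pr_smul]
    exact smul_ne_zero hc0 hu0
  have hd : ContinuousAt (fun y => ofC4 (ofSphere y)) z :=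
    contDiff_ofC4.continuous.continuousAt.comp
      (contDiffAt_ofSphere (norm_fst_sq_lt_of_mem_brieskornW hz)).continuousAt
  have hdenom : Continuous (denom i) := by
    cases i
    · exact continuous_const.sub Complex.continuous_re
    · exact continuous_const.add Complex.continuous_re
  have hden : ∀ᶠ y in 𝓝 z, denom i (ofC4 (ofSphere y)).1 ≠ 0 :=
    ((hdenom.comp continuous_fst).continuousAt.comp hd).eventually_ne hi
  refine ⟨brieskornSect n i, ?_, ?_⟩
  · obtain ⟨h1, h2, h3, h4, -⟩ := solve_spec (hmodel z hz) hi
    have hΔc : Continuous fun d : ℂ × HH => 4 - d.1.re ^ 2 - d.1.im ^ 2 := by fun_prop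
    have hΔ : ∀ᶠ y in 𝓝 z, 4 - (ofC4 (ofSphere y)).1.re ^ 2 - (ofC4 (ofSphere y)).1.im ^ 2 ≠ 0 :=
      (ContinuousAt.comp (g := fun d : ℂ × HH => 4 - d.1.re ^ 2 - d.1.im ^ 2)
        hΔc.continuousAt hd).eventually_ne (hmodel z hz).norm_bound.ne'
    have hnorm : ∀ᶠ y in 𝓝 z, 0 < (1 - ‖y.1‖ ^ 2) / 4 :=
      (((continuous_const.sub contDiff_norm_fst_sq.continuous).div_const 4).continuousAt).eventually
        (isOpen_Ioi.mem_nhds (norm_fst_sq_lt_of_mem_brieskornW hz))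
    have hsol : ContinuousAt (fun y => solve i (ofC4 (ofSphere y))) z :=
      ContinuousAt.comp (g := solve i)
        (contDiffAt_solve hi (hmodel z hz).norm_bound.ne').continuousAt hd
    filter_upwards [hΔ, hnorm, hden,
      hsol.eventually (eventually_contMDiffAt_sect h3 (hpr _ h1 h4))] with y hy1 hy2 hy3 hy4
    have hs : ContDiffAt ℝ ∞ (fun y => solve i (ofC4 (ofSphere y))) y :=
      ContDiffAt.comp (g := solve i) (f := fun y => ofC4 (ofSphere y)) y (contDiffAt_solve hy3 hy1)
        (contDiff_ofC4.contDiffAt.comp y (contDiffAt_ofSphere hy2))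
    exact ContMDiffAt.comp (g := sect n i) (f := fun y => solve i (ofC4 (ofSphere y))) y hy4
      hs.contMDiffAt
  · filter_upwards [hden] with y hy hyW
    obtain ⟨h1, h2, h3, h4, h5⟩ := solve_spec (hmodel y hyW) hy
    rw [brieskornSect, sect_eq h3 (hpr _ h1 h4), proj_mem_Sigma5, brieskornMap, oddMap_proj]
    refine ⟨⟨h1, h2⟩, ?_⟩
    simp only [hrho _ h1, slice_smul hc, h5, toC4_ofC4, toSphere_ofSphere hyW]

/-! ### Equivariance -/

theorem brieskornRotation_zero (d : ℕ) (z : C4) : brieskornRotation d 0 z = z := by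
  simp [brieskornRotation]

/-- As the exponent 3 is odd, `-E` acts as `-1` on `ℂ³`, while it acts trivially on `z₀`. -/
theorem brieskornRotation_pi (z : C4) : brieskornRotation 3 Real.pi z = (z.1, -z.2) := by
  have h1 : Complex.exp (2 * Complex.I * Real.pi) = 1 := by
    rw [← Complex.exp_two_pi_mul_I]; congr 1; ring
  have h2 : Complex.exp (((3 : ℕ) : ℂ) * Complex.I * Real.pi) = -1 := by
    rw [show ((3 : ℕ) : ℂ) * Complex.I * Real.pi = Real.pi * Complex.I + 2 * Real.pi * Complex.I by
      push_cast; ring, Complex.exp_add, Complex.exp_two_pi_mul_I, Complex.exp_pi_mul_I, mul_one]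
  rw [brieskornRotation, h1, h2, one_mul, neg_one_smul]

theorem brieskornAct_one_one (q : unitary ℍ[ℝ]) (z : C4) :
    brieskornAct 3 (1, 1) q z = brieskornSO3 q z := by
  simp [brieskornAct, brieskornRotation_zero]

theorem brieskornAct_one_neg (q : unitary ℍ[ℝ]) (z : C4) :
    brieskornAct 3 (1, -1) q z = brieskornReflection (brieskornSO3 q z) := by
  simp [brieskornAct, brieskornRotation_zero]

theorem brieskornAct_neg_neg (q : unitary ℍ[ℝ]) (z : C4) :
    brieskornAct 3 (-1, -1) q z = ((brieskornSO3 q z).1, -(brieskornSO3 q z).2) := by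
  simp [brieskornAct, brieskornRotation_pi]

theorem brieskornAct_neg_one (q : unitary ℍ[ℝ]) (z : C4) :
    brieskornAct 3 (-1, 1) q z = ((brieskornReflection (brieskornSO3 q z)).1,
      -(brieskornReflection (brieskornSO3 q z)).2) := by
  simp [brieskornAct, brieskornRotation_pi]

theorem brieskornSO3_dilate (q : unitary ℍ[ℝ]) (c : ℝ) (z : C4) :
    brieskornSO3 q (dilate c z) = dilate c (brieskornSO3 q z) := by
  simp only [brieskornSO3, dilate, Matrix.mulVec_smul]

theorem brieskornReflection_dilate (c : ℝ) (z : C4) :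
    brieskornReflection (dilate c z) = dilate c (brieskornReflection z) := by
  simp only [brieskornReflection, dilate, StarModule.star_smul, star_trivial]

/-- Together with `norm_brieskornAct_fst` this is what `toSphere_comm` requires. -/
theorem brieskornAct_dilate (B : ℤˣ × ℤˣ) (q : unitary ℍ[ℝ]) (c : ℝ) (z : C4) :
    brieskornAct 3 B q (dilate c z) = dilate c (brieskornAct 3 B q z) := by
  obtain ⟨ε, δ⟩ := B
  rcases Int.units_eq_one_or ε with rfl | rfl <;> rcases Int.units_eq_one_or δ with rfl | rfl <;>
  simp only [brieskornAct_one_one, brieskornAct_one_neg, brieskornAct_neg_neg,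
    brieskornAct_neg_one, brieskornSO3_dilate, brieskornReflection_dilate]
  all_goals simp only [dilate, smul_neg]

theorem norm_brieskornAct_fst (B : ℤˣ × ℤˣ) (q : unitary ℍ[ℝ]) (z : C4) :
    ‖(brieskornAct 3 B q z).1‖ = ‖z.1‖ := by
  obtain ⟨ε, δ⟩ := B
  rcases Int.units_eq_one_or ε with rfl | rfl <;> rcases Int.units_eq_one_or δ with rfl | rfl <;>
  simp only [brieskornAct_one_one, brieskornAct_one_neg, brieskornAct_neg_neg,
    brieskornAct_neg_one, brieskornSO3, brieskornReflection, _root_.norm_star]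

theorem rotMatrix_mulVec (q : unitary ℍ[ℝ]) {a : ℍ[ℝ]} (ha : a.re = 0) :
    (rotMatrix q).mulVec (imCoord a) = imCoord ((q : ℍ[ℝ]) * a * star (q : ℍ[ℝ])) := by
  have h : a = ∑ j, imCoord a j • imQuat (Pi.single j 1) := by
    rw [Fin.sum_univ_three]
    ext <;> simp [ha, imCoord]
  have hadd : ∀ a b : ℍ[ℝ], imCoord (a + b) = imCoord a + imCoord b := fun a b => by
    funext j; fin_cases j <;> simp [imCoord]
  have hsmul : ∀ (r : ℝ) (a : ℍ[ℝ]), imCoord (r • a) = r • imCoord a := fun r a => by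
    funext j; fin_cases j <;> simp [imCoord]
  funext i
  conv_rhs => rw [h]
  simp only [Matrix.mulVec, dotProduct, rotMatrix, Matrix.of_apply, Fin.sum_univ_three, mul_add,
    add_mul, mul_smul_comm, smul_mul_assoc, hadd, hsmul, Pi.add_apply, Pi.smul_apply, smul_eq_mul]
  ring

theorem brieskornSO3_toC4 (q : unitary ℍ[ℝ]) {d : ℂ × HH} (hd : IsModelPoint d) :
    brieskornSO3 q (toC4 d) = toC4 (d.1, conjAct q d.2) := by
  refine Prod.ext rfl (funext fun i => ?_)
  have h1 := congrFun (rotMatrix_mulVec q hd.re_fst) i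
  have h2 := congrFun (rotMatrix_mulVec q hd.re_snd) i
  simp only [Matrix.mulVec, dotProduct, Fin.sum_univ_three] at h1 h2
  apply Complex.ext
  · simp only [brieskornSO3, toC4, conjAct, ← h1, Matrix.mulVec, dotProduct, Fin.sum_univ_three]
    simp
  · simp only [brieskornSO3, toC4, conjAct, ← h2, Matrix.mulVec, dotProduct, Fin.sum_univ_three]
    simp

/-- `B` changes the signs of `u₁` and `u₂`, hence that of `⟨u₁, u₂⟩` by the product; in `cubicInv`
the signs of `v` cancel and the factors `q̄` of `v` turn into conjugation by `q`. -/
theorem oddMap_bullet {n : ℤ} (B : ℤˣ × ℤˣ) (q : unitary ℍ[ℝ]) (x : Sigma7 n) :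
    oddMap n (bullet n B q x) = (⟨(oddMap n x).1.re, (B.1 * B.2 : ℤˣ) * (oddMap n x).1.im⟩,
      diagAct B (conjAct q (oddMap n x).2)) := by
  obtain ⟨e, rfl⟩ : ∃ e, proj n e = x := Quotient.exists_rep x
  obtain ⟨ε, δ⟩ := B
  rw [bullet_proj, oddMap_proj, oddMap_proj]
  rcases Int.units_eq_one_or ε with rfl | rfl <;> rcases Int.units_eq_one_or δ with rfl | rfl <;>
  simp [invPair, quadInv, cubicInv, bulletTotal, diagAct, conjAct, rightAct, mul_assoc, mul_sub,
    sub_mul]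

/-- Since `X` and `Y` are the real and imaginary parts of a vector in `ℂ³`, the matrix `diag(1, -1)`
becomes complex conjugation and `-E` becomes `-1` on `ℂ³`. -/
theorem brieskornAct_toC4 (B : ℤˣ × ℤˣ) (q : unitary ℍ[ℝ]) {d : ℂ × HH} (hd : IsModelPoint d) :
    brieskornAct 3 B q (toC4 d) = toC4 (⟨d.1.re, (B.1 * B.2 : ℤˣ) * d.1.im⟩,
      diagAct B (conjAct q d.2)) := by
  obtain ⟨ε, δ⟩ := B
  rcases Int.units_eq_one_or ε with rfl | rfl <;> rcases Int.units_eq_one_or δ with rfl | rfl <;>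
  simp only [brieskornAct_one_one, brieskornAct_one_neg, brieskornAct_neg_neg,
    brieskornAct_neg_one, brieskornSO3_toC4 q hd]
  all_goals
    refine Prod.ext ?_ (funext fun i => ?_)
    · apply Complex.ext <;> simp [toC4, brieskornReflection]
    · apply Complex.ext <;> fin_cases i <;> simp [toC4, brieskornReflection, diagAct, imCoord]

/-- Equivariance holds for the invariants themselves and passes through `toSphere`, whose scale
depends only on `|z₀|`. -/
theorem equivariantlyDiffeomorphic_of_odd {n : ℤ} (hn : Odd n) :
    EquivariantlyDiffeomorphic (𝓡 7) 𝓘(ℝ, C4)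
      (fun g : (ℤˣ × ℤˣ) × unitary ℍ[ℝ] => bullet n g.1 g.2) (Sigma5 n)
      (fun g => brieskornAct 3 g.1 g.2) (brieskornW 3) := by
  have hX : ∀ x ∈ Sigma5 n, toC4 (oddMap n x) ∈ modelX := fun x hx =>
    toC4_mem_modelX (isModelPoint_oddMap hn hx)
  refine equivariantlyDiffeomorphic_of_local_sections (brieskornMap n)
    (fun g => mapsTo_bullet_Sigma5 n g.1 g.2) (fun x hx => toSphere_mem (hX x hx)) ?_
    (fun x hx => eventually_contMDiffAt_brieskornMap hn hx)
    (fun z hz => exists_brieskornSect hn hz) ?_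
  · intro x hx y hy hxy
    refine injOn_oddMap hn hx hy ?_
    have h := congrArg (fun z => ofC4 (ofSphere z)) hxy
    simp only [brieskornMap] at h
    rwa [ofSphere_toSphere (hX x hx), ofSphere_toSphere (hX y hy),
      ofC4_toC4 (isModelPoint_oddMap hn hx), ofC4_toC4 (isModelPoint_oddMap hn hy)] at h
  · rintro ⟨B, q⟩ x hx
    change toSphere (toC4 (oddMap n (bullet n B q x))) =
      brieskornAct 3 B q (toSphere (toC4 (oddMap n x)))
    rw [oddMap_bullet, ← brieskornAct_toC4 B q (isModelPoint_oddMap hn hx)]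
    exact toSphere_comm (brieskornAct_dilate B q) (norm_brieskornAct_fst B q) _

end GromollMeyer

end

theorem proposition3 (n : ℤ) :
    (∀ (B : ℤˣ × ℤˣ) (q : unitary ℍ[ℝ]), Set.MapsTo (bullet n B q) (Sigma5 n) (Sigma5 n)) ∧
    IsEmbeddedSubmanifold 7 5 (Sigma5 n) ∧
    (Even n → EquivariantlyDiffeomorphic (𝓡 7) 𝓘(ℝ, HH)
      (fun g : (ℤˣ × ℤˣ) × unitary ℍ[ℝ] => bullet n g.1 g.2) (Sigma5 n)
      (fun g => linearAct g.1 g.2) linearS5) ∧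
    (Odd n → EquivariantlyDiffeomorphic (𝓡 7) 𝓘(ℝ, C4)
      (fun g : (ℤˣ × ℤˣ) × unitary ℍ[ℝ] => bullet n g.1 g.2) (Sigma5 n)
      (fun g => brieskornAct 3 g.1 g.2) (brieskornW 3)) ∧
    (∀ g : SmoothMetric 7 (Sigma7 n),
      (∀ (ε : ℤˣ) (q : unitary ℍ[ℝ]), IsInvariantUnder g (bullet n (ε, ε) q)) →
        IsMinimalSubmanifold 5 g (Sigma5 n)) :=
  ⟨mapsTo_bullet_Sigma5 n, isEmbeddedSubmanifold_Sigma5 n, equivariantlyDiffeomorphic_of_even,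
    equivariantlyDiffeomorphic_of_odd, isMinimalSubmanifold_Sigma5 n⟩
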